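/- **Inclusion logic.** Fix a first-order signature $\mathscr L$ with equality and a countably infinite set of variables. First-order formulas are $\alpha::=\bot\mid t=t'\mid Rt_1\dots t_n\mid\neg\alpha\mid\alpha\wedge\alpha\mid\alpha\vee\alpha\mid\exists x\alpha\mid\forall x\alpha$. Formulas of inclusion logic $\mathsf{Inc}$ are $$\phi::=\bot\mid\alpha\mid\neg\alpha\mid x_1\dots x_n\subseteq y_1\dots y_n\mid\phi\wedge\phi\mid\phi\vee\phi\mid\exists x\phi\mid\forall x\phi$$ with $\alpha$ first-order; all variables of an inclusion atom are free in it, and a sentence is a formula without free variables. Put $\alpha\leftrightarrow\beta:=(\neg\alpha\vee\beta)\wedge(\neg\beta\vee\alpha)$; an empty conjunction is $\top:=\neg\bot$. *Semantics.* Models have at least two elements; a team $X$ of $M$ is a set of assignments (with a common domain containing the relevant free variables). $M\models_X\bot$ iff $X=\emptyset$; $M\models_X\alpha$ iff all $s\in X$ satisfy $\alpha$, for $\alpha$ first-order; $M\models_X\mathsf x\subseteq\mathsf y$ iff for each $s\in X$ there is $s'\in X$ with $s(\mathsf x)=s'(\mathsf y)$; $\wedge$ is "and"; $M\models_X\phi\vee\psi$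 iff $X=Y\cup Z$ with $M\models_Y\phi$ and $M\models_Z\psi$; $M\models_X\exists x\phi$ iff there is $F:X\to\wp(M)\setminus\{\emptyset\}$ such that $M\models_{X(F/x)}\phi$ with $X(F/x)=\{s(a/x)\mid s\in X,a\in F(s)\}$; $M\models_X\forall x\phi$ iff $M\models_{X(M/x)}\phi$ with $X(M/x)=\{s(a/x)\mid s\in X,a\in M\}$. Two formulas are semantically equivalent, $\phi\equiv\psi$, if they are satisfied by the same teams of every model. *Deduction.* $\Gamma\vdash\phi$ means that $\phi$ has a natural deduction derivation with all undischarged assumptions in $\Gamma$, by the following rules. Here $\alpha$ is first-order, $[\cdot]$ marks discharged assumptions, every substituted term is free for the variable it replaces and is a variable if it enters an inclusion atom, both sides of every inclusion atom have equal length, and corresponding blocks in it have equal length. - $t=t$; from $t=t'$ and $\phi(t/x)$ infer $\phi(t'/x)$. - From a derivation of $\bot$ from $[\alpha]$ infer $\neg\alpha$, and from a derivation of $\bot$ from $[\neg\alpha]$ infer $\alpha$, if its other assumptions are first-order; from $\alpha,\neg\alpha$ infer any $\phi$. - The usual introduction and elimination rules for $\wedge$ and introduction rules for $\vee$; from $\phi\vee\psi$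 and derivations of $\chi$ from $[\phi]$ and of $\chi$ from $[\psi]$ infer $\chi$, if the other assumptions of these two derivations are first-order. - From $\phi(t/x)$ infer $\exists x\phi$; from $\exists x\phi$ and a derivation of $\psi$ from $[\phi]$ infer $\psi$, if $x$ is not free in $\psi$ or in the other assumptions of this derivation. - From $\phi$ infer $\forall x\phi$, if $x$ is not free in the assumptions used; from $\forall x\alpha$ infer $\alpha(t/x)$; from $\forall x\phi$ infer $\phi$, if $x$ is not free in $\phi$; from $\forall x\phi$ and a derivation of $\psi$ from $[\phi(y/x)]$ infer $\forall y\psi$, if $y$ is not free in $\forall x\phi$ or in the other assumptions of this derivation; from $\forall x\forall y\phi$ infer $\forall y\forall x\phi$; from $\forall x\phi$ and $\forall x\psi$ infer $\forall x(\phi\wedge\psi)$; infer $\exists y\exists z\forall x((\phi\wedge y=z)\vee(\psi\wedge\neg\,y=z))$ from $\forall x\phi\vee\psi$ and conversely, if $x$ is not free in $\psi$ and $y,z$ are distinct and fresh. - From $\mathsf{xyz}\subseteq\mathsf{uvw}$ infer $\mathsf{yxz}\subseteq\mathsf{vuw}$; from $\mathsf{xy}\subseteq\mathsf{uv}$ infer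 $\mathsf x\subseteq\mathsf u$; from $\mathsf x\subseteq\mathsf y$ and $\mathsf y\subseteq\mathsf z$ infer $\mathsf x\subseteq\mathsf z$. - For a sequence $\mathsf z$ of distinct variables containing all free variables of $\alpha$: from $\mathsf y\subseteq\mathsf x$ and $\alpha(\mathsf x/\mathsf z)$ infer $\alpha(\mathsf y/\mathsf z)$; from a derivation of $\bot$ from $[\mathsf y\subseteq\mathsf x]$ and $[\neg\alpha(\mathsf y/\mathsf z)]$ infer $\alpha(\mathsf x/\mathsf z)$, if the variables $\mathsf y$ are distinct, not among $\mathsf x$, and not free in the other assumptions. - From $\mathsf x\subseteq\mathsf y$ infer $\exists w(\mathsf xw\subseteq\mathsf yz)$, and also $\forall w(\mathsf xz\subseteq\mathsf yw)$, if $w$ is not among $\mathsf{xy}z$. - Infer $\exists\mathsf x\forall\mathsf y(\mathsf{zy}\subseteq\mathsf{zx}\wedge\phi)$ from $\forall\mathsf x\phi$ and conversely, if the free variables of $\phi$ are among $\mathsf{xz}$, $\mathsf x$ consists of distinct variables not in $\mathsf z$, and $\mathsf y$ consists of distinct fresh variables. - From $\exists\mathsf x(\bigwedge_{i\in I}\mathsf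 u_i\subseteq\mathsf v_i\wedge\alpha)\vee\phi$ infer $\exists\mathsf x\exists p\exists q(\bigwedge_{i\in I}\mathsf u_ipq\subseteq\mathsf v_ipq\wedge(\alpha\leftrightarrow p=q)\wedge(\alpha\vee\phi))$, if $\mathsf x$ consists of distinct variables not free in $\phi$, each $\mathsf u_i$ and each $\mathsf v_i$ is a sequence of distinct variables from $\mathsf x$, and $p,q$ are distinct and fresh. **Normal form.** A sentence is in normal form if it is $$\exists\mathsf w\exists\mathsf x\forall y\Big(\bigwedge_{i\in I}\rho^i_{\mathsf w}\subseteq\sigma^i_{\mathsf w}\wedge\bigwedge_{j\in J}\pi^j_{\mathsf x}y\subseteq\tau^j_{\mathsf x}\wedge\alpha(\mathsf w,\mathsf x)\Big),$$ where $\mathsf w,\mathsf x,y$ are distinct variables, $I,J$ are finite, $\alpha$ is first-order and quantifier-free, and each of $\rho^i,\sigma^i,\pi^j,\tau^j$ selects, by fixed distinct positions, a sequence of variables from the sequence in its subscript. **Approximations.** Let a sentence in normal form be given. Let $L_0=\{0\}$ and, for $n\ge 0$, let $L_{n+1}=E_{n+1}\cup U_{n+1}$, where $E_{n+1}=\{\langle\xi,i\rangle\mid\xi\in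 L_n,i\in I\}$, $U_{n+1}=\{\langle\xi\eta,j\rangle\mid\xi\eta\in A_{n+1},j\in J\}$, and $A_{n+1}$ is the set of pairs $\xi\eta$ with $\xi\in L_0\cup\dots\cup L_n$, $\eta\in\{0,\dots,n\}$ and $\xi\eta\notin A_1\cup\dots\cup A_n$. Take pairwise distinct variables forming sequences $\mathsf w_\xi,\mathsf x_\xi$ (copies of $\mathsf w,\mathsf x$) and $y_n$. Put $\mathsf w^n=\langle\mathsf w_\xi\mid\xi\in L_n\rangle$, $\mathsf x^n=\langle\mathsf x_\xi\mid\xi\in L_n\rangle$, $\alpha_n=\bigwedge_{\xi\in L_n}\alpha(\mathsf w_\xi,\mathsf x_\xi)$ and $$\gamma_{n+1}=\bigwedge_{\xi\in L_n,\,i\in I}\rho^i_{\mathsf w_\xi}=\sigma^i_{\mathsf w_{\langle\xi,i\rangle}},\qquad\delta_{n+1}=\bigwedge_{\xi\eta\in A_{n+1},\,j\in J}\pi^j_{\mathsf x_\xi}y_\eta=\tau^j_{\mathsf x_{\langle\xi\eta,j\rangle}}.$$ The $n$-th approximation of the game expression of the sentence is the first-order sentence $$\Phi_n:=\exists\mathsf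 w^0\mathsf x^0\forall y_0\Big(\alpha_0\wedge\exists\mathsf w^1\mathsf x^1\forall y_1\big(\alpha_1\wedge\gamma_1\wedge\delta_1\wedge\dots\wedge\exists\mathsf w^n\mathsf x^n\forall y_n(\alpha_n\wedge\gamma_n\wedge\delta_n)\dots\big)\Big).$$ **Lemma.** (a) If $\phi$ is an $\mathsf{Inc}$-sentence in normal form and $\Phi_n$ are the approximations of its game expression, then $\phi\vdash\Phi_n$ for every $n<\omega$. (b) For every $\mathsf{Inc}$-sentence $\phi$ there is a sentence $\phi'\equiv\phi$ in normal form such that $\phi\vdash\Phi_n$ for every $n<\omega$, where $\Phi_n$ are the approximations of the game expression of $\phi'$. -/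

import Mathlib

universe u v w

namespace IncLogic

/-! ## Formulas of inclusion logic -/

/-- Raw formulas over the signature `L`, with variables named by natural numbers.
`inc xs ys` is the inclusion atom `x₁ … xₙ ⊆ y₁ … yₙ`. The formulas of inclusion logic are the raw
formulas satisfying `Form.WF`, the first-order formulas those satisfying `Form.IsFO`. -/
inductive Form (L : FirstOrder.Language.{u, v}) : Type (max u v) where
  | bot : Form L
  | eq (t s : L.Term ℕ) : Form L
  | rel {n : ℕ} (R : L.Relations n) (ts : Fin n → L.Term ℕ) : Form L
  | inc (xs ys : List ℕ) : Form L
  | neg (φ : Form L) : Form L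
  | and (φ ψ : Form L) : Form L
  | or (φ ψ : Form L) : Form L
  | ex (x : ℕ) (φ : Form L) : Form L
  | all (x : ℕ) (φ : Form L) : Form L

namespace Form

variable {L : FirstOrder.Language.{u, v}}

/-- First-order formulas: no inclusion atom occurs. -/
def IsFO : Form L → Prop
  | bot => True
  | eq _ _ => True
  | rel _ _ => True
  | inc _ _ => False
  | neg φ => φ.IsFO
  | and φ ψ => φ.IsFO ∧ ψ.IsFO
  | or φ ψ => φ.IsFO ∧ ψ.IsFO
  | ex _ φ => φ.IsFO
  | all _ φ => φ.IsFO

/-- Formulas of inclusion logic: negation is applied to first-order formulas only, and the two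
sides of an inclusion atom have the same length. -/
def WF : Form L → Prop
  | bot => True
  | eq _ _ => True
  | rel _ _ => True
  | inc xs ys => xs.length = ys.length
  | neg φ => φ.IsFO
  | and φ ψ => φ.WF ∧ ψ.WF
  | or φ ψ => φ.WF ∧ ψ.WF
  | ex _ φ => φ.WF
  | all _ φ => φ.WF

/-- Free variables. -/
def fv : Form L → Finset ℕ
  | bot => ∅
  | eq t s => t.varFinset ∪ s.varFinset
  | rel _ ts => Finset.univ.biUnion fun i => (ts i).varFinset
  | inc xs ys => xs.toFinset ∪ ys.toFinset
  | neg φ => φ.fv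
  | and φ ψ => φ.fv ∪ ψ.fv
  | or φ ψ => φ.fv ∪ ψ.fv
  | ex x φ => φ.fv.erase x
  | all x φ => φ.fv.erase x

/-- All variables that occur, free or bound; a variable is fresh for `φ` if it is not in
`φ.vars`. -/
def vars : Form L → Finset ℕ
  | bot => ∅
  | eq t s => t.varFinset ∪ s.varFinset
  | rel _ ts => Finset.univ.biUnion fun i => (ts i).varFinset
  | inc xs ys => xs.toFinset ∪ ys.toFinset
  | neg φ => φ.vars
  | and φ ψ => φ.vars ∪ ψ.vars
  | or φ ψ => φ.vars ∪ ψ.vars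
  | ex x φ => insert x φ.vars
  | all x φ => insert x φ.vars

/-- Sentences of inclusion logic. -/
def IsSentence (φ : Form L) : Prop := φ.WF ∧ φ.fv = ∅

/-- The variable substituted for `x` inside an inclusion atom. If `σ x` is not a variable the
value is irrelevant, since `Admissible` excludes that case. -/
def varSub (σ : ℕ → L.Term ℕ) (x : ℕ) : ℕ :=
  match σ x with
  | .var y => y
  | .func _ _ => x

/-- Simultaneous substitution of terms for the free variables. -/
def subst : (ℕ → L.Term ℕ) → Form L → Form L
  | _, bot => bot
  | σ, eq t s => eq (t.subst σ) (s.subst σ)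
  | σ, rel R ts => rel R fun i => (ts i).subst σ
  | σ, inc xs ys => inc (xs.map (varSub σ)) (ys.map (varSub σ))
  | σ, neg φ => neg (subst σ φ)
  | σ, and φ ψ => and (subst σ φ) (subst σ ψ)
  | σ, or φ ψ => or (subst σ φ) (subst σ ψ)
  | σ, ex x φ => ex x (subst (Function.update σ x (.var x)) φ)
  | σ, all x φ => all x (subst (Function.update σ x (.var x)) φ)

/-- The terms `σ x` are free for `x` in the formula (no variable is captured by a quantifier), and
only variables are substituted into inclusion atoms, so that the result is again a formula. -/
def Admissible : (ℕ → L.Term ℕ) → Form L → Prop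
  | _, bot => True
  | _, eq _ _ => True
  | _, rel _ _ => True
  | σ, inc xs ys => ∀ x ∈ xs ++ ys, ∃ y : ℕ, σ x = .var y
  | σ, neg φ => Admissible σ φ
  | σ, and φ ψ => Admissible σ φ ∧ Admissible σ ψ
  | σ, or φ ψ => Admissible σ φ ∧ Admissible σ ψ
  | σ, ex x φ => (∀ z ∈ φ.fv, z ≠ x → x ∉ (σ z).varFinset) ∧
      Admissible (Function.update σ x (.var x)) φ
  | σ, all x φ => (∀ z ∈ φ.fv, z ≠ x → x ∉ (σ z).varFinset) ∧
      Admissible (Function.update σ x (.var x)) φ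

/-- The substitution `t/x`. -/
def single (x : ℕ) (t : L.Term ℕ) : ℕ → L.Term ℕ :=
  Function.update (fun y => .var y) x t

/-- The substitution `x₁ … xₙ / z₁ … zₙ` of variables for (distinct) variables. -/
def seqSub (xs zs : List ℕ) : ℕ → L.Term ℕ :=
  fun z => .var (((zs.zip xs).lookup z).getD z)

/-- Truth, written `⊤`. -/
def top : Form L := neg bot

/-- `φ → ψ` is `¬φ ∨ ψ`. -/
def imp (φ ψ : Form L) : Form L := or (neg φ) ψ

/-- `φ ↔ ψ`. -/
def iff (φ ψ : Form L) : Form L := and (imp φ ψ) (imp ψ φ)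

/-- Equality of two variables. -/
def veq (x y : ℕ) : Form L := eq (.var x) (.var y)

/-- Finite conjunction; the empty one is `⊤`. -/
def conj : List (Form L) → Form L
  | [] => top
  | [φ] => φ
  | φ :: ψ :: l => and φ (conj (ψ :: l))

/-- Equality `x₁ … xₙ = y₁ … yₙ` of sequences of variables of the same length. -/
def seqEq (xs ys : List ℕ) : Form L := conj (List.zipWith veq xs ys)

/-- `∃x₁ … ∃xₙ φ`. -/
def exs (xs : List ℕ) (φ : Form L) : Form L := xs.foldr ex φ

/-- `∀x₁ … ∀xₙ φ`. -/
def alls (xs : List ℕ) (φ : Form L) : Form L := xs.foldr all φ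

/-! ## Team semantics -/

section Semantics

variable {M : Type w} [L.Structure M]

/-- Tarski semantics. It is used for first-order formulas only (the value at inclusion atoms is
irrelevant). -/
def Holds : (ℕ → M) → Form L → Prop
  | _, bot => False
  | s, eq t r => t.realize s = r.realize s
  | s, rel R ts => FirstOrder.Language.Structure.RelMap R fun i => (ts i).realize s
  | s, inc xs ys => xs.map s = ys.map s
  | s, neg φ => ¬ Holds s φ
  | s, and φ ψ => Holds s φ ∧ Holds s ψ
  | s, or φ ψ => Holds s φ ∨ Holds s ψ
  | s, ex x φ => ∃ a : M, Holds (Function.update s x a) φ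
  | s, all x φ => ∀ a : M, Holds (Function.update s x a) φ

/-- (Lax) team semantics. A team is a set of assignments; by locality assignments may be taken to
be defined on all variables. -/
def Sat : Set (ℕ → M) → Form L → Prop
  | X, bot => X = ∅
  | X, eq t r => ∀ s ∈ X, t.realize s = r.realize s
  | X, rel R ts => ∀ s ∈ X, FirstOrder.Language.Structure.RelMap R fun i => (ts i).realize s
  | X, inc xs ys => ∀ s ∈ X, ∃ r ∈ X, xs.map s = ys.map r
  | X, neg φ => ∀ s ∈ X, ¬ Holds s φ
  | X, and φ ψ => Sat X φ ∧ Sat X ψ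
  | X, or φ ψ => ∃ Y Z : Set (ℕ → M), X = Y ∪ Z ∧ Sat Y φ ∧ Sat Z ψ
  | X, ex x φ => ∃ F : (ℕ → M) → Set M, (∀ s ∈ X, (F s).Nonempty) ∧
      Sat {r | ∃ s ∈ X, ∃ a ∈ F s, r = Function.update s x a} φ
  | X, all x φ => Sat {r | ∃ s ∈ X, ∃ a : M, r = Function.update s x a} φ

end Semantics

/-- Semantic equivalence over all models (with at least two elements) and all teams. -/
def SemEquiv (φ ψ : Form L) : Prop :=
  ∀ (M : Type w) [L.Structure M] [Nontrivial M] (X : Set (ℕ → M)), Sat X φ ↔ Sat X ψ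

end Form

/-! ## The system of natural deduction -/

open Form in
/-- `Deriv Γ φ` says that `φ` has a natural deduction derivation all of whose undischarged
assumptions belong to `Γ`. In a rule that discharges an assumption of a subderivation, or that has
a side condition on the undischarged assumptions of a subderivation, these undischarged assumptions
are collected in a set `Δ ⊆ Γ`. The hypotheses `WF` only ensure that all formulas are formulas of
inclusion logic. -/
inductive Deriv {L : FirstOrder.Language.{u, v}} : Set (Form L) → Form L → Prop
  | ass {Γ : Set (Form L)} {φ : Form L} (hw : φ.WF) (h : φ ∈ Γ) : Deriv Γ φ
  -- equality
  | eqI {Γ : Set (Form L)} (t : L.Term ℕ) : Deriv Γ (eq t t)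
  | eqSub {Γ : Set (Form L)} {t r : L.Term ℕ} {x : ℕ} {φ : Form L} (hw : φ.WF)
      (ht : Admissible (single x t) φ) (hr : Admissible (single x r) φ)
      (h : Deriv Γ (eq t r)) (h1 : Deriv Γ (subst (single x t) φ)) :
      Deriv Γ (subst (single x r) φ)
  -- negation (of first-order formulas)
  | negI {Γ Δ : Set (Form L)} {α : Form L} (ha : α.IsFO) (hs : Δ ⊆ Γ) (hfo : ∀ δ ∈ Δ, δ.IsFO)
      (h : Deriv (insert α Δ) bot) : Deriv Γ (neg α)
  | negE {Γ : Set (Form L)} {α φ : Form L} (ha : α.IsFO) (hw : φ.WF)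
      (h : Deriv Γ α) (h1 : Deriv Γ (neg α)) : Deriv Γ φ
  | raa {Γ Δ : Set (Form L)} {α : Form L} (ha : α.IsFO) (hs : Δ ⊆ Γ) (hfo : ∀ δ ∈ Δ, δ.IsFO)
      (h : Deriv (insert (neg α) Δ) bot) : Deriv Γ α
  -- conjunction and disjunction
  | andI {Γ : Set (Form L)} {φ ψ : Form L} (h : Deriv Γ φ) (h1 : Deriv Γ ψ) : Deriv Γ (and φ ψ)
  | andE1 {Γ : Set (Form L)} {φ ψ : Form L} (h : Deriv Γ (and φ ψ)) : Deriv Γ φ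
  | andE2 {Γ : Set (Form L)} {φ ψ : Form L} (h : Deriv Γ (and φ ψ)) : Deriv Γ ψ
  | orI1 {Γ : Set (Form L)} {φ ψ : Form L} (hw : ψ.WF) (h : Deriv Γ φ) : Deriv Γ (or φ ψ)
  | orI2 {Γ : Set (Form L)} {φ ψ : Form L} (hw : ψ.WF) (h : Deriv Γ φ) : Deriv Γ (or ψ φ)
  | orE {Γ Δ₀ Δ₁ : Set (Form L)} {φ ψ χ : Form L}
      (hs₀ : Δ₀ ⊆ Γ) (hs₁ : Δ₁ ⊆ Γ) (hfo₀ : ∀ δ ∈ Δ₀, δ.IsFO) (hfo₁ : ∀ δ ∈ Δ₁, δ.IsFO)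
      (h : Deriv Γ (or φ ψ)) (h₀ : Deriv (insert φ Δ₀) χ) (h₁ : Deriv (insert ψ Δ₁) χ) :
      Deriv Γ χ
  -- existential quantifier
  | exI {Γ : Set (Form L)} {x : ℕ} {t : L.Term ℕ} {φ : Form L} (hw : φ.WF)
      (ht : Admissible (single x t) φ) (h : Deriv Γ (subst (single x t) φ)) : Deriv Γ (ex x φ)
  | exE {Γ Δ : Set (Form L)} {x : ℕ} {φ ψ : Form L} (hs : Δ ⊆ Γ)
      (hx : x ∉ ψ.fv) (hΔ : ∀ δ ∈ Δ, x ∉ δ.fv)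
      (h : Deriv Γ (ex x φ)) (h1 : Deriv (insert φ Δ) ψ) : Deriv Γ ψ
  -- universal quantifier
  | allI {Γ Δ : Set (Form L)} {x : ℕ} {φ : Form L} (hs : Δ ⊆ Γ) (hΔ : ∀ δ ∈ Δ, x ∉ δ.fv)
      (h : Deriv Δ φ) : Deriv Γ (all x φ)
  | allE {Γ : Set (Form L)} {x : ℕ} {t : L.Term ℕ} {α : Form L} (ha : α.IsFO)
      (ht : Admissible (single x t) α) (h : Deriv Γ (all x α)) : Deriv Γ (subst (single x t) α)
  | allE₀ {Γ : Set (Form L)} {x : ℕ} {φ : Form L} (hx : x ∉ φ.fv)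
      (h : Deriv Γ (all x φ)) : Deriv Γ φ
  | allSub {Γ Δ : Set (Form L)} {x y : ℕ} {φ ψ : Form L} (hs : Δ ⊆ Γ)
      (hy : y ∉ (all x φ).fv) (hΔ : ∀ δ ∈ Δ, y ∉ δ.fv)
      (ht : Admissible (single x (.var y)) φ)
      (h : Deriv Γ (all x φ)) (h1 : Deriv (insert (subst (single x (.var y)) φ) Δ) ψ) :
      Deriv Γ (all y ψ)
  | allExc {Γ : Set (Form L)} {x y : ℕ} {φ : Form L}
      (h : Deriv Γ (all x (all y φ))) : Deriv Γ (all y (all x φ))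
  | allAndExt {Γ : Set (Form L)} {x : ℕ} {φ ψ : Form L}
      (h : Deriv Γ (all x φ)) (h1 : Deriv Γ (all x ψ)) : Deriv Γ (all x (and φ ψ))
  | allOrExt {Γ : Set (Form L)} {x y z : ℕ} {φ ψ : Form L} (hx : x ∉ ψ.fv)
      (hyz : y ≠ z) (hy : y ∉ insert x (φ.vars ∪ ψ.vars)) (hz : z ∉ insert x (φ.vars ∪ ψ.vars))
      (h : Deriv Γ (or (all x φ) ψ)) :
      Deriv Γ (ex y (ex z (all x (or (and φ (veq y z)) (and ψ (neg (veq y z)))))))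
  | allOrExtInv {Γ : Set (Form L)} {x y z : ℕ} {φ ψ : Form L} (hx : x ∉ ψ.fv)
      (hyz : y ≠ z) (hy : y ∉ insert x (φ.vars ∪ ψ.vars)) (hz : z ∉ insert x (φ.vars ∪ ψ.vars))
      (h : Deriv Γ (ex y (ex z (all x (or (and φ (veq y z)) (and ψ (neg (veq y z)))))))) :
      Deriv Γ (or (all x φ) ψ)
  -- inclusion atoms
  | incExc {Γ : Set (Form L)} {xs ys zs us vs ws : List ℕ}
      (h₁ : xs.length = us.length) (h₂ : ys.length = vs.length) (h₃ : zs.length = ws.length)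
      (h : Deriv Γ (inc (xs ++ ys ++ zs) (us ++ vs ++ ws))) :
      Deriv Γ (inc (ys ++ xs ++ zs) (vs ++ us ++ ws))
  | incCtr {Γ : Set (Form L)} {xs ys us vs : List ℕ}
      (h₁ : xs.length = us.length) (h₂ : ys.length = vs.length)
      (h : Deriv Γ (inc (xs ++ ys) (us ++ vs))) : Deriv Γ (inc xs us)
  | incTrs {Γ : Set (Form L)} {xs ys zs : List ℕ}
      (h : Deriv Γ (inc xs ys)) (h1 : Deriv Γ (inc ys zs)) : Deriv Γ (inc xs zs)
  | incCmp {Γ : Set (Form L)} {xs ys zs : List ℕ} {α : Form L} (ha : α.IsFO)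
      (hz : zs.Nodup) (hlx : xs.length = zs.length) (hly : ys.length = zs.length)
      (hfv : α.fv ⊆ zs.toFinset)
      (hx : Admissible (seqSub xs zs) α) (hy : Admissible (seqSub ys zs) α)
      (h : Deriv Γ (inc ys xs)) (h1 : Deriv Γ (subst (seqSub xs zs) α)) :
      Deriv Γ (subst (seqSub ys zs) α)
  | incExp {Γ Δ : Set (Form L)} {xs ys zs : List ℕ} {α : Form L} (ha : α.IsFO) (hs : Δ ⊆ Γ)
      (hz : zs.Nodup) (hlx : xs.length = zs.length) (hly : ys.length = zs.length)
      (hfv : α.fv ⊆ zs.toFinset)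
      (hx : Admissible (seqSub xs zs) α) (hy : Admissible (seqSub ys zs) α)
      (hyn : ys.Nodup) (hyx : ys.Disjoint xs) (hΔ : ∀ δ ∈ Δ, ∀ y ∈ ys, y ∉ δ.fv)
      (h : Deriv (insert (inc ys xs) (insert (neg (subst (seqSub ys zs) α)) Δ)) bot) :
      Deriv Γ (subst (seqSub xs zs) α)
  | incWEx {Γ : Set (Form L)} {xs ys : List ℕ} {w z : ℕ} (hw : w ∉ xs ++ ys ++ [z])
      (h : Deriv Γ (inc xs ys)) : Deriv Γ (ex w (inc (xs ++ [w]) (ys ++ [z])))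
  | incWAll {Γ : Set (Form L)} {xs ys : List ℕ} {w z : ℕ} (hw : w ∉ xs ++ ys ++ [z])
      (h : Deriv Γ (inc xs ys)) : Deriv Γ (all w (inc (xs ++ [z]) (ys ++ [w])))
  | allSim {Γ : Set (Form L)} {xs ys zs : List ℕ} {φ : Form L}
      (hx : xs.Nodup) (hxz : xs.Disjoint zs) (hfv : φ.fv ⊆ (xs ++ zs).toFinset)
      (hl : ys.length = xs.length) (hyn : ys.Nodup) (hyxz : ys.Disjoint (xs ++ zs))
      (hy : ∀ y ∈ ys, y ∉ φ.vars)
      (h : Deriv Γ (alls xs φ)) :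
      Deriv Γ (exs xs (alls ys (and (inc (zs ++ ys) (zs ++ xs)) φ)))
  | allSimInv {Γ : Set (Form L)} {xs ys zs : List ℕ} {φ : Form L}
      (hx : xs.Nodup) (hxz : xs.Disjoint zs) (hfv : φ.fv ⊆ (xs ++ zs).toFinset)
      (hl : ys.length = xs.length) (hyn : ys.Nodup) (hyxz : ys.Disjoint (xs ++ zs))
      (hy : ∀ y ∈ ys, y ∉ φ.vars)
      (h : Deriv Γ (exs xs (alls ys (and (inc (zs ++ ys) (zs ++ xs)) φ)))) :
      Deriv Γ (alls xs φ)
  | exIncExt {Γ : Set (Form L)} {xs : List ℕ} {ps : List (List ℕ × List ℕ)} {α φ : Form L}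
      {p q : ℕ} (ha : α.IsFO) (hx : xs.Nodup)
      (hps : ∀ a ∈ ps, a.1.length = a.2.length ∧ a.1.Nodup ∧ a.2.Nodup ∧ a.1 ⊆ xs ∧ a.2 ⊆ xs)
      (hφ : ∀ x ∈ xs, x ∉ φ.fv)
      (hpq : p ≠ q) (hp : p ∉ xs.toFinset ∪ α.vars ∪ φ.vars) (hq : q ∉ xs.toFinset ∪ α.vars ∪ φ.vars)
      (h : Deriv Γ (or (exs xs (and (conj (ps.map fun a => inc a.1 a.2)) α)) φ)) :
      Deriv Γ (exs xs (ex p (ex q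
        (and (conj (ps.map fun a => inc (a.1 ++ [p, q]) (a.2 ++ [p, q])))
          (and (iff α (veq p q)) (or α φ))))))

/-! ## Normal forms and the finite approximations of the game expression -/

/-- Quantifier-free first-order formulas with variables in `V`. -/
inductive QF (L : FirstOrder.Language.{u, v}) (V : Type) : Type (max u v) where
  | bot : QF L V
  | eq (t s : L.Term V) : QF L V
  | rel {n : ℕ} (R : L.Relations n) (ts : Fin n → L.Term V) : QF L V
  | neg (φ : QF L V) : QF L V
  | and (φ ψ : QF L V) : QF L V
  | or (φ ψ : QF L V) : QF L V

/-- The formula obtained by taking the variable named `f a` for each `a : V`. -/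
def QF.inst {L : FirstOrder.Language.{u, v}} {V : Type} (f : V → ℕ) : QF L V → Form L
  | .bot => .bot
  | .eq t s => .eq (t.relabel f) (s.relabel f)
  | .rel R ts => .rel R fun i => (ts i).relabel f
  | .neg φ => .neg (φ.inst f)
  | .and φ ψ => .and (φ.inst f) (ψ.inst f)
  | .or φ ψ => .or (φ.inst f) (ψ.inst f)

/-- The data of a sentence in normal form
`∃w ∃x ∀y (⋀_{i ∈ I} ρⁱ_w ⊆ σⁱ_w ∧ ⋀_{j ∈ J} πʲ_x y ⊆ τʲ_x ∧ α(w, x))`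
with `α` quantifier-free and first-order. Here `w = wv 0 … wv (nw-1)`, `x = xv 0 … xv (nx-1)` and
`y = yv` are distinct variables, `I = Fin nI`, `J = Fin nJ`, and `ρⁱ_w = w_{ρ i 0} w_{ρ i 1} …` and
so on are sequences of distinct variables from `w` or `x`. -/
structure NormalForm (L : FirstOrder.Language.{u, v}) where
  nw : ℕ
  nx : ℕ
  wv : Fin nw → ℕ
  xv : Fin nx → ℕ
  yv : ℕ
  distinct : (List.ofFn wv ++ List.ofFn xv ++ [yv]).Nodup
  nI : ℕ
  lenI : Fin nI → ℕ
  ρ : (i : Fin nI) → Fin (lenI i) ↪ Fin nw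
  σ : (i : Fin nI) → Fin (lenI i) ↪ Fin nw
  nJ : ℕ
  lenJ : Fin nJ → ℕ
  π : (j : Fin nJ) → Fin (lenJ j) ↪ Fin nx
  τ : (j : Fin nJ) → Fin (lenJ j + 1) ↪ Fin nx
  α : QF L (Fin nw ⊕ Fin nx)

/-- The indices `ξ` of the sequences `w_ξ`, `x_ξ` in the game expression: the index `0`, the
indices `⟨ξ, i⟩` of the witnesses for `ρⁱ_w ⊆ σⁱ_w` with respect to `w_ξ`, and the indices
`⟨ξη, j⟩` of the witnesses for `πʲ_x y ⊆ τʲ_x` with respect to `x_ξ y_η`. -/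
inductive Idx : Type where
  | root : Idx
  | e (ξ : Idx) (i : ℕ) : Idx
  | u (ξ : Idx) (η : ℕ) (j : ℕ) : Idx

/-- An injective coding of indices, used to choose pairwise distinct variables. -/
def Idx.code : Idx → ℕ
  | .root => 0
  | .e ξ i => 2 * Nat.pair ξ.code i + 1
  | .u ξ η j => 2 * Nat.pair ξ.code (Nat.pair η j) + 2

/-- The `k`-th variable of the sequence `w_ξ`. -/
def wVar (ξ : Idx) (k : ℕ) : ℕ := 3 * Nat.pair ξ.code k

/-- The `k`-th variable of the sequence `x_ξ`. -/
def xVar (ξ : Idx) (k : ℕ) : ℕ := 3 * Nat.pair ξ.code k + 1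

/-- The variable `y_η`. -/
def yVar (η : ℕ) : ℕ := 3 * η + 2

namespace NormalForm

variable {L : FirstOrder.Language.{u, v}} (N : NormalForm L)

/-- The sentence in normal form. -/
def sentence : Form L :=
  .exs (List.ofFn N.wv) <| .exs (List.ofFn N.xv) <| .all N.yv <|
    .and
      (.conj <| List.ofFn fun i =>
        .inc (List.ofFn fun k => N.wv (N.ρ i k)) (List.ofFn fun k => N.wv (N.σ i k))) <|
    .and
      (.conj <| List.ofFn fun j =>
        .inc ((List.ofFn fun k => N.xv (N.π j k)) ++ [N.yv]) (List.ofFn fun k => N.xv (N.τ j k)))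
      (N.α.inst (Sum.elim N.wv N.xv))

/-- `E_{n+1}`, from the list `cur` of the elements of `E_n ∪ U_n`. -/
def nextE (cur : List Idx) : List Idx :=
  cur.flatMap fun ξ => (List.range N.nI).map fun i => .e ξ i

/-- `A_{n+1}`, from the list `old` of the indices in layers `< n` and the list `cur` of those in
layer `n`: the pairs `ξη` with `ξ` in a layer `≤ n` and `η ≤ n` that are new, that is, that do not
have both `ξ` in a layer `< n` and `η < n`. -/
def nextA (old cur : List Idx) (n : ℕ) : List (Idx × ℕ) :=
  (old.map fun ξ => (ξ, n)) ++ cur.flatMap fun ξ => (List.range (n + 1)).map fun η => (ξ, η)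

/-- `U_{n+1}`, from `A_{n+1}`. -/
def nextU (A : List (Idx × ℕ)) : List Idx :=
  A.flatMap fun a => (List.range N.nJ).map fun j => .u a.1 a.2 j

/-- The indices in layers `< n`, and the indices in layer `n`. -/
def layers : ℕ → List Idx × List Idx
  | 0 => ([], [.root])
  | n + 1 =>
    ((layers n).1 ++ (layers n).2,
      N.nextE (layers n).2 ++ N.nextU (nextA (layers n).1 (layers n).2 n))

/-- The list `E_n ∪ U_n` of the indices in layer `n`; layer `0` consists of the index `0`. -/
def layer (n : ℕ) : List Idx := (N.layers n).2

/-- The set `A_{n+1}`. -/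
def pairsSucc (n : ℕ) : List (Idx × ℕ) := nextA (N.layers n).1 (N.layers n).2 n

/-- `α(w_ξ, x_ξ)`. -/
def alphaAt (ξ : Idx) : Form L :=
  N.α.inst (Sum.elim (fun k : Fin N.nw => wVar ξ k) (fun k : Fin N.nx => xVar ξ k))

/-- `α_n`, the conjunction of the `α(w_ξ, x_ξ)` for `ξ` in layer `n`. -/
def alphaN (n : ℕ) : Form L := .conj ((N.layer n).map N.alphaAt)

/-- `γ_{n+1}`, the conjunction of the `ρⁱ_{w_ξ} = σⁱ_{w_{ξ,i}}` for `ξ` in layer `n`, `i ∈ I`. -/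
def gammaSucc (n : ℕ) : Form L :=
  .conj <| (N.layer n).flatMap fun ξ => List.ofFn fun i =>
    .seqEq (List.ofFn fun k => wVar ξ (N.ρ i k)) (List.ofFn fun k => wVar (.e ξ i) (N.σ i k))

/-- `δ_{n+1}`, the conjunction of the `πʲ_{x_ξ} y_η = τʲ_{x_{ξη,j}}` for `ξη ∈ A_{n+1}`,
`j ∈ J`. -/
def deltaSucc (n : ℕ) : Form L :=
  .conj <| (N.pairsSucc n).flatMap fun a => List.ofFn fun j =>
    .seqEq ((List.ofFn fun k => xVar a.1 (N.π j k)) ++ [yVar a.2])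
      (List.ofFn fun k => xVar (.u a.1 a.2 j) (N.τ j k))

/-- `α_n ∧ γ_n ∧ δ_n`, where `γ_0` and `δ_0` are absent. -/
def lambdaN : ℕ → Form L
  | 0 => N.alphaN 0
  | n + 1 => .and (N.alphaN (n + 1)) (.and (N.gammaSucc n) (N.deltaSucc n))

/-- The variables of `wⁿ` followed by those of `xⁿ`. -/
def layerVars (n : ℕ) : List ℕ :=
  ((N.layer n).flatMap fun ξ => (List.range N.nw).map fun k => wVar ξ k) ++
    (N.layer n).flatMap fun ξ => (List.range N.nx).map fun k => xVar ξ k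

/-- The layers `k, k + 1, …, k + r` of the game expression, nested:
`∃wᵏxᵏ ∀y_k (λ_k ∧ ∃wᵏ⁺¹xᵏ⁺¹ ∀y_{k+1} (λ_{k+1} ∧ … ))` with `λ_k` for `α_k ∧ γ_k ∧ δ_k`. -/
def nest : ℕ → ℕ → Form L
  | 0, k => .exs (N.layerVars k) (.all (yVar k) (N.lambdaN k))
  | r + 1, k => .exs (N.layerVars k) (.all (yVar k) (.and (N.lambdaN k) (nest r (k + 1))))

/-- The `n`-approximation `Φ_n` of the game expression. -/
def approx (n : ℕ) : Form L := N.nest n 0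

end NormalForm

end IncLogic

/-! Part (a). The matrix of a normal form says that the tuples of values of `w x` satisfy `α` and
are closed under two kinds of moves: each `ρⁱ`-part occurs as a `σⁱ`-part, and each `πʲ`-part
followed by the universally quantified `y` occurs as a `τʲ`-part. To derive an approximation, rename
the bound variables apart from all `w_ξ`, `x_ξ`, `y_η`, assume the matrix, and answer every move by
a tuple from this set; the invariant is the inclusion atom `w_ξ x_ξ ⊆ w x`. The invariant and the
matrix give `ρⁱ_{w_ξ} ⊆ σⁱ_w` and, as a value may be appended to an inclusion under a universal
quantifier, `πʲ_{x_ξ} y_η ⊆ τʲ_x`. Weakening extends such an atom by a fresh copy of all of `w x`,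
for instance to `ρⁱ_{w_ξ} w_ζ x_ζ ⊆ σⁱ_w w x` (`Deriv.inc_block`). Projecting it yields the
invariant for `ζ`. Two columns of the left side over the same variable of the right side are equal,
which gives `γ` and `δ` (`Deriv.seqEq_of_inc`). First-order formulas pass along inclusion atoms,
which gives `α` (`Deriv.inst_of_inc`). The assumptions made up to layer `k` mention `y_η` for `η <
k` only, so `y_k` may be generalized (`NormalForm.deriv_layer`). Part (b). By (a) it is enough to
find a sentence in normal form that is equivalent to `φ` and derivable from `φ`. The relation `Red`
combines these two demands with a control of free variables and is a congruence for the connectives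
other than negation and for the quantifiers. Two classes of formulas are shown to be closed under
these operations. The class `Eable` has the form `∃xs (⋀ us ⊆ vs ∧ α)`; it contains the inclusion
atoms and is closed under disjunction by the rule that pulls inclusion atoms out of a disjunction
and marks the truth of `α` by `p = q` (`Red.ex_inc`). The class `Gable` has in addition one
universal quantifier. A formula `∀x φ` is replaced by `∃x (∀y (zs y ⊆ zs x) ∧ φ)` (`Red.all_sim`),
so that universal quantifiers govern inclusion atoms only and can be merged; a disjunction with a
universally quantified side is made prenex by two variables that record the chosen side
(`Red.all_or`). Negations of first-order formulas are pushed inwards. -/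

open FirstOrder

/-! ### Terms: substitution, relabelling and evaluation -/

namespace FirstOrder.Language.Term

variable {L : FirstOrder.Language.{u, v}}

theorem subst_congr_varFinset {V W : Type} [DecidableEq V] {σ τ : V → L.Term W} (t : L.Term V)
    (h : ∀ z ∈ t.varFinset, σ z = τ z) : t.subst σ = t.subst τ := by
  induction t with
  | var z => exact h z (by simp [varFinset])
  | func f ts ih =>
    simp only [subst, func.injEq, heq_eq_eq, true_and]
    funext i
    exact ih i fun z hz => h z (by
      simp only [varFinset, Finset.mem_biUnion, Finset.mem_univ, true_and]; exact ⟨i, hz⟩)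

theorem subst_var_eq {V : Type} (t : L.Term V) : t.subst var = t := by
  induction t with
  | var z => rfl
  | func f ts ih => simp only [subst, func.injEq, heq_eq_eq, true_and]; exact funext ih

theorem subst_subst_eq {V W U : Type} (σ : V → L.Term W) (τ : W → L.Term U) (t : L.Term V) :
    (t.subst σ).subst τ = t.subst fun z => (σ z).subst τ := by
  induction t with
  | var z => rfl
  | func f ts ih => simp only [subst, func.injEq, heq_eq_eq, true_and]; exact funext ih

theorem relabel_eq_subst {V W : Type} (f : V → W) (t : L.Term V) :
    t.relabel f = t.subst fun z => var (f z) := by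
  induction t with
  | var z => rfl
  | func f ts ih => simp only [subst, relabel, func.injEq, heq_eq_eq, true_and]; exact funext ih

theorem mem_varFinset_subst {V W : Type} [DecidableEq V] [DecidableEq W] {σ : V → L.Term W}
    {t : L.Term V} {y : W} :
    y ∈ (t.subst σ).varFinset ↔ ∃ z ∈ t.varFinset, y ∈ (σ z).varFinset := by
  induction t with
  | var z => simp [subst, varFinset]
  | func f ts ih =>
    simp only [subst, varFinset, Finset.mem_biUnion, Finset.mem_univ, true_and, ih]
    exact ⟨fun ⟨i, z, h, h'⟩ => ⟨z, ⟨i, h⟩, h'⟩, fun ⟨z, ⟨i, h⟩, h'⟩ => ⟨i, z, h, h'⟩⟩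

theorem realize_congr_varFinset {V : Type} [DecidableEq V] {M : Type w} [L.Structure M]
    {s r : V → M} (t : L.Term V) (h : ∀ z ∈ t.varFinset, s z = r z) :
    t.realize s = t.realize r := by
  induction t with
  | var z => exact h z (by simp [varFinset])
  | func f ts ih =>
    simp only [realize]
    congr 1
    funext i
    exact ih i fun z hz => h z (by
      simp only [varFinset, Finset.mem_biUnion, Finset.mem_univ, true_and]; exact ⟨i, hz⟩)

end FirstOrder.Language.Term

namespace IncLogic

open Language

variable {L : FirstOrder.Language.{u, v}}

namespace Form

/-! ### Substitution -/

theorem IsFO.wf {φ : Form L} (h : φ.IsFO) : φ.WF := by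
  induction φ with
  | inc xs ys => exact h.elim
  | neg φ ih => exact h
  | and φ ψ ih₁ ih₂ => exact ⟨ih₁ h.1, ih₂ h.2⟩
  | or φ ψ ih₁ ih₂ => exact ⟨ih₁ h.1, ih₂ h.2⟩
  | ex x φ ih => exact ih h
  | all x φ ih => exact ih h
  | _ => trivial

theorem IsFO.subst {φ : Form L} (σ : ℕ → L.Term ℕ) (h : φ.IsFO) : (subst σ φ).IsFO := by
  induction φ generalizing σ with
  | inc xs ys => exact h.elim
  | neg φ ih => exact ih σ h
  | and φ ψ ih₁ ih₂ => exact ⟨ih₁ σ h.1, ih₂ σ h.2⟩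
  | or φ ψ ih₁ ih₂ => exact ⟨ih₁ σ h.1, ih₂ σ h.2⟩
  | ex x φ ih => exact ih _ h
  | all x φ ih => exact ih _ h
  | _ => trivial

theorem WF.subst {φ : Form L} (σ : ℕ → L.Term ℕ) (h : φ.WF) : (subst σ φ).WF := by
  induction φ generalizing σ with
  | inc xs ys => simpa [Form.subst, WF] using h
  | neg φ ih => exact IsFO.subst σ h
  | and φ ψ ih₁ ih₂ => exact ⟨ih₁ σ h.1, ih₂ σ h.2⟩
  | or φ ψ ih₁ ih₂ => exact ⟨ih₁ σ h.1, ih₂ σ h.2⟩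
  | ex x φ ih => exact ih _ h
  | all x φ ih => exact ih _ h
  | _ => trivial

theorem fv_subset_vars (φ : Form L) : φ.fv ⊆ φ.vars := by
  induction φ with
  | neg φ ih => exact ih
  | and φ ψ ih₁ ih₂ => exact Finset.union_subset_union ih₁ ih₂
  | or φ ψ ih₁ ih₂ => exact Finset.union_subset_union ih₁ ih₂
  | ex x φ ih =>
    exact (Finset.erase_subset _ _).trans (ih.trans (Finset.subset_insert _ _))
  | all x φ ih =>
    exact (Finset.erase_subset _ _).trans (ih.trans (Finset.subset_insert _ _))
  | _ => exact subset_rfl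

theorem varSub_of_eq {σ : ℕ → L.Term ℕ} {x y : ℕ} (h : σ x = .var y) : varSub σ x = y := by
  simp [varSub, h]

theorem subst_congr {σ τ : ℕ → L.Term ℕ} {φ : Form L} (h : ∀ z ∈ φ.fv, σ z = τ z) :
    subst σ φ = subst τ φ := by
  induction φ generalizing σ τ with
  | bot => rfl
  | eq t s =>
    simp only [fv, Finset.mem_union] at h
    simp only [subst, eq.injEq]
    exact ⟨t.subst_congr_varFinset fun z hz => h z (.inl hz),
      s.subst_congr_varFinset fun z hz => h z (.inr hz)⟩
  | rel R ts =>
    simp only [fv, Finset.mem_biUnion, Finset.mem_univ, true_and] at h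
    simp only [subst, rel.injEq, heq_eq_eq, true_and]
    exact funext fun i => (ts i).subst_congr_varFinset fun z hz => h z ⟨i, hz⟩
  | inc xs ys =>
    simp only [fv, Finset.mem_union, List.mem_toFinset] at h
    simp only [subst, inc.injEq, List.map_inj_left, varSub]
    exact ⟨fun z hz => by rw [h z (.inl hz)], fun z hz => by rw [h z (.inr hz)]⟩
  | neg φ ih => simp only [subst, ih h]
  | and φ ψ ih₁ ih₂ =>
    simp only [fv, Finset.mem_union] at h
    simp only [subst, ih₁ fun z hz => h z (.inl hz), ih₂ fun z hz => h z (.inr hz)]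
  | or φ ψ ih₁ ih₂ =>
    simp only [fv, Finset.mem_union] at h
    simp only [subst, ih₁ fun z hz => h z (.inl hz), ih₂ fun z hz => h z (.inr hz)]
  | ex x φ ih =>
    simp only [subst, ex.injEq, true_and]
    refine ih fun z hz => ?_
    by_cases hzx : z = x
    · simp [hzx]
    · simpa [hzx] using h z (by simp [fv, hzx, hz])
  | all x φ ih =>
    simp only [subst, all.injEq, true_and]
    refine ih fun z hz => ?_
    by_cases hzx : z = x
    · simp [hzx]
    · simpa [hzx] using h z (by simp [fv, hzx, hz])

theorem Admissible.congr {σ τ : ℕ → L.Term ℕ} {φ : Form L} (h : ∀ z ∈ φ.fv, σ z = τ z)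
    (ha : Admissible σ φ) : Admissible τ φ := by
  induction φ generalizing σ τ with
  | inc xs ys =>
    intro x hx
    rw [← h x (by simpa [fv] using hx)]
    exact ha x hx
  | neg φ ih => exact ih h ha
  | and φ ψ ih₁ ih₂ =>
    simp only [fv, Finset.mem_union] at h
    exact ⟨ih₁ (fun z hz => h z (.inl hz)) ha.1, ih₂ (fun z hz => h z (.inr hz)) ha.2⟩
  | or φ ψ ih₁ ih₂ =>
    simp only [fv, Finset.mem_union] at h
    exact ⟨ih₁ (fun z hz => h z (.inl hz)) ha.1, ih₂ (fun z hz => h z (.inr hz)) ha.2⟩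
  | ex x φ ih =>
    refine ⟨fun z hz hzx => ?_, ih (fun z hz => ?_) ha.2⟩
    · rw [← h z (by simp [fv, hzx, hz])]; exact ha.1 z hz hzx
    · by_cases hzx : z = x
      · simp [hzx]
      · simpa [hzx] using h z (by simp [fv, hzx, hz])
  | all x φ ih =>
    refine ⟨fun z hz hzx => ?_, ih (fun z hz => ?_) ha.2⟩
    · rw [← h z (by simp [fv, hzx, hz])]; exact ha.1 z hz hzx
    · by_cases hzx : z = x
      · simp [hzx]
      · simpa [hzx] using h z (by simp [fv, hzx, hz])
  | _ => trivial

theorem subst_var (φ : Form L) : subst (fun z => .var z) φ = φ := by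
  induction φ with
  | bot => rfl
  | eq t s => simp only [subst, eq.injEq]; exact ⟨t.subst_var_eq, s.subst_var_eq⟩
  | rel R ts =>
    simp only [subst, rel.injEq, heq_eq_eq, true_and]
    exact funext fun i => (ts i).subst_var_eq
  | inc xs ys =>
    have e : varSub (fun z => (.var z : L.Term ℕ)) = id := rfl
    rw [subst, e, List.map_id, List.map_id]
  | neg φ ih => simp only [subst, ih]
  | and φ ψ ih₁ ih₂ => simp only [subst, ih₁, ih₂]
  | or φ ψ ih₁ ih₂ => simp only [subst, ih₁, ih₂]
  | ex x φ ih =>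
    simp only [subst, ex.injEq, true_and]
    rw [show Function.update (fun z => (Language.var z : L.Term ℕ)) x (.var x) = _ from
      Function.update_eq_self x _]
    exact ih
  | all x φ ih =>
    simp only [subst, all.injEq, true_and]
    rw [show Function.update (fun z => (Language.var z : L.Term ℕ)) x (.var x) = _ from
      Function.update_eq_self x _]
    exact ih

theorem subst_eq_self {σ : ℕ → L.Term ℕ} {φ : Form L} (h : ∀ z ∈ φ.fv, σ z = .var z) :
    subst σ φ = φ := (subst_congr h).trans φ.subst_var

/-- Bound variables. -/
def bv : Form L → Finset ℕ
  | bot => ∅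
  | eq _ _ => ∅
  | rel _ _ => ∅
  | inc _ _ => ∅
  | neg φ => φ.bv
  | and φ ψ => φ.bv ∪ ψ.bv
  | or φ ψ => φ.bv ∪ ψ.bv
  | ex x φ => insert x φ.bv
  | all x φ => insert x φ.bv

theorem bv_subset_vars (φ : Form L) : φ.bv ⊆ φ.vars := by
  induction φ with
  | neg φ ih => exact ih
  | and φ ψ ih₁ ih₂ => exact Finset.union_subset_union ih₁ ih₂
  | or φ ψ ih₁ ih₂ => exact Finset.union_subset_union ih₁ ih₂
  | ex x φ ih => exact Finset.insert_subset_insert x ih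
  | all x φ ih => exact Finset.insert_subset_insert x ih
  | _ => exact Finset.empty_subset _

theorem bv_subst (σ : ℕ → L.Term ℕ) (φ : Form L) : (subst σ φ).bv = φ.bv := by
  induction φ generalizing σ with
  | neg φ ih => exact ih σ
  | and φ ψ ih₁ ih₂ => simp only [subst, bv, ih₁, ih₂]
  | or φ ψ ih₁ ih₂ => simp only [subst, bv, ih₁, ih₂]
  | ex x φ ih => simp only [subst, bv, ih]
  | all x φ ih => simp only [subst, bv, ih]
  | _ => rfl

theorem mem_bv_exs {xs : List ℕ} {φ : Form L} {z : ℕ} :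
    z ∈ (exs xs φ).bv ↔ z ∈ φ.bv ∨ z ∈ xs := by
  induction xs with
  | nil => simp [exs]
  | cons x xs ih =>
    rw [show exs (x :: xs) φ = ex x (exs xs φ) from rfl, bv, Finset.mem_insert, ih]
    simp only [List.mem_cons]
    tauto

/-- Renaming variables to variables that are not bound is admissible. -/
theorem admissible_of_notMem_bv {σ : ℕ → L.Term ℕ} {φ : Form L}
    (h : ∀ z ∈ φ.fv, σ z = .var z ∨ ∃ y, σ z = .var y ∧ y ∉ φ.bv) : Admissible σ φ := by
  induction φ generalizing σ with
  | inc xs ys =>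
    intro x hx
    rcases h x (by simpa [fv] using hx) with h | ⟨y, h, -⟩
    · exact ⟨_, h⟩
    · exact ⟨_, h⟩
  | neg φ ih => exact ih h
  | and φ ψ ih₁ ih₂ =>
    simp only [fv, bv, Finset.mem_union, not_or] at h
    exact ⟨ih₁ fun z hz => (h z (.inl hz)).imp_right fun ⟨y, a, b⟩ => ⟨y, a, b.1⟩,
      ih₂ fun z hz => (h z (.inr hz)).imp_right fun ⟨y, a, b⟩ => ⟨y, a, b.2⟩⟩
  | or φ ψ ih₁ ih₂ =>
    simp only [fv, bv, Finset.mem_union, not_or] at h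
    exact ⟨ih₁ fun z hz => (h z (.inl hz)).imp_right fun ⟨y, a, b⟩ => ⟨y, a, b.1⟩,
      ih₂ fun z hz => (h z (.inr hz)).imp_right fun ⟨y, a, b⟩ => ⟨y, a, b.2⟩⟩
  | ex x φ ih =>
    simp only [fv, bv, Finset.mem_erase, Finset.mem_insert, not_or] at h
    refine ⟨fun z hz hzx => ?_, ih fun z hz => ?_⟩
    · rcases h z ⟨hzx, hz⟩ with h | ⟨y, h, h', -⟩
      · simp [h, Term.varFinset, Ne.symm hzx]
      · simp [h, Term.varFinset, Ne.symm h']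
    · by_cases hzx : z = x
      · simp [hzx]
      · simpa [hzx] using (h z ⟨hzx, hz⟩).imp_right fun ⟨y, a, b⟩ => ⟨y, a, b.2⟩
  | all x φ ih =>
    simp only [fv, bv, Finset.mem_erase, Finset.mem_insert, not_or] at h
    refine ⟨fun z hz hzx => ?_, ih fun z hz => ?_⟩
    · rcases h z ⟨hzx, hz⟩ with h | ⟨y, h, h', -⟩
      · simp [h, Term.varFinset, Ne.symm hzx]
      · simp [h, Term.varFinset, Ne.symm h']
    · by_cases hzx : z = x
      · simp [hzx]
      · simpa [hzx] using (h z ⟨hzx, hz⟩).imp_right fun ⟨y, a, b⟩ => ⟨y, a, b.2⟩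
  | _ => trivial

theorem admissible_of_fresh {σ : ℕ → L.Term ℕ} {φ : Form L}
    (h : ∀ z ∈ φ.fv, σ z = .var z ∨ ∃ y, σ z = .var y ∧ y ∉ φ.vars) : Admissible σ φ :=
  admissible_of_notMem_bv fun z hz => (h z hz).imp_right fun ⟨y, a, b⟩ =>
    ⟨y, a, fun hy => b (φ.bv_subset_vars hy)⟩

theorem single_self (x : ℕ) : (single x (.var x) : ℕ → L.Term ℕ) = fun z => .var z :=
  Function.update_eq_self x _

theorem admissible_single_self (x : ℕ) (φ : Form L) : Admissible (single x (.var x)) φ :=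
  admissible_of_fresh fun z _ => .inl (by rw [single_self])

theorem subst_single_self (x : ℕ) (φ : Form L) : subst (single x (.var x)) φ = φ := by
  rw [single_self, subst_var]

theorem admissible_single_fresh {x y : ℕ} {φ : Form L} (h : y ∉ φ.vars) :
    Admissible (single x (.var y)) φ :=
  admissible_of_fresh fun z _ => by
    by_cases hzx : z = x
    · exact .inr ⟨y, by simp [single, hzx], h⟩
    · exact .inl (by simp [single, hzx])

/-- The first admissibility hypothesis prevents the terms `σ z` from being captured, where `τ` could
not reach them; in inclusion atoms both hypotheses exclude the default value of `varSub`. -/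
theorem subst_subst {σ τ : ℕ → L.Term ℕ} {φ : Form L} (h : Admissible σ φ)
    (h' : Admissible τ (subst σ φ)) :
    subst τ (subst σ φ) = subst (fun z => (σ z).subst τ) φ := by
  induction φ generalizing σ τ with
  | bot => rfl
  | eq t s => simp only [subst, Term.subst_subst_eq]
  | rel R ts => simp only [subst, Term.subst_subst_eq]
  | inc xs ys =>
    simp only [subst, inc.injEq, List.map_map, List.map_inj_left, Function.comp]
    constructor <;> intro z hz <;> obtain ⟨y, hy⟩ := h z (by simp [hz]) <;>
      obtain ⟨x, hx⟩ := h' y (by simp only [List.mem_append, List.mem_map]; first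
        | exact .inl ⟨z, hz, varSub_of_eq hy⟩ | exact .inr ⟨z, hz, varSub_of_eq hy⟩) <;>
      simp [varSub, hy, hx, Term.subst]
  | neg φ ih => simp only [subst, neg.injEq]; exact ih h h'
  | and φ ψ ih₁ ih₂ => simp only [subst, and.injEq]; exact ⟨ih₁ h.1 h'.1, ih₂ h.2 h'.2⟩
  | or φ ψ ih₁ ih₂ => simp only [subst, or.injEq]; exact ⟨ih₁ h.1 h'.1, ih₂ h.2 h'.2⟩
  | ex x φ ih =>
    simp only [subst, ex.injEq, true_and]
    refine (ih h.2 h'.2).trans (subst_congr fun z hz => ?_)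
    by_cases hzx : z = x
    · simp [hzx, Term.subst]
    · simp only [ne_eq, hzx, not_false_eq_true, Function.update_of_ne]
      refine Term.subst_congr_varFinset _ fun w hw => ?_
      rw [Function.update_of_ne]
      rintro rfl
      exact h.1 z hz hzx hw
  | all x φ ih =>
    simp only [subst, all.injEq, true_and]
    refine (ih h.2 h'.2).trans (subst_congr fun z hz => ?_)
    by_cases hzx : z = x
    · simp [hzx, Term.subst]
    · simp only [ne_eq, hzx, not_false_eq_true, Function.update_of_ne]
      refine Term.subst_congr_varFinset _ fun w hw => ?_
      rw [Function.update_of_ne]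
      rintro rfl
      exact h.1 z hz hzx hw

/-- Admissibility matters in the inclusion atoms only, where it excludes the default value of
`varSub`. -/
theorem exists_of_mem_fv_subst {σ : ℕ → L.Term ℕ} {φ : Form L} (h : Admissible σ φ) {y : ℕ}
    (hy : y ∈ (subst σ φ).fv) : ∃ z ∈ φ.fv, y ∈ (σ z).varFinset := by
  induction φ generalizing σ with
  | bot => simp [subst, fv] at hy
  | eq t s =>
    simp only [subst, fv, Finset.mem_union, Term.mem_varFinset_subst] at hy
    rcases hy with ⟨z, hz, hy⟩ | ⟨z, hz, hy⟩
    · exact ⟨z, by simp [fv, hz], hy⟩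
    · exact ⟨z, by simp [fv, hz], hy⟩
  | rel R ts =>
    simp only [subst, fv, Finset.mem_biUnion, Finset.mem_univ, true_and,
      Term.mem_varFinset_subst] at hy ⊢
    obtain ⟨i, z, hz, hy⟩ := hy
    exact ⟨z, ⟨i, hz⟩, hy⟩
  | inc xs ys =>
    simp only [subst, fv, Finset.mem_union, List.mem_toFinset, List.mem_map] at hy ⊢
    rcases hy with ⟨z, hz, rfl⟩ | ⟨z, hz, rfl⟩ <;> obtain ⟨y, hy⟩ := h z (by simp [hz]) <;>
      exact ⟨z, by simp [hz], by simp [varSub, hy, Term.varFinset]⟩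
  | neg φ ih => exact ih h hy
  | and φ ψ ih₁ ih₂ =>
    simp only [subst, fv, Finset.mem_union] at hy ⊢
    rcases hy with hy | hy
    · obtain ⟨z, hz, hy⟩ := ih₁ h.1 hy; exact ⟨z, .inl hz, hy⟩
    · obtain ⟨z, hz, hy⟩ := ih₂ h.2 hy; exact ⟨z, .inr hz, hy⟩
  | or φ ψ ih₁ ih₂ =>
    simp only [subst, fv, Finset.mem_union] at hy ⊢
    rcases hy with hy | hy
    · obtain ⟨z, hz, hy⟩ := ih₁ h.1 hy; exact ⟨z, .inl hz, hy⟩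
    · obtain ⟨z, hz, hy⟩ := ih₂ h.2 hy; exact ⟨z, .inr hz, hy⟩
  | ex x φ ih =>
    simp only [subst, fv, Finset.mem_erase] at hy ⊢
    obtain ⟨z, hz, hy'⟩ := ih h.2 hy.2
    by_cases hzx : z = x
    · subst hzx; simp [Term.varFinset] at hy'; exact absurd hy' hy.1
    · exact ⟨z, ⟨hzx, hz⟩, by simpa [hzx] using hy'⟩
  | all x φ ih =>
    simp only [subst, fv, Finset.mem_erase] at hy ⊢
    obtain ⟨z, hz, hy'⟩ := ih h.2 hy.2
    by_cases hzx : z = x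
    · subst hzx; simp [Term.varFinset] at hy'; exact absurd hy' hy.1
    · exact ⟨z, ⟨hzx, hz⟩, by simpa [hzx] using hy'⟩

/-- After renaming `x` to a fresh variable `y`, the variable `x` is free for `y`. -/
theorem admissible_single_back {x y : ℕ} {φ : Form L} (hy : y ∉ φ.vars) :
    Admissible (single y (.var x)) (subst (single x (.var y)) φ) := by
  induction φ with
  | inc xs ys =>
    intro z _
    by_cases h : z = y
    · exact ⟨x, by simp [single, h]⟩
    · exact ⟨z, by simp [single, h]⟩
  | neg φ ih => exact ih hy
  | and φ ψ ih₁ ih₂ =>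
    simp only [vars, Finset.mem_union, not_or] at hy
    exact ⟨ih₁ hy.1, ih₂ hy.2⟩
  | or φ ψ ih₁ ih₂ =>
    simp only [vars, Finset.mem_union, not_or] at hy
    exact ⟨ih₁ hy.1, ih₂ hy.2⟩
  | ex b φ ih =>
    simp only [vars, Finset.mem_insert, not_or] at hy
    by_cases hb : b = x
    · subst hb
      have e : subst (Function.update (single b (.var y)) b (.var b)) φ = φ :=
        subst_eq_self fun z _ => by by_cases hz : z = b <;> simp [single, hz]
      have hyf : ∀ z ∈ φ.fv, z ≠ y := fun z hz h => hy.2 (φ.fv_subset_vars (h ▸ hz))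
      simp only [subst, e, Admissible]
      refine ⟨fun z hz hzb => by simp [single, hyf z hz, Term.varFinset, Ne.symm hzb], ?_⟩
      refine Admissible.congr (fun z hz => ?_) (admissible_single_self b φ)
      by_cases hzb : z = b
      · simp [single, hzb]
      · simp [single, hzb, hyf z hz]
    · have e : Function.update (single x (.var y : L.Term ℕ)) b (.var b) = single x (.var y) := by
        rw [← show (single x (.var y : L.Term ℕ)) b = .var b by simp [single, hb],
          Function.update_eq_self]
      have e' : Function.update (single y (.var x : L.Term ℕ)) b (.var b) = single y (.var x) := by
        rw [← show (single y (.var x : L.Term ℕ)) b = .var b by simp [single, Ne.symm hy.1],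
          Function.update_eq_self]
      simp only [subst, e, e', Admissible]
      refine ⟨fun z _ hzb => ?_, ih hy.2⟩
      by_cases hz : z = y
      · simp [single, hz, Term.varFinset, hb]
      · simp [single, hz, Term.varFinset, Ne.symm hzb]
  | all b φ ih =>
    simp only [vars, Finset.mem_insert, not_or] at hy
    by_cases hb : b = x
    · subst hb
      have e : subst (Function.update (single b (.var y)) b (.var b)) φ = φ :=
        subst_eq_self fun z _ => by by_cases hz : z = b <;> simp [single, hz]
      have hyf : ∀ z ∈ φ.fv, z ≠ y := fun z hz h => hy.2 (φ.fv_subset_vars (h ▸ hz))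
      simp only [subst, e, Admissible]
      refine ⟨fun z hz hzb => by simp [single, hyf z hz, Term.varFinset, Ne.symm hzb], ?_⟩
      refine Admissible.congr (fun z hz => ?_) (admissible_single_self b φ)
      by_cases hzb : z = b
      · simp [single, hzb]
      · simp [single, hzb, hyf z hz]
    · have e : Function.update (single x (.var y : L.Term ℕ)) b (.var b) = single x (.var y) := by
        rw [← show (single x (.var y : L.Term ℕ)) b = .var b by simp [single, hb],
          Function.update_eq_self]
      have e' : Function.update (single y (.var x : L.Term ℕ)) b (.var b) = single y (.var x) := by
        rw [← show (single y (.var x : L.Term ℕ)) b = .var b by simp [single, Ne.symm hy.1],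
          Function.update_eq_self]
      simp only [subst, e, e', Admissible]
      refine ⟨fun z _ hzb => ?_, ih hy.2⟩
      by_cases hz : z = y
      · simp [single, hz, Term.varFinset, hb]
      · simp [single, hz, Term.varFinset, Ne.symm hzb]
  | _ => trivial

theorem subst_single_back {x y : ℕ} {φ : Form L} (hy : y ∉ φ.vars) :
    subst (single y (.var x)) (subst (single x (.var y)) φ) = φ := by
  rw [subst_subst (admissible_single_fresh hy) (admissible_single_back hy)]
  refine subst_eq_self fun z hz => ?_
  by_cases hzx : z = x
  · simp [single, hzx, Term.subst]
  · have hzy : z ≠ y := fun h => hy (φ.fv_subset_vars (h ▸ hz))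
    simp [single, hzx, Term.subst, hzy]

/-! ### Finite conjunctions and blocks of quantifiers -/

@[simp] theorem exs_nil (φ : Form L) : exs [] φ = φ := rfl
@[simp] theorem exs_cons (x : ℕ) (xs : List ℕ) (φ : Form L) : exs (x :: xs) φ = ex x (exs xs φ) :=
  rfl

theorem exs_append (xs ys : List ℕ) (φ : Form L) : exs (xs ++ ys) φ = exs xs (exs ys φ) := by
  simp [exs]

theorem mem_fv_exs {xs : List ℕ} {φ : Form L} {z : ℕ} :
    z ∈ (exs xs φ).fv ↔ z ∈ φ.fv ∧ z ∉ xs := by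
  induction xs with
  | nil => simp
  | cons x xs ih => simp [fv, ih]; tauto

theorem mem_vars_exs {xs : List ℕ} {φ : Form L} {z : ℕ} :
    z ∈ (exs xs φ).vars ↔ z ∈ φ.vars ∨ z ∈ xs := by
  induction xs with
  | nil => simp
  | cons x xs ih => simp [vars, ih]; tauto

theorem wf_exs {xs : List ℕ} {φ : Form L} : (exs xs φ).WF ↔ φ.WF := by
  induction xs with
  | nil => rfl
  | cons x xs ih => simpa [WF] using ih

theorem wf_conj {l : List (Form L)} : (conj l).WF ↔ ∀ φ ∈ l, φ.WF := by
  induction l with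
  | nil => simp [conj, top, WF, IsFO]
  | cons φ l ih =>
    cases l with
    | nil => simp [conj]
    | cons ψ l => rw [conj, WF, ih]; simp

theorem mem_fv_conj {l : List (Form L)} {z : ℕ} : z ∈ (conj l).fv ↔ ∃ φ ∈ l, z ∈ φ.fv := by
  induction l with
  | nil => simp [conj, top, fv]
  | cons φ l ih =>
    cases l with
    | nil => simp [conj]
    | cons ψ l => rw [conj, fv, Finset.mem_union, ih]; simp

theorem subst_conj (σ : ℕ → L.Term ℕ) (l : List (Form L)) :
    subst σ (conj l) = conj (l.map (subst σ)) := by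
  induction l with
  | nil => rfl
  | cons φ l ih =>
    cases l with
    | nil => rfl
    | cons ψ l => rw [conj, subst, ih]; rfl

theorem admissible_conj {σ : ℕ → L.Term ℕ} {l : List (Form L)} :
    Admissible σ (conj l) ↔ ∀ φ ∈ l, Admissible σ φ := by
  induction l with
  | nil => simp [conj, top, Admissible]
  | cons φ l ih =>
    cases l with
    | nil => simp [conj]
    | cons ψ l => rw [conj, Admissible, ih]; simp

end Form

/-! ### Structural properties of derivations -/

namespace Deriv

open Form

theorem mono {Γ Γ' : Set (Form L)} {φ : Form L} (h : Deriv Γ φ) (hs : Γ ⊆ Γ') : Deriv Γ' φ := by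
  induction h generalizing Γ' with
  | ass hw h => exact ass hw (hs h)
  | eqI t => exact eqI t
  | eqSub hw ht hr _ _ ih ih1 => exact eqSub hw ht hr (ih hs) (ih1 hs)
  | negI ha hs' hfo h _ => exact negI ha (hs'.trans hs) hfo h
  | negE ha hw _ _ ih ih1 => exact negE ha hw (ih hs) (ih1 hs)
  | raa ha hs' hfo h _ => exact raa ha (hs'.trans hs) hfo h
  | andI _ _ ih ih1 => exact andI (ih hs) (ih1 hs)
  | andE1 _ ih => exact andE1 (ih hs)
  | andE2 _ ih => exact andE2 (ih hs)
  | orI1 hw _ ih => exact orI1 hw (ih hs)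
  | orI2 hw _ ih => exact orI2 hw (ih hs)
  | orE hs₀ hs₁ hf₀ hf₁ _ h₀ h₁ ih => exact orE (hs₀.trans hs) (hs₁.trans hs) hf₀ hf₁ (ih hs) h₀ h₁
  | exI hw ht _ ih => exact exI hw ht (ih hs)
  | exE hs' hx hΔ _ h1 ih => exact exE (hs'.trans hs) hx hΔ (ih hs) h1
  | allI hs' hΔ h => exact allI (hs'.trans hs) hΔ h
  | allE ha ht _ ih => exact allE ha ht (ih hs)
  | allE₀ hx _ ih => exact allE₀ hx (ih hs)
  | allSub hs' hy hΔ ht _ h1 ih => exact allSub (hs'.trans hs) hy hΔ ht (ih hs) h1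
  | allExc _ ih => exact allExc (ih hs)
  | allAndExt _ _ ih ih1 => exact allAndExt (ih hs) (ih1 hs)
  | allOrExt hx hyz hy hz _ ih => exact allOrExt hx hyz hy hz (ih hs)
  | allOrExtInv hx hyz hy hz _ ih => exact allOrExtInv hx hyz hy hz (ih hs)
  | incExc h₁ h₂ h₃ _ ih => exact incExc h₁ h₂ h₃ (ih hs)
  | incCtr h₁ h₂ _ ih => exact incCtr h₁ h₂ (ih hs)
  | incTrs _ _ ih ih1 => exact incTrs (ih hs) (ih1 hs)
  | incCmp ha hz hlx hly hfv hx hy _ _ ih ih1 =>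
    exact incCmp ha hz hlx hly hfv hx hy (ih hs) (ih1 hs)
  | incExp ha hs' hz hlx hly hfv hx hy hyn hyx hΔ h _ =>
    exact incExp ha (hs'.trans hs) hz hlx hly hfv hx hy hyn hyx hΔ h
  | incWEx hw _ ih => exact incWEx hw (ih hs)
  | incWAll hw _ ih => exact incWAll hw (ih hs)
  | allSim hx hxz hfv hl hyn hyxz hy _ ih => exact allSim hx hxz hfv hl hyn hyxz hy (ih hs)
  | allSimInv hx hxz hfv hl hyn hyxz hy _ ih => exact allSimInv hx hxz hfv hl hyn hyxz hy (ih hs)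
  | exIncExt ha hx hps hφ hpq hp hq _ ih => exact exIncExt ha hx hps hφ hpq hp hq (ih hs)

theorem wf_alls {xs : List ℕ} {φ : Form L} : (alls xs φ).WF ↔ φ.WF := by
  induction xs with
  | nil => rfl
  | cons x xs ih => simpa [alls, WF] using ih

theorem wf {Γ : Set (Form L)} {φ : Form L} (h : Deriv Γ φ) : φ.WF := by
  induction h with
  | ass hw h => exact hw
  | eqI t => trivial
  | eqSub hw ht hr _ _ ih ih1 => exact hw.subst _
  | negI ha hs' hfo h _ => exact ha
  | negE ha hw _ _ ih ih1 => exact hw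
  | raa ha hs' hfo h _ => exact ha.wf
  | andI _ _ ih ih1 => exact ⟨ih, ih1⟩
  | andE1 _ ih => exact ih.1
  | andE2 _ ih => exact ih.2
  | orI1 hw _ ih => exact ⟨ih, hw⟩
  | orI2 hw _ ih => exact ⟨hw, ih⟩
  | orE hs₀ hs₁ hf₀ hf₁ _ h₀ h₁ ih ih₀ => exact ih₀
  | exI hw ht _ ih => exact hw
  | exE hs' hx hΔ _ h1 ih ih1 => exact ih1
  | allI hs' hΔ h ih => exact ih
  | allE ha ht _ ih => exact ha.wf.subst _
  | allE₀ hx _ ih => exact ih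
  | allSub hs' hy hΔ ht _ h1 ih ih1 => exact ih1
  | allExc _ ih => exact ih
  | allAndExt _ _ ih ih1 => exact ⟨ih, ih1⟩
  | allOrExt hx hyz hy hz _ ih => exact ⟨⟨ih.1, trivial⟩, ih.2, trivial⟩
  | allOrExtInv hx hyz hy hz _ ih => exact ⟨ih.1.1, ih.2.1⟩
  | incExc h₁ h₂ h₃ _ ih => simp [WF, h₁, h₂, h₃]
  | incCtr h₁ h₂ _ ih => exact h₁
  | incTrs _ _ ih ih1 => exact Eq.trans ih ih1
  | incCmp ha hz hlx hly hfv hx hy _ _ ih ih1 => exact ha.wf.subst _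
  | incExp ha hs' hz hlx hly hfv hx hy hyn hyx hΔ h _ => exact ha.wf.subst _
  | incWEx hw _ ih => simpa [WF] using ih
  | incWAll hw _ ih => simpa [WF] using ih
  | allSim hx hxz hfv hl hyn hyxz hy _ ih =>
    exact wf_exs.2 (wf_alls.2 ⟨by simp [WF, hl], wf_alls.1 ih⟩)
  | allSimInv hx hxz hfv hl hyn hyxz hy _ ih => exact wf_alls.2 (wf_alls.1 (wf_exs.1 ih)).2
  | @exIncExt _ xs ps α φ p q ha hx hps hφ hpq hp hq _ ih =>
    refine wf_exs.2 ⟨wf_conj.2 fun ψ hψ => ?_, ⟨⟨ha, trivial⟩, trivial, ha.wf⟩, ha.wf, ih.2⟩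
    obtain ⟨a, h, rfl⟩ := List.mem_map.1 hψ
    simp [WF, (hps a h).1]

theorem ass_insert {Γ : Set (Form L)} {φ : Form L} (hw : φ.WF) : Deriv (insert φ Γ) φ :=
  ass hw (Set.mem_insert _ _)

theorem weaken {Γ : Set (Form L)} {φ ψ : Form L} (h : Deriv Γ φ) : Deriv (insert ψ Γ) φ :=
  h.mono (Set.subset_insert _ _)

theorem topI (Γ : Set (Form L)) : Deriv Γ top :=
  negI (Δ := ∅) (α := bot) trivial (Set.empty_subset _) (by simp) (ass_insert trivial)

theorem conj_iff {Γ : Set (Form L)} {l : List (Form L)} :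
    Deriv Γ (conj l) ↔ ∀ φ ∈ l, Deriv Γ φ := by
  induction l with
  | nil => simpa [conj] using topI Γ
  | cons φ l ih =>
    cases l with
    | nil => simp [conj]
    | cons ψ l =>
      rw [conj, List.forall_mem_cons, ← ih]
      exact ⟨fun h => ⟨h.andE1, h.andE2⟩, fun h => h.1.andI h.2⟩

theorem and_iff {Γ : Set (Form L)} {φ ψ : Form L} :
    Deriv Γ (and φ ψ) ↔ Deriv Γ φ ∧ Deriv Γ ψ :=
  ⟨fun h => ⟨h.andE1, h.andE2⟩, fun h => h.1.andI h.2⟩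

theorem exI_self {Γ : Set (Form L)} {x : ℕ} {φ : Form L} (h : Deriv Γ φ) : Deriv Γ (ex x φ) :=
  exI (t := .var x) h.wf (admissible_single_self x φ) (by rwa [subst_single_self])

theorem exsI_self {Γ : Set (Form L)} {xs : List ℕ} {φ : Form L} (h : Deriv Γ φ) :
    Deriv Γ (exs xs φ) := by
  induction xs with
  | nil => exact h
  | cons x xs ih => exact ih.exI_self

/-- Cut: a vacuous existential quantifier discharges the assumption. -/
theorem cut {Γ : Set (Form L)} {φ ψ : Form L} (h : Deriv Γ φ) (h1 : Deriv {φ} ψ) : Deriv Γ ψ := by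
  obtain ⟨x, hx⟩ := Infinite.exists_notMem_finset ψ.fv
  exact exE (Δ := ∅) (Set.empty_subset _) hx (by simp) (exI_self (x := x) h) (by simpa using h1)

/-- Finiteness of `Γ` provides a variable free in no assumption, so that the vacuous quantifier can
be eliminated with all of `Γ` kept. -/
theorem cut_insert {Γ : Set (Form L)} (hΓ : Γ.Finite) {φ ψ : Form L} (h : Deriv Γ φ)
    (h1 : Deriv (insert φ Γ) ψ) : Deriv Γ ψ := by
  obtain ⟨x, hx⟩ := Infinite.exists_notMem_finset (ψ.fv ∪ hΓ.toFinset.biUnion Form.fv)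
  simp only [Finset.mem_union, Finset.mem_biUnion, Set.Finite.mem_toFinset, not_or,
    not_exists, not_and] at hx
  exact exE subset_rfl hx.1 hx.2 (exI_self (x := x) h) h1

theorem cut₂ {Γ : Set (Form L)} {φ φ' ψ : Form L} (h : Deriv Γ φ) (h' : Deriv Γ φ')
    (h1 : Deriv {φ, φ'} ψ) : Deriv Γ ψ := by
  have h0 : Deriv {and φ φ'} (and φ φ') := ass ⟨h.wf, h'.wf⟩ rfl
  refine (h.andI h').cut (cut_insert (Set.toFinite _) h0.andE1
    (cut_insert (Set.toFinite _) h0.andE2.weaken (h1.mono ?_)))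
  rintro δ (rfl | rfl) <;> simp

/-- Existential elimination for a block of quantifiers. -/
theorem exsE {Γ : Set (Form L)} {xs : List ℕ} {φ ψ : Form L} (hx : ∀ x ∈ xs, x ∉ ψ.fv)
    (h : Deriv Γ (exs xs φ)) (h1 : ∀ Γ, Deriv Γ φ → Deriv Γ ψ) : Deriv Γ ψ := by
  induction xs generalizing Γ with
  | nil => exact h1 Γ h
  | cons x xs ih =>
    exact exE (Δ := ∅) (Set.empty_subset _) (hx x (by simp)) (by simp) h
      (ih (fun z hz => hx z (by simp [hz])) (ass_insert h.wf))

/-- The hypothesis ranges over all contexts, so it applies with `φ` as the only assumption; this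
meets the variable condition of the rule, which is used with `x` renamed to itself. -/
theorem allMono {Γ : Set (Form L)} {x : ℕ} {φ ψ : Form L} (h : Deriv Γ (all x φ))
    (h1 : ∀ Γ, Deriv Γ φ → Deriv Γ ψ) : Deriv Γ (all x ψ) := by
  refine allSub (Δ := ∅) (Set.empty_subset _) (by simp [fv]) (by simp)
    (admissible_single_self x φ) h ?_
  rw [subst_single_self]
  exact h1 _ (ass_insert h.wf)

theorem exMono {Γ : Set (Form L)} {x : ℕ} {φ ψ : Form L} (h : Deriv Γ (ex x φ))
    (h1 : ∀ Γ, Deriv Γ φ → Deriv Γ ψ) : Deriv Γ (ex x ψ) :=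
  exE (Δ := ∅) (Set.empty_subset _) (by simp [fv]) (by simp) h (h1 _ (ass_insert h.wf)).exI_self

/-- A block of existential quantifiers introduced by simultaneously instantiating its variables by
variables that are not bound in the formula. -/
theorem exsI {Γ : Set (Form L)} {xs : List ℕ} {f : ℕ → ℕ} {φ : Form L} (hw : φ.WF)
    (hn : xs.Nodup) (hf : ∀ x ∈ xs, f x ∉ xs ∧ f x ∉ φ.bv) (hf' : ∀ z ∉ xs, f z = z)
    (h : Deriv Γ (subst (fun z => .var (f z)) φ)) : Deriv Γ (exs xs φ) := by
  induction xs generalizing Γ f φ with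
  | nil =>
    rw [subst_eq_self fun z _ => by rw [hf' z (by simp)] ] at h
    exact h
  | cons x xs ih =>
    simp only [List.nodup_cons] at hn
    have hfx := hf x (by simp)
    simp only [List.mem_cons, not_or] at hfx hf hf'
    have key : ∀ l : List ℕ, x ∉ l → f x ∉ l →
        subst (single x (.var (f x))) (exs l φ) = exs l (subst (single x (.var (f x))) φ) := by
      intro l hx hl
      induction l with
      | nil => rfl
      | cons y l ihl =>
        simp only [List.mem_cons, not_or] at hx hl
        simp only [exs_cons, subst, ex.injEq, true_and]
        rw [← ihl hx.2 hl.2]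
        congr 1
        rw [← show (single x (.var (f x)) : ℕ → L.Term ℕ) y = .var y by
          simp [single, Ne.symm hx.1], Function.update_eq_self]
    have adm : ∀ ψ : Form L, f x ∉ ψ.bv → Admissible (single x (.var (f x))) ψ := fun ψ hψ =>
      admissible_of_notMem_bv fun z _ => by
        by_cases hzx : z = x
        · exact .inr ⟨f x, by simp [single, hzx], hψ⟩
        · exact .inl (by simp [single, hzx])
    rw [exs_cons]
    refine exI (t := .var (f x)) (wf_exs.2 hw) (adm _ ?_) ?_
    · rw [mem_bv_exs, not_or]; exact ⟨hfx.2, hfx.1.2⟩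
    · rw [key xs hn.1 hfx.1.2]
      -- After the first instantiation `x` is no longer free; sending it to itself meets the
      -- requirement that the map fix everything outside the remaining block.
      refine ih (f := fun z => if z = x then x else f z) (hw.subst _) hn.2 (fun z hz => ?_)
        (fun z hz => ?_) ?_
      · have hzx : z ≠ x := fun e => hn.1 (e ▸ hz)
        rw [if_neg hzx, bv_subst]
        exact ⟨(hf z (.inr hz)).1.2, (hf z (.inr hz)).2⟩
      · split_ifs with e
        · exact e.symm
        · exact hf' z ⟨e, hz⟩
      · rw [subst_subst (adm _ hfx.2)]
        · convert h using 1
          refine subst_congr fun z hz => ?_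
          by_cases hzx : z = x
          · simp [single, hzx, Term.subst, hfx.1.1, hf' (f x) hfx.1]
          · simp [single, hzx, Term.subst]
        · refine admissible_of_notMem_bv fun z _ => ?_
          by_cases hzx : z = x
          · exact .inl (by simp [hzx])
          · by_cases hz : z ∈ xs
            · exact .inr ⟨f z, by simp [hzx], by rw [bv_subst]; exact (hf z (.inr hz)).2⟩
            · exact .inl (by simp [hzx, hf' z ⟨hzx, hz⟩])

end Deriv

end IncLogic

namespace IncLogic

open Language

variable {L : FirstOrder.Language.{u, v}}

namespace Deriv

open Form

/-! ### Derived rules for inclusion atoms -/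

section Select

variable {ι : Type} {f g : ι → ℕ} {Γ : Set (Form L)}

/-- The prefix makes the induction over permutations work: the `cons` case moves the head into it.
-/
theorem inc_perm {l l' : List ι} (h : l.Perm l') :
    ∀ pre : List ι, Deriv Γ (inc ((pre ++ l).map f) ((pre ++ l).map g)) →
      Deriv Γ (inc ((pre ++ l').map f) ((pre ++ l').map g)) := by
  induction h with
  | nil => exact fun _ h => h
  | cons x _ ih => exact fun pre h => by simpa using ih (pre ++ [x]) (by simpa using h)
  | swap a b l =>
    intro pre h
    -- The exchange rule swaps the two leading blocks only: `b` and then `a` are brought to the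
    -- front, and finally the prefix is moved back before them.
    have h1 := incExc (xs := pre.map f) (ys := [f b]) (zs := f a :: l.map f) (us := pre.map g)
      (vs := [g b]) (ws := g a :: l.map g) (by simp) (by simp) (by simp) (Γ := Γ)
      (by simpa using h)
    have h2 := incExc (xs := f b :: pre.map f) (ys := [f a]) (zs := l.map f)
      (us := g b :: pre.map g) (vs := [g a]) (ws := l.map g) (by simp) (by simp) (by simp) (Γ := Γ)
      (by simpa using h1)
    have h3 := incExc (xs := [f a, f b]) (ys := pre.map f) (zs := l.map f)
      (us := [g a, g b]) (vs := pre.map g) (ws := l.map g) (by simp) (by simp) (by simp) (Γ := Γ)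
      (by simpa using h2)
    simpa using h3
  | trans _ _ ih₁ ih₂ => exact fun pre h => ih₂ pre (ih₁ pre h)

/-- Projection of an inclusion atom to a selection of its positions. -/
theorem inc_select {e l : List ι} (hl : l.Subperm e)
    (h : Deriv Γ (inc (e.map f) (e.map g))) : Deriv Γ (inc (l.map f) (l.map g)) := by
  obtain ⟨l', hl', hs⟩ := hl
  obtain ⟨r, hr⟩ := hs.exists_perm_append
  have hp : e.Perm (l ++ r) := hr.trans (hl'.append_right r)
  have h1 := inc_perm hp [] h
  simp only [List.nil_append, List.map_append] at h1
  exact incCtr (by simp) (by simp) h1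

end Select

theorem inc_select_zip {Γ : Set (Form L)} {xs ys : List ℕ} {l : List (ℕ × ℕ)}
    (hl : l.Subperm (xs.zip ys)) (h : Deriv Γ (inc xs ys)) :
    Deriv Γ (inc (l.map Prod.fst) (l.map Prod.snd)) := by
  have hw : xs.length = ys.length := h.wf
  refine inc_select hl ?_
  rwa [List.map_fst_zip hw.le, List.map_snd_zip hw.ge]

/-- Two variables whose values are included in those of the same variable are equal if this holds
within one inclusion atom. -/
theorem veq_of_inc {Γ : Set (Form L)} {xs ys : List ℕ} {a b c : ℕ} (h : Deriv Γ (inc xs ys))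
    (ha : (a, c) ∈ xs.zip ys) (hb : (b, c) ∈ xs.zip ys) : Deriv Γ (veq a b) := by
  -- For `a = b` both pairs may be the same position of the atom, which cannot be projected to
  -- twice.
  by_cases hab : a = b
  · subst hab; exact eqI _
  have h1 : Deriv Γ (inc [a, b] [c, c]) := by
    refine inc_select_zip (l := [(a, c), (b, c)]) (List.subperm_of_subset (by simp [hab]) ?_) h
    intro p hp
    simp only [List.mem_cons, List.not_mem_nil, or_false] at hp
    rcases hp with rfl | rfl <;> assumption
  -- The formula `z₀ = z₁` is transported along the atom from `c, c`, where it is an instance of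
  -- reflexivity, to `a, b`.
  have key : ∀ x y : ℕ, subst (seqSub [x, y] [0, 1]) (veq 0 1 : Form L) = veq x y :=
    fun x y => rfl
  rw [← key]
  exact incCmp (xs := [c, c]) trivial (by decide) rfl rfl
    (by intro z; simp [veq, fv, Term.varFinset]) trivial trivial h1 (by rw [key]; exact eqI _)

/-- An entry of `us` and the variable `f i` of the corresponding selected position `i` stand over
the same variable `g i` in one atom. The equations in `γ` and `δ` arise in this way. -/
theorem seqEq_of_inc {ι : Type} {Γ : Set (Form L)} {f g : ι → ℕ} {e sel : List ι} {us : List ℕ}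
    (hs : sel ⊆ e) (hl : us.length = sel.length)
    (h : Deriv Γ (inc (us ++ e.map f) (sel.map g ++ e.map g))) :
    Deriv Γ (seqEq us (sel.map f)) := by
  refine conj_iff.2 fun φ hφ => ?_
  rw [← List.map_uncurry_zip_eq_zipWith] at hφ
  obtain ⟨⟨a, b⟩, hab, rfl⟩ := List.mem_map.1 hφ
  rw [List.zip_map_right, List.mem_map] at hab
  obtain ⟨⟨a', i⟩, hi, hab⟩ := hab
  simp only [Prod.map_apply, id_eq, Prod.mk.injEq] at hab
  obtain ⟨rfl, rfl⟩ := hab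
  refine veq_of_inc h (c := g i) ?_ ?_
  · rw [List.zip_append (by simpa using hl), List.mem_append, List.zip_map_right]
    exact .inl (List.mem_map.2 ⟨_, hi, rfl⟩)
  · rw [List.zip_append (by simpa using hl), List.mem_append, List.zip_map, List.mem_map]
    exact .inr ⟨(i, i), by
      have key : ∀ (e : List ι), i ∈ e → (i, i) ∈ e.zip e := by
        intro e hi
        induction e with
        | nil => simp at hi
        | cons a e ih =>
          rcases List.mem_cons.1 hi with rfl | hi
          · simp
          · exact List.mem_cons_of_mem _ (ih hi)
      exact key e (hs (List.of_mem_zip hi).2), rfl⟩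

end Deriv

/-! ### Instances of quantifier-free formulas -/

theorem QF.isFO_inst {V : Type} (f : V → ℕ) (α : QF L V) : (α.inst f).IsFO := by
  induction α with
  | neg φ ih => exact ih
  | and φ ψ ih₁ ih₂ => exact ⟨ih₁, ih₂⟩
  | or φ ψ ih₁ ih₂ => exact ⟨ih₁, ih₂⟩
  | _ => trivial

theorem QF.admissible_inst {V : Type} (f : V → ℕ) (σ : ℕ → L.Term ℕ) (α : QF L V) :
    Form.Admissible σ (α.inst f) := by
  induction α with
  | neg φ ih => exact ih
  | and φ ψ ih₁ ih₂ => exact ⟨ih₁, ih₂⟩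
  | or φ ψ ih₁ ih₂ => exact ⟨ih₁, ih₂⟩
  | _ => trivial

theorem term_relabel_subst {V : Type} {f g : V → ℕ} {σ : ℕ → L.Term ℕ}
    (h : ∀ v, σ (f v) = .var (g v)) (t : L.Term V) : (t.relabel f).subst σ = t.relabel g := by
  rw [Term.relabel_eq_subst, Term.relabel_eq_subst, Term.subst_subst_eq]
  simp only [Term.subst, h]

theorem QF.subst_inst {V : Type} {f g : V → ℕ} {σ : ℕ → L.Term ℕ}
    (h : ∀ v, σ (f v) = .var (g v)) (α : QF L V) : Form.subst σ (α.inst f) = α.inst g := by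
  induction α with
  | bot => rfl
  | eq t s => simp only [QF.inst, Form.subst, term_relabel_subst h]
  | rel R ts => simp only [QF.inst, Form.subst, term_relabel_subst h]
  | neg φ ih => simp only [QF.inst, Form.subst, ih]
  | and φ ψ ih₁ ih₂ => simp only [QF.inst, Form.subst, ih₁, ih₂]
  | or φ ψ ih₁ ih₂ => simp only [QF.inst, Form.subst, ih₁, ih₂]

theorem mem_varFinset_relabel {V : Type} {f : V → ℕ} {t : L.Term V} {z : ℕ}
    (h : z ∈ (t.relabel f).varFinset) : ∃ v, f v = z := by
  induction t with
  | var v => exact ⟨v, by simpa [Term.relabel, Term.varFinset, eq_comm] using h⟩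
  | func F ts ih =>
    simp only [Term.relabel, Term.varFinset, Finset.mem_biUnion, Finset.mem_univ, true_and] at h
    obtain ⟨i, h⟩ := h
    exact ih i h

theorem QF.exists_of_mem_fv_inst {V : Type} {f : V → ℕ} {α : QF L V} {z : ℕ}
    (h : z ∈ (α.inst f).fv) : ∃ v, f v = z := by
  induction α with
  | bot => simp [QF.inst, Form.fv] at h
  | eq t s =>
    simp only [QF.inst, Form.fv, Finset.mem_union] at h
    exact h.elim mem_varFinset_relabel mem_varFinset_relabel
  | rel R ts =>
    simp only [QF.inst, Form.fv, Finset.mem_biUnion, Finset.mem_univ, true_and] at h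
    obtain ⟨i, h⟩ := h
    exact mem_varFinset_relabel h
  | neg φ ih => exact ih h
  | and φ ψ ih₁ ih₂ =>
    simp only [QF.inst, Form.fv, Finset.mem_union] at h
    exact h.elim ih₁ ih₂
  | or φ ψ ih₁ ih₂ =>
    simp only [QF.inst, Form.fv, Finset.mem_union] at h
    exact h.elim ih₁ ih₂

theorem QF.bv_inst {V : Type} (f : V → ℕ) (α : QF L V) : (α.inst f).bv = ∅ := by
  induction α with
  | neg φ ih => exact ih
  | and φ ψ ih₁ ih₂ => simp [QF.inst, Form.bv, ih₁, ih₂]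
  | or φ ψ ih₁ ih₂ => simp [QF.inst, Form.bv, ih₁, ih₂]
  | _ => rfl

theorem seqSub_map {V : Type} {c f : V → ℕ} (hc : c.Injective) {e : List V} {v : V} (hv : v ∈ e) :
    (Form.seqSub (e.map f) (e.map c) : ℕ → L.Term ℕ) (c v) = .var (f v) := by
  have : ((e.map c).zip (e.map f)).lookup (c v) = some (f v) := by
    induction e with
    | nil => simp at hv
    | cons a e ih =>
      rw [List.map_cons, List.map_cons, List.zip_cons_cons, List.lookup_cons]
      by_cases hva : v = a
      · simp [hva]
      · rw [show (c v == c a) = false by simpa using fun h => hva (hc h)]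
        exact ih ((List.mem_cons.1 hv).resolve_left hva)
  rw [Form.seqSub, this, Option.getD_some]

/-- A quantifier-free formula is preserved along an inclusion atom. -/
theorem Deriv.inst_of_inc {V : Type} [Encodable V] {Γ : Set (Form L)} {f g : V → ℕ} {e : List V}
    (hn : e.Nodup) (he : ∀ v, v ∈ e) {α : QF L V} (h : Deriv Γ (.inc (e.map f) (e.map g)))
    (hg : Deriv Γ (α.inst g)) : Deriv Γ (α.inst f) := by
  -- The rule requires a template whose free variables lie in a list of distinct variables; the
  -- codes of the elements of `V` are used as these.
  have hc : (Encodable.encode : V → ℕ).Injective := Encodable.encode_injective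
  have key : ∀ f : V → ℕ, Form.subst (Form.seqSub (e.map f) (e.map Encodable.encode))
      (α.inst Encodable.encode) = α.inst f :=
    fun f => α.subst_inst fun v => seqSub_map hc (he v)
  rw [← key]
  refine Deriv.incCmp (xs := e.map g) (α.isFO_inst _) (hn.map hc) (by simp) (by simp) ?_
    (α.admissible_inst _ _) (α.admissible_inst _ _) h (by rwa [key])
  intro z hz
  obtain ⟨v, rfl⟩ := QF.exists_of_mem_fv_inst hz
  exact List.mem_toFinset.2 (List.mem_map.2 ⟨v, he v, rfl⟩)

/-- Copying: an inclusion atom may be extended by fresh variables for a witness. -/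
theorem Deriv.inc_block {Γ : Set (Form L)} {xs zs us vs : List ℕ} {ψ : Form L}
    (hl : xs.length = zs.length) (hn : xs.Nodup) (hx : ∀ x ∈ xs, x ∉ us ++ vs ++ zs)
    (hψ : ∀ x ∈ xs, x ∉ ψ.fv) (hΓ : ∀ δ ∈ Γ, ∀ x ∈ xs, x ∉ δ.fv)
    (h : Deriv Γ (.inc us vs))
    (h1 : ∀ Γ', Γ ⊆ Γ' → (∀ δ ∈ Γ', δ ∈ Γ ∨ ∀ z ∈ δ.fv, z ∈ us ++ xs ++ (vs ++ zs)) →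
      Deriv Γ' (.inc (us ++ xs) (vs ++ zs)) → Deriv Γ' ψ) : Deriv Γ ψ := by
  induction xs generalizing zs us vs Γ with
  | nil =>
    obtain rfl : zs = [] := List.length_eq_zero_iff.1 hl.symm
    exact h1 Γ subset_rfl (fun δ hδ => .inl hδ) (by simpa using h)
  | cons x xs ih =>
    cases zs with
    | nil => simp at hl
    | cons z zs =>
      simp only [List.nodup_cons] at hn
      simp only [List.mem_append, List.mem_cons, not_or] at hx hψ hΓ
      have hx0 := hx x (.inl rfl)
      -- Weakening appends one pair of variables at a time. Each quantifier is eliminated with the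
      -- whole context kept, which is why the free variables of the growing context are recorded.
      refine Deriv.exE (x := x) subset_rfl (hψ x (.inl rfl)) (fun δ hδ => hΓ δ hδ x (.inl rfl))
        (Deriv.incWEx (w := x) (z := z)
          (by simp only [List.mem_append, List.mem_singleton, not_or]; exact ⟨hx0.1, hx0.2.1⟩) h) ?_
      refine ih (zs := zs) (by simpa using hl) hn.2 (fun y hy => ?_) (fun y hy => hψ y (.inr hy))
        ?_ (Deriv.ass_insert (by have := h.wf; simpa [Form.WF] using this)) ?_
      · have := hx y (.inr hy)
        simp only [List.mem_append, List.mem_singleton, not_or]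
        exact ⟨⟨⟨this.1.1, fun e => hn.1 (e ▸ hy)⟩, this.1.2, this.2.1⟩, this.2.2⟩
      · rintro δ (rfl | hδ) y hy
        · have := hx y (.inr hy)
          simp only [Form.fv, Finset.mem_union, List.mem_toFinset, List.mem_append,
            List.mem_singleton, not_or]
          exact ⟨⟨this.1.1, fun e => hn.1 (e ▸ hy)⟩, this.1.2, this.2.1⟩
        · exact hΓ δ hδ y (.inr hy)
      · intro Γ' hs hfv hd
        refine h1 Γ' ((Set.subset_insert _ _).trans hs) (fun δ hδ => ?_) (by simpa using hd)
        rcases hfv δ hδ with (rfl | h) | h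
        · refine .inr fun y hy => ?_
          simp only [Form.fv, Finset.mem_union, List.mem_toFinset, List.mem_append,
            List.mem_singleton] at hy
          simp only [List.mem_append, List.mem_cons]
          tauto
        · exact .inl h
        · exact .inr fun y hy => by simpa [or_assoc] using h y hy

/-- Reflexivity is not among the rules; it is the simulation rule for an empty block of quantifiers,
applied to `⊤`. -/
theorem Deriv.inc_refl (Γ : Set (Form L)) (xs : List ℕ) : Deriv Γ (.inc xs xs) := by
  have := Deriv.allSim (xs := []) (ys := []) (zs := xs) (φ := (Form.top : Form L)) (by simp)
    (by simp) (by simp [Form.top, Form.fv]) rfl (by simp) (by simp) (by simp) (Deriv.topI Γ)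
  simpa using Deriv.andE1 this

/-! ### Derivations of the approximations from a sentence in normal form -/

/-- The code is zero, odd, or positive and even according to the constructor, and pairing is
injective. -/
theorem Idx.code_injective : Function.Injective Idx.code := by
  intro a
  induction a with
  | root => intro b h; cases b <;> simp [Idx.code] at h ⊢
  | e ξ i ih =>
    intro b h
    cases b with
    | root => simp [Idx.code] at h
    | e ξ' i' =>
      simp only [Idx.code, Nat.add_right_cancel_iff, mul_eq_mul_left_iff, Nat.pair_eq_pair] at h
      obtain ⟨h1, rfl⟩ := h.resolve_right (by decide)
      rw [ih h1]
    | u ξ' η j => simp only [Idx.code] at h; omega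
  | u ξ η j ih =>
    intro b h
    cases b with
    | root => simp [Idx.code] at h
    | e ξ' i' => simp only [Idx.code] at h; omega
    | u ξ' η' j' =>
      simp only [Idx.code, Nat.add_right_cancel_iff, mul_eq_mul_left_iff, Nat.pair_eq_pair] at h
      obtain ⟨h1, rfl, rfl⟩ := h.resolve_right (by decide)
      rw [ih h1]

/-- The layer of an index. -/
def Idx.depth : Idx → ℕ
  | .root => 0
  | .e ξ _ => ξ.depth + 1
  | .u ξ η _ => max ξ.depth η + 1

namespace NormalForm

variable (N : NormalForm L)

/-- The positions of the bound variables of a normal form. -/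
abbrev Pos : Type := Fin N.nw ⊕ Fin N.nx

/-- All positions. -/
def positions : List N.Pos := List.ofFn Sum.inl ++ List.ofFn Sum.inr

theorem mem_positions (v : N.Pos) : v ∈ N.positions := by
  cases v <;> simp [positions, List.mem_ofFn]

theorem nodup_positions : N.positions.Nodup := by
  refine List.Nodup.append (List.nodup_ofFn.2 Sum.inl_injective)
    (List.nodup_ofFn.2 Sum.inr_injective) ?_
  intro a h h'
  simp only [List.mem_ofFn] at h h'
  obtain ⟨⟨i, rfl⟩, j, h⟩ := And.intro h h'
  cases h

/-- The variables `w_ξ x_ξ`. -/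
def name (ξ : Idx) : N.Pos → ℕ := Sum.elim (fun k => wVar ξ k) fun k => xVar ξ k

def selρ (i : Fin N.nI) : List N.Pos := List.ofFn fun k => .inl (N.ρ i k)
def selσ (i : Fin N.nI) : List N.Pos := List.ofFn fun k => .inl (N.σ i k)
def selπ (j : Fin N.nJ) : List N.Pos := List.ofFn fun k => .inr (N.π j k)
def selτ (j : Fin N.nJ) : List N.Pos := List.ofFn fun k => .inr (N.τ j k)

theorem subperm_positions {l : List N.Pos} (h : l.Nodup) : l.Subperm N.positions :=
  List.subperm_of_subset h fun v _ => N.mem_positions v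

theorem nodup_selρ (i) : (N.selρ i).Nodup :=
  List.nodup_ofFn.2 (Sum.inl_injective.comp (N.ρ i).injective)

theorem nodup_selπ (j) : (N.selπ j).Nodup :=
  List.nodup_ofFn.2 (Sum.inr_injective.comp (N.π j).injective)

/-- Residues modulo 3 separate the `w`-variables from the `x`-variables; within each kind, pairing
separates the indices and the positions. -/
theorem name_injective {ξ ξ' : Idx} {v v' : N.Pos} (h : N.name ξ v = N.name ξ' v') :
    ξ = ξ' ∧ v = v' := by
  rcases v with v | v <;> rcases v' with v' | v' <;>
    simp only [name, Sum.elim_inl, Sum.elim_inr, wVar, xVar] at h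
  · have := Nat.pair_eq_pair.1 (show Nat.pair ξ.code v = Nat.pair ξ'.code v' by omega)
    exact ⟨Idx.code_injective this.1, congrArg _ (Fin.ext this.2)⟩
  · omega
  · omega
  · have := Nat.pair_eq_pair.1 (show Nat.pair ξ.code v = Nat.pair ξ'.code v' by omega)
    exact ⟨Idx.code_injective this.1, congrArg _ (Fin.ext this.2)⟩

theorem name_ne_yVar {ξ : Idx} {v : N.Pos} {η : ℕ} : N.name ξ v ≠ yVar η := by
  rcases v with v | v <;> simp only [name, Sum.elim_inl, Sum.elim_inr, wVar, xVar, yVar] <;> omega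

theorem name_mem_layerVars {k : ℕ} {ξ : Idx} (h : ξ ∈ N.layer k) (v : N.Pos) :
    N.name ξ v ∈ N.layerVars k := by
  simp only [layerVars, List.mem_append, List.mem_flatMap, List.mem_map, List.mem_range]
  rcases v with v | v
  · exact .inl ⟨ξ, h, v, v.2, rfl⟩
  · exact .inr ⟨ξ, h, v, v.2, rfl⟩

theorem layers_succ (n : ℕ) : N.layers (n + 1) = ((N.layers n).1 ++ (N.layers n).2,
    N.nextE (N.layers n).2 ++ N.nextU (nextA (N.layers n).1 (N.layers n).2 n)) := rfl

theorem mem_nextE {cur : List Idx} {ζ : Idx} :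
    ζ ∈ N.nextE cur ↔ ∃ ξ ∈ cur, ∃ i < N.nI, ζ = .e ξ i := by
  simp [nextE, eq_comm]

theorem mem_nextU {A : List (Idx × ℕ)} {ζ : Idx} :
    ζ ∈ N.nextU A ↔ ∃ a ∈ A, ∃ j < N.nJ, ζ = .u a.1 a.2 j := by
  simp [nextU, eq_comm]

theorem mem_nextA {old cur : List Idx} {n : ℕ} {a : Idx × ℕ} :
    a ∈ nextA old cur n ↔ (a.1 ∈ old ∧ a.2 = n) ∨ (a.1 ∈ cur ∧ a.2 < n + 1) := by
  obtain ⟨ξ, η⟩ := a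
  simp [nextA, eq_comm]

/-- In a pair `ξη` that is new at stage `n + 1`, neither the layer of `ξ` nor `η` exceeds `n` and
one of them equals `n`, so the maximum in `Idx.depth` is exactly `n`. -/
theorem depth_layers (n : ℕ) :
    (∀ ξ ∈ (N.layers n).1, ξ.depth < n) ∧ ∀ ξ ∈ (N.layers n).2, ξ.depth = n := by
  induction n with
  | zero => simp [layers, Idx.depth]
  | succ n ih =>
    simp only [layers_succ, List.mem_append, mem_nextE, mem_nextU, mem_nextA]
    refine ⟨?_, ?_⟩
    · rintro ξ (h | h)
      · exact (ih.1 ξ h).trans n.lt_succ_self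
      · exact (ih.2 ξ h).trans_lt n.lt_succ_self
    · rintro ζ (⟨ξ, hξ, i, hi, rfl⟩ | ⟨⟨ξ, η⟩, (⟨hξ, hη⟩ | ⟨hξ, hη⟩), j, hj, rfl⟩)
      · simp [Idx.depth, ih.2 ξ hξ]
      · have := ih.1 ξ hξ; simp only at hη; simp only [Idx.depth, hη]; omega
      · have := ih.2 ξ hξ; simp only at hη; simp only [Idx.depth, this]; omega

/-- An index listed twice would have its block of variables introduced a second time, when it is no
longer fresh. -/
theorem nodup_layers (n : ℕ) : ((N.layers n).1).Nodup ∧ ((N.layers n).2).Nodup := by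
  induction n with
  | zero => simp [layers]
  | succ n ih =>
    have hdis : (N.layers n).1.Disjoint (N.layers n).2 := fun ξ h h' => by
      have := (N.depth_layers n).1 ξ h; have := (N.depth_layers n).2 ξ h'; omega
    rw [layers_succ]
    refine ⟨ih.1.append ih.2 hdis, List.Nodup.append ?_ ?_ ?_⟩
    · refine List.nodup_flatMap.2 ⟨fun ξ _ => ?_, ?_⟩
      · exact List.nodup_range.map fun a b h => by simpa using h
      · refine ih.2.imp fun {a b} hab ζ h h' => ?_
        simp only [List.mem_map, List.mem_range] at h h'
        obtain ⟨i, -, rfl⟩ := h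
        obtain ⟨i', -, h'⟩ := h'
        exact hab (by simpa using (Idx.e.inj h').1.symm)
    · refine List.nodup_flatMap.2 ⟨fun ξ _ => ?_, ?_⟩
      · exact List.nodup_range.map fun a b h => by simpa using h
      · have hA : (nextA (N.layers n).1 (N.layers n).2 n).Nodup := by
          refine List.Nodup.append (ih.1.map fun a b h => by simpa using h) ?_ ?_
          · refine List.nodup_flatMap.2 ⟨fun ξ _ => ?_, ?_⟩
            · exact List.nodup_range.map fun a b h => by simpa using h
            · refine ih.2.imp fun {a b} hab ζ h h' => ?_
              simp only [List.mem_map, List.mem_range] at h h'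
              obtain ⟨i, -, rfl⟩ := h
              obtain ⟨i', -, h'⟩ := h'
              exact hab (by simpa using (Prod.mk.inj h').1.symm)
          · intro a h h'
            simp only [List.mem_map, List.mem_flatMap] at h h'
            obtain ⟨ξ, hξ, rfl⟩ := h
            obtain ⟨ξ', hξ', i, -, h⟩ := h'
            exact hdis hξ ((Prod.mk.inj h).1 ▸ hξ')
        refine hA.imp fun {a b} hab ζ h h' => ?_
        simp only [List.mem_map, List.mem_range] at h h'
        obtain ⟨i, -, rfl⟩ := h
        obtain ⟨i', -, h'⟩ := h'
        have := Idx.u.inj h'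
        exact hab (Prod.ext this.1.symm this.2.1.symm)
    · intro ζ h h'
      rw [mem_nextE] at h
      rw [mem_nextU] at h'
      obtain ⟨ξ, -, i, -, rfl⟩ := h
      obtain ⟨a, -, j, -, h⟩ := h'
      cases h

end NormalForm

end IncLogic

/-! ### Playing the game inside the deduction system -/

namespace IncLogic

open Language

variable {L : FirstOrder.Language.{u, v}}

namespace NormalForm

variable (N : NormalForm L)

/-- The matrix of a sentence in normal form, for the variables `g` in place of `w x` and `Y` in
place of `y`, is derivable from `Γ`. -/
structure Matrix (Γ : Set (Form L)) (g : N.Pos → ℕ) (Y : ℕ) : Prop where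
  ρσ : ∀ i, Deriv Γ (.inc ((N.selρ i).map g) ((N.selσ i).map g))
  πτ : ∀ j, Deriv Γ (.all Y (.inc ((N.selπ j).map g ++ [Y]) ((N.selτ j).map g)))
  α : Deriv Γ (N.α.inst g)

variable {N}

theorem Matrix.mono {Γ Γ' : Set (Form L)} {g : N.Pos → ℕ} {Y : ℕ} (h : N.Matrix Γ g Y)
    (hs : Γ ⊆ Γ') : N.Matrix Γ' g Y :=
  ⟨fun i => (h.ρσ i).mono hs, fun j => (h.πτ j).mono hs, h.α.mono hs⟩

/-- The invariant for `f` is projected to the positions of `ρⁱ` and composed with the atom of the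
matrix. -/
theorem Matrix.inc_ρσ {Γ : Set (Form L)} {f g : N.Pos → ℕ} {Y : ℕ} (h : N.Matrix Γ g Y)
    (hf : Deriv Γ (.inc (N.positions.map f) (N.positions.map g))) (i : Fin N.nI) :
    Deriv Γ (.inc ((N.selρ i).map f) ((N.selσ i).map g)) :=
  (Deriv.inc_select (N.subperm_positions (N.nodup_selρ i)) hf).incTrs (h.ρσ i)

/-- Under `∀Y` the invariant may be extended by `y` on the left and `Y` on the right. There the atom
of the matrix applies to `Y`, and the composed atom does not contain `Y`, so the quantifier can be
dropped. -/
theorem Matrix.inc_πτ {Γ : Set (Form L)} {f g : N.Pos → ℕ} {Y y : ℕ} (h : N.Matrix Γ g Y)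
    (hf : Deriv Γ (.inc (N.positions.map f) (N.positions.map g)))
    (hYf : ∀ v, f v ≠ Y) (hYg : ∀ v, g v ≠ Y) (hy : y ≠ Y) (j : Fin N.nJ) :
    Deriv Γ (.inc ((N.selπ j).map f ++ [y]) ((N.selτ j).map g)) := by
  have h1 : Deriv Γ (.all Y (.inc (N.positions.map f ++ [y]) (N.positions.map g ++ [Y]))) := by
    refine Deriv.incWAll ?_ hf
    simp only [List.mem_append, List.mem_map, List.mem_singleton, not_or, not_exists, not_and]
    exact ⟨⟨fun v _ => hYf v, fun v _ => hYg v⟩, hy.symm⟩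
  refine Deriv.allE₀ (x := Y) ?_ (Deriv.allMono (h1.allAndExt (h.πτ j)) fun Γ hd => ?_)
  · simp only [Form.fv, Finset.mem_union, List.mem_toFinset, List.mem_append, List.mem_map,
      List.mem_singleton, not_or, not_exists, not_and]
    exact ⟨⟨fun v _ => hYf v, hy.symm⟩, fun v _ => hYg v⟩
  · refine Deriv.incTrs (ys := (N.selπ j).map g ++ [Y]) ?_ hd.andE2
    have hd1 := hd.andE1
    -- The extra position `none` stands for the column of `y` over `Y`.
    have key := Deriv.inc_select (ι := Option N.Pos) (f := fun o => o.elim y f)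
      (g := fun o => o.elim Y g) (l := (N.selπ j).map some ++ [none])
      (e := N.positions.map some ++ [none]) (Γ := Γ) (List.subperm_of_subset ?_ ?_)
      (by simpa [Function.comp_def] using hd1)
    · simpa [Function.comp_def] using key
    · refine List.Nodup.append ((N.nodup_selπ j).map (Option.some_injective _)) (by simp) ?_
      simp
    · intro o ho
      cases o with
      | none => simp
      | some v => simpa using N.mem_positions v

/-- The inclusion atom `us ⊆ vs` whose witnesses are the values of `w_ξ x_ξ`. -/
def IsSource (g : N.Pos → ℕ) (ξ : Idx) (us vs : List ℕ) : Prop :=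
  (∀ ζ (i : Fin N.nI), ξ = .e ζ i →
    us = (N.selρ i).map (N.name ζ) ∧ vs = (N.selσ i).map g) ∧
  ∀ ζ η (j : Fin N.nJ), ξ = .u ζ η j →
    us = (N.selπ j).map (N.name ζ) ++ [yVar η] ∧ vs = (N.selτ j).map g

/-- The blocks of a layer are introduced one after another, each through its own source atom; no
source atom depends on another block of the list, so all are available at the start. The predicate
`P` covers the variables in use and grows with every block, which keeps the blocks still to come
fresh. -/
theorem deriv_of_blocks {g : N.Pos → ℕ} {ψ : Form L} (l : List Idx) (hn : l.Nodup)
    (hψ : ∀ ξ ∈ l, ∀ v, N.name ξ v ∉ ψ.fv) (P : ℕ → Prop)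
    (hP : ∀ ξ ∈ l, ∀ v, ¬ P (N.name ξ v)) (hg : ∀ v, P (g v)) {Γ : Set (Form L)}
    (hΓ : ∀ δ ∈ Γ, ∀ z ∈ δ.fv, P z)
    (hsrc : ∀ ξ ∈ l, ∃ us vs, IsSource g ξ us vs ∧ (∀ z ∈ us ++ vs, P z) ∧ Deriv Γ (.inc us vs))
    (h : ∀ Γ', Γ ⊆ Γ' → (∀ δ ∈ Γ', ∀ z ∈ δ.fv, P z ∨ ∃ ξ ∈ l, ∃ v, z = N.name ξ v) →
      (∀ ξ ∈ l, ∃ us vs, IsSource g ξ us vs ∧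
        Deriv Γ' (.inc (us ++ N.positions.map (N.name ξ)) (vs ++ N.positions.map g))) →
      Deriv Γ' ψ) : Deriv Γ ψ := by
  induction l generalizing P Γ with
  | nil => exact h Γ subset_rfl (fun δ hδ z hz => .inl (hΓ δ hδ z hz)) (by simp)
  | cons ξ l ih =>
    simp only [List.nodup_cons] at hn
    obtain ⟨us, vs, hs, hPs, hd⟩ := hsrc ξ (by simp)
    have hmem : ∀ {z}, z ∈ us ++ N.positions.map (N.name ξ) ++ (vs ++ N.positions.map g) →
        P z ∨ ∃ v, z = N.name ξ v := by
      intro z hz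
      simp only [List.mem_append, List.mem_map] at hz hPs
      rcases hz with (hz | ⟨v, -, rfl⟩) | hz | ⟨v, -, rfl⟩
      · exact .inl (hPs z (.inl hz))
      · exact .inr ⟨v, rfl⟩
      · exact .inl (hPs z (.inr hz))
      · exact .inl (hg v)
    refine hd.inc_block (xs := N.positions.map (N.name ξ)) (zs := N.positions.map g) (by simp)
      (N.nodup_positions.map fun v v' e => (N.name_injective e).2) ?_ ?_ ?_ ?_
    · intro x hx hx'
      obtain ⟨v, -, rfl⟩ := List.mem_map.1 hx
      rcases List.mem_append.1 hx' with hx' | hx'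
      · exact hP ξ (by simp) v (hPs _ hx')
      · obtain ⟨v', -, e⟩ := List.mem_map.1 hx'
        exact hP ξ (by simp) v (e ▸ hg v')
    · intro x hx
      obtain ⟨v, -, rfl⟩ := List.mem_map.1 hx
      exact hψ ξ (by simp) v
    · intro δ hδ x hx hx'
      obtain ⟨v, -, rfl⟩ := List.mem_map.1 hx
      exact hP ξ (by simp) v (hΓ δ hδ _ hx')
    · intro Γ' hΓ' hfv hd'
      refine ih hn.2 (fun ζ hζ => hψ ζ (by simp [hζ])) (fun z => P z ∨ ∃ v, z = N.name ξ v)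
        ?_ (fun v => .inl (hg v)) ?_ ?_ ?_
      · rintro ζ hζ v (hp | ⟨v', e⟩)
        · exact hP ζ (by simp [hζ]) v hp
        · exact hn.1 ((N.name_injective e).1 ▸ hζ)
      · intro δ hδ z hz
        rcases hfv δ hδ with h' | h'
        · exact .inl (hΓ δ h' z hz)
        · exact hmem (h' z hz)
      · intro ζ hζ
        obtain ⟨us', vs', a, b, c⟩ := hsrc ζ (by simp [hζ])
        exact ⟨us', vs', a, fun z hz => .inl (b z hz), c.mono hΓ'⟩
      · intro Γ'' hΓ'' hfv' hinc
        refine h Γ'' (hΓ'.trans hΓ'') (fun δ hδ z hz => ?_) ?_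
        · rcases hfv' δ hδ z hz with (h' | ⟨v, h'⟩) | ⟨ζ, hζ, v, h'⟩
          · exact .inl h'
          · exact .inr ⟨ξ, by simp, v, h'⟩
          · exact .inr ⟨ζ, by simp [hζ], v, h'⟩
        · intro ζ hζ
          rcases List.mem_cons.1 hζ with rfl | hζ
          · exact ⟨us, vs, hs, hd'.mono hΓ''⟩
          · exact hinc ζ hζ

/-- The variables in use when layer `k` is reached. -/
def Used (g : N.Pos → ℕ) (Y k z : ℕ) : Prop :=
  z = Y ∨ (∃ v, z = g v) ∨ (∃ ξ v, ξ.depth < k ∧ z = N.name ξ v) ∨ ∃ η < k, z = yVar η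

theorem inc_of_block {Γ : Set (Form L)} {us vs xs ys : List ℕ} (hl : us.length = vs.length)
    (h : Deriv Γ (.inc (us ++ xs) (vs ++ ys))) : Deriv Γ (.inc xs ys) := by
  have hl' : xs.length = ys.length := by have := h.wf; simpa [Form.WF, hl] using this
  have h1 := Deriv.incExc (xs := us) (ys := xs) (zs := []) (us := vs) (vs := ys) (ws := []) hl hl'
    rfl (by simpa using h)
  simp only [List.append_nil] at h1
  exact h1.incCtr hl' hl

variable {g : N.Pos → ℕ} {Y : ℕ}

theorem IsSource.length_eq {ξ : Idx} {us vs : List ℕ} {Γ : Set (Form L)}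
    (h : Deriv Γ (.inc (us ++ N.positions.map (N.name ξ)) (vs ++ N.positions.map g))) :
    us.length = vs.length := by
  have := h.wf
  simpa [Form.WF] using this

/-- The conjunction `λ_k`, once witnesses for layer `k` are available. -/
theorem deriv_lambdaN {k : ℕ} {Γ : Set (Form L)} (hM : N.Matrix Γ g Y)
    (h : ∀ ξ ∈ N.layer k, ∃ us vs, IsSource g ξ us vs ∧
        Deriv Γ (.inc (us ++ N.positions.map (N.name ξ)) (vs ++ N.positions.map g))) :
    Deriv Γ (N.lambdaN k) := by
  have hα : Deriv Γ (N.alphaN k) := by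
    refine Deriv.conj_iff.2 fun φ hφ => ?_
    obtain ⟨ξ, hξ, rfl⟩ := List.mem_map.1 hφ
    obtain ⟨us, vs, -, hd⟩ := h ξ hξ
    exact Deriv.inst_of_inc N.nodup_positions N.mem_positions
      (inc_of_block (IsSource.length_eq hd) hd) hM.α
  cases k with
  | zero => exact hα
  | succ k =>
    refine hα.andI (Deriv.andI ?_ ?_)
    · refine Deriv.conj_iff.2 fun φ hφ => ?_
      simp only [List.mem_flatMap, List.mem_ofFn] at hφ
      obtain ⟨ξ, hξ, i, rfl⟩ := hφ
      have hmem : Idx.e ξ i ∈ N.layer (k + 1) :=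
        List.mem_append_left _ (N.mem_nextE.2 ⟨ξ, hξ, i, i.2, rfl⟩)
      obtain ⟨us, vs, hs, hd⟩ := h _ hmem
      -- In the extended source atom both `ρⁱ_{w_ξ}` and the `σⁱ`-part of the new block stand over
      -- the `σⁱ`-part of `g`.
      obtain ⟨rfl, rfl⟩ := hs.1 ξ i rfl
      have := Deriv.seqEq_of_inc (fun v _ => N.mem_positions v) (by simp [selρ, selσ]) hd
      simpa [selρ, selσ, List.map_ofFn, Function.comp_def, name] using this
    · refine Deriv.conj_iff.2 fun φ hφ => ?_
      simp only [List.mem_flatMap, List.mem_ofFn] at hφ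
      obtain ⟨⟨ξ, η⟩, hξ, j, rfl⟩ := hφ
      have hmem : Idx.u ξ η j ∈ N.layer (k + 1) :=
        List.mem_append_right _ (N.mem_nextU.2 ⟨_, hξ, j, j.2, rfl⟩)
      obtain ⟨us, vs, hs, hd⟩ := h _ hmem
      obtain ⟨rfl, rfl⟩ := hs.2 ξ η j rfl
      have := Deriv.seqEq_of_inc (fun v _ => N.mem_positions v) (by simp [selπ, selτ]) hd
      simpa [selπ, selτ, List.map_ofFn, Function.comp_def, name] using this

/-- One step of the game: from the witnesses for the layers before `k` to those for layer `k`. -/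
theorem deriv_layer {k : ℕ} {θ : Form L} {Γ : Set (Form L)} (hM : N.Matrix Γ g Y)
    (hg : ∀ v ξ v', g v ≠ N.name ξ v') (hgy : ∀ v η, g v ≠ yVar η)
    (hY : ∀ ξ v, Y ≠ N.name ξ v) (hYy : ∀ η, Y ≠ yVar η) (hYg : ∀ v, g v ≠ Y)
    (hΓ : ∀ δ ∈ Γ, ∀ z ∈ δ.fv, N.Used g Y k z)
    (hinc : ∀ ξ ∈ (N.layers k).1,
      Deriv Γ (.inc (N.positions.map (N.name ξ)) (N.positions.map g)))
    (h : ∀ Γ', Γ ⊆ Γ' → (∀ δ ∈ Γ', ∀ z ∈ δ.fv, N.Used g Y (k + 1) z) →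
      (∀ ξ ∈ (N.layers (k + 1)).1,
        Deriv Γ' (.inc (N.positions.map (N.name ξ)) (N.positions.map g))) →
      Deriv Γ' (N.lambdaN k) → Deriv Γ' θ) :
    Deriv Γ (.exs (N.layerVars k) (.all (yVar k) θ)) := by
  have hdepth := N.depth_layers k
  refine deriv_of_blocks (g := g) (N.layer k) (N.nodup_layers k).2 ?_ (N.Used g Y k) ?_
    (fun v => .inr (.inl ⟨v, rfl⟩)) hΓ ?_ ?_
  · intro ξ hξ v hv
    exact (Form.mem_fv_exs.1 hv).2 (N.name_mem_layerVars hξ v)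
  · rintro ξ hξ v (e | ⟨v', e⟩ | ⟨ζ, v', hζ, e⟩ | ⟨η, -, e⟩)
    · exact hY ξ v e.symm
    · exact hg v' ξ v e.symm
    · have := hdepth.2 ξ hξ
      rw [(N.name_injective e).1] at this
      omega
    · exact N.name_ne_yVar e
  · intro ξ hξ
    have sel_name : ∀ {l : List N.Pos} {ζ : Idx} {z : ℕ}, ζ.depth < k → z ∈ l.map (N.name ζ) →
        N.Used g Y k z := by
      intro l ζ z hζ hz
      obtain ⟨v, -, rfl⟩ := List.mem_map.1 hz
      exact .inr (.inr (.inl ⟨ζ, v, hζ, rfl⟩))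
    have sel_g : ∀ {l : List N.Pos} {z : ℕ}, z ∈ l.map g → N.Used g Y k z := by
      intro l z hz
      obtain ⟨v, -, rfl⟩ := List.mem_map.1 hz
      exact .inr (.inl ⟨v, rfl⟩)
    cases k with
    | zero =>
      -- The root answers no move: its block extends the empty inclusion atom.
      obtain rfl : ξ = .root := by simpa [layer, layers] using hξ
      exact ⟨[], [], ⟨fun _ _ h => (by cases h), fun _ _ _ h => (by cases h)⟩, by simp,
        Deriv.inc_refl Γ []⟩
    | succ k =>
      have hold : ∀ ζ ∈ (N.layers k).1 ++ (N.layers k).2, ζ.depth < k + 1 := hdepth.1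
      rcases List.mem_append.1 hξ with hξ | hξ
      · obtain ⟨ζ, hζ, i, hi, rfl⟩ := N.mem_nextE.1 hξ
        have hζ' : ζ ∈ (N.layers k).1 ++ (N.layers k).2 := List.mem_append_right _ hζ
        refine ⟨_, _, ⟨?_, fun _ _ _ h => (by cases h)⟩, ?_, hM.inc_ρσ (hinc ζ hζ') ⟨i, hi⟩⟩
        · intro ζ' i' e
          obtain ⟨rfl, rfl⟩ := Idx.e.inj e
          exact ⟨rfl, rfl⟩
        · intro z hz
          rcases List.mem_append.1 hz with hz | hz
          · exact sel_name (hold ζ hζ') hz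
          · exact sel_g hz
      · obtain ⟨⟨ζ, η⟩, hζ, j, hj, rfl⟩ := N.mem_nextU.1 hξ
        -- Old indices are paired with `η = k`, current ones with every `η ≤ k`; either way `y_η`
        -- belongs to an earlier layer than the one being built.
        have hζη : ζ ∈ (N.layers k).1 ++ (N.layers k).2 ∧ η < k + 1 := by
          rcases mem_nextA.1 hζ with ⟨a, b⟩ | ⟨a, b⟩
          · exact ⟨List.mem_append_left _ a, by simp only at b; omega⟩
          · exact ⟨List.mem_append_right _ a, b⟩
        refine ⟨_, _, ⟨fun _ _ h => (by cases h), ?_⟩, ?_, hM.inc_πτ (hinc ζ hζη.1) (y := yVar η)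
          (fun v => (hY ζ v).symm) hYg (hYy η).symm ⟨j, hj⟩⟩
        · intro ζ' η' j' e
          obtain ⟨rfl, rfl, rfl⟩ := Idx.u.inj e
          exact ⟨rfl, rfl⟩
        · intro z hz
          rcases List.mem_append.1 hz with hz | hz
          · rcases List.mem_append.1 hz with hz | hz
            · exact sel_name (hold ζ hζη.1) hz
            · exact .inr (.inr (.inr ⟨η, hζη.2, List.mem_singleton.1 hz⟩))
          · exact sel_g hz
  · intro Γ' hs hfv hsrc
    have hUsed : ∀ δ ∈ Γ', ∀ z ∈ δ.fv, N.Used g Y (k + 1) z ∧ z ≠ yVar k := by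
      intro δ hδ z hz
      rcases hfv δ hδ z hz with (rfl | ⟨v, rfl⟩ | ⟨ζ, v', hζ, rfl⟩ | ⟨η, hη, rfl⟩) | ⟨ξ, hξ, v, rfl⟩
      · exact ⟨.inl rfl, hYy k⟩
      · exact ⟨.inr (.inl ⟨v, rfl⟩), hgy v k⟩
      · exact ⟨.inr (.inr (.inl ⟨ζ, v', by omega, rfl⟩)), N.name_ne_yVar⟩
      · exact ⟨.inr (.inr (.inr ⟨η, by omega, rfl⟩)), by simp only [yVar]; omega⟩
      · exact ⟨.inr (.inr (.inl ⟨ξ, v, by have := hdepth.2 ξ hξ; omega, rfl⟩)), N.name_ne_yVar⟩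
    -- The variables of the layer witness their own quantifiers. The variable `y_k` is free in no
    -- assumption, because the atoms introduced so far contain `y_η` only for `η < k`.
    refine Deriv.exsI_self (Deriv.allI subset_rfl (fun δ hδ h' => (hUsed δ hδ _ h').2 rfl) ?_)
    refine h Γ' hs (fun δ hδ z hz => (hUsed δ hδ z hz).1) ?_
      (deriv_lambdaN (hM.mono hs) hsrc)
    intro ξ hξ
    rcases List.mem_append.1 hξ with hξ | hξ
    · exact (hinc ξ hξ).mono hs
    · obtain ⟨us, vs, -, hd⟩ := hsrc ξ hξ
      exact inc_of_block (IsSource.length_eq hd) hd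

/-- Induction on the number of remaining layers. The assumptions made for the outer layers stay in
force below their universal quantifiers, so the inner formula is derived in the enlarged context,
where the matrix persists by monotonicity. -/
theorem deriv_nest (hg : ∀ v ξ v', g v ≠ N.name ξ v') (hgy : ∀ v η, g v ≠ yVar η)
    (hY : ∀ ξ v, Y ≠ N.name ξ v) (hYy : ∀ η, Y ≠ yVar η) (hYg : ∀ v, g v ≠ Y) (r : ℕ)
    {k : ℕ} {Γ : Set (Form L)} (hM : N.Matrix Γ g Y)
    (hΓ : ∀ δ ∈ Γ, ∀ z ∈ δ.fv, N.Used g Y k z)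
    (hinc : ∀ ξ ∈ (N.layers k).1,
      Deriv Γ (.inc (N.positions.map (N.name ξ)) (N.positions.map g))) :
    Deriv Γ (N.nest r k) := by
  induction r generalizing k Γ with
  | zero => exact deriv_layer hM hg hgy hY hYy hYg hΓ hinc fun _ _ _ _ h => h
  | succ r ih =>
    exact deriv_layer hM hg hgy hY hYy hYg hΓ hinc fun Γ' hs hΓ' hinc' h =>
      h.andI (ih (hM.mono hs) hΓ' hinc')

variable (N)

theorem mem_fv_seqEq {xs ys : List ℕ} {z : ℕ} (h : z ∈ (Form.seqEq xs ys : Form L).fv) :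
    z ∈ xs ∨ z ∈ ys := by
  obtain ⟨φ, hφ, hz⟩ := Form.mem_fv_conj.1 h
  rw [← List.map_uncurry_zip_eq_zipWith] at hφ
  obtain ⟨⟨a, b⟩, hab, rfl⟩ := List.mem_map.1 hφ
  have := List.of_mem_zip hab
  simp only [Function.uncurry, Form.veq, Form.fv, Term.varFinset, Finset.mem_union,
    Finset.mem_singleton] at hz
  rcases hz with rfl | rfl
  · exact .inl this.1
  · exact .inr this.2

/-- Together with its analogue for `nest`, this keeps the renamed bound variables of the sentence
out of the approximation, so that their quantifiers can be eliminated. -/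
theorem name_or_yVar_of_mem_fv_lambdaN {k z : ℕ} (h : z ∈ (N.lambdaN k).fv) :
    (∃ ξ v, z = N.name ξ v) ∨ ∃ η, z = yVar η := by
  have hα : ∀ {k}, z ∈ (N.alphaN k).fv → ∃ ξ v, z = N.name ξ v := by
    intro k h
    obtain ⟨φ, hφ, hz⟩ := Form.mem_fv_conj.1 h
    obtain ⟨ξ, -, rfl⟩ := List.mem_map.1 hφ
    obtain ⟨v, hv⟩ := QF.exists_of_mem_fv_inst hz
    exact ⟨ξ, v, hv.symm⟩
  cases k with
  | zero => exact .inl (hα h)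
  | succ k =>
    simp only [lambdaN, Form.fv, Finset.mem_union] at h
    rcases h with h | h | h
    · exact .inl (hα h)
    · obtain ⟨φ, hφ, hz⟩ := Form.mem_fv_conj.1 h
      simp only [List.mem_flatMap, List.mem_ofFn] at hφ
      obtain ⟨ξ, -, i, rfl⟩ := hφ
      rcases mem_fv_seqEq hz with hz | hz <;> obtain ⟨v, rfl⟩ := List.mem_ofFn.1 hz
      · exact .inl ⟨ξ, .inl (N.ρ i v), rfl⟩
      · exact .inl ⟨.e ξ i, .inl (N.σ i v), rfl⟩
    · obtain ⟨φ, hφ, hz⟩ := Form.mem_fv_conj.1 h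
      simp only [List.mem_flatMap, List.mem_ofFn] at hφ
      obtain ⟨a, -, j, rfl⟩ := hφ
      rcases mem_fv_seqEq hz with hz | hz
      · rcases List.mem_append.1 hz with hz | hz
        · obtain ⟨v, rfl⟩ := List.mem_ofFn.1 hz
          exact .inl ⟨a.1, .inr (N.π j v), rfl⟩
        · exact .inr ⟨a.2, List.mem_singleton.1 hz⟩
      · obtain ⟨v, rfl⟩ := List.mem_ofFn.1 hz
        exact .inl ⟨.u a.1 a.2 j, .inr (N.τ j v), rfl⟩

theorem name_or_yVar_of_mem_fv_nest {r k z : ℕ} (h : z ∈ (N.nest r k).fv) :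
    (∃ ξ v, z = N.name ξ v) ∨ ∃ η, z = yVar η := by
  induction r generalizing k with
  | zero =>
    have := (Form.mem_fv_exs.1 h).1
    simp only [Form.fv, Finset.mem_erase] at this
    exact N.name_or_yVar_of_mem_fv_lambdaN this.2
  | succ r ih =>
    have := (Form.mem_fv_exs.1 h).1
    simp only [Form.fv, Finset.mem_erase, Finset.mem_union] at this
    exact this.2.elim N.name_or_yVar_of_mem_fv_lambdaN ih

/-- The matrix of a normal form in the variables `g` and `Y`, as one formula. -/
def matrixForm (g : N.Pos → ℕ) (Y : ℕ) : Form L :=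
  .and (.conj (List.ofFn fun i => .inc ((N.selρ i).map g) ((N.selσ i).map g))) <|
    .and (.all Y (.conj (List.ofFn fun j =>
      .inc ((N.selπ j).map g ++ [Y]) ((N.selτ j).map g)))) (N.α.inst g)

theorem sentence_eq (N : NormalForm L) : N.sentence = .exs (N.positions.map (Sum.elim N.wv N.xv))
    (.all N.yv (.and (.conj (List.ofFn fun i => .inc ((N.selρ i).map (Sum.elim N.wv N.xv))
      ((N.selσ i).map (Sum.elim N.wv N.xv)))) (.and (.conj (List.ofFn fun j =>
      .inc ((N.selπ j).map (Sum.elim N.wv N.xv) ++ [N.yv]) ((N.selτ j).map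
        (Sum.elim N.wv N.xv)))) (N.α.inst (Sum.elim N.wv N.xv))))) := by
  simp only [positions, selρ, selσ, selπ, selτ, List.map_append, List.map_ofFn, Form.exs_append,
    sentence, Function.comp_def, Sum.elim_inl, Sum.elim_inr]

variable {N}

theorem map_varSub {g f : N.Pos → ℕ} {σ : ℕ → L.Term ℕ} (h : ∀ v, σ (g v) = .var (f v))
    (l : List N.Pos) : (l.map g).map (Form.varSub σ) = l.map f := by
  rw [List.map_map]
  exact List.map_congr_left fun v _ => Form.varSub_of_eq (h v)

theorem subst_matrixForm {g f : N.Pos → ℕ} {Y : ℕ} {σ : ℕ → L.Term ℕ}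
    (h : ∀ v, σ (g v) = .var (f v)) (hY : ∀ v, g v ≠ Y) :
    Form.subst σ (N.matrixForm g Y) = N.matrixForm f Y := by
  have h' : ∀ v, Function.update σ Y (.var Y) (g v) = .var (f v) := fun v => by
    rw [Function.update_of_ne (hY v), h]
  simp only [matrixForm, Form.subst, Form.subst_conj, List.map_ofFn, Function.comp_def,
    map_varSub h, map_varSub h', List.map_append, List.map_cons, List.map_nil,
    Form.varSub_of_eq (Function.update_self Y _ _), QF.subst_inst h]

/-- The rules instantiate `∀y` in first-order formulas only, but they allow weakening under it.
Conjuncts without `y` then lose a vacuous quantifier, and the atoms with `y` keep theirs, renamed to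
`Y`. -/
theorem deriv_matrixForm {Γ : Set (Form L)} {g : N.Pos → ℕ} {y Y : ℕ} (hg : ∀ v, g v ≠ y)
    (hY : ∀ v, g v ≠ Y)
    (h : Deriv Γ (.all y (.and (.conj (List.ofFn fun i => .inc ((N.selρ i).map g)
      ((N.selσ i).map g))) (.and (.conj (List.ofFn fun j =>
      .inc ((N.selπ j).map g ++ [y]) ((N.selτ j).map g))) (N.α.inst g))))) :
    Deriv Γ (N.matrixForm g Y) := by
  refine .andI (.allE₀ (x := y) ?_ (h.allMono fun _ hd => hd.andE1)) (.andI ?_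
    (.allE₀ (x := y) ?_ (h.allMono fun Γ hd => hd.andE2.andE2)))
  · intro hy
    obtain ⟨φ, hφ, hz⟩ := Form.mem_fv_conj.1 hy
    obtain ⟨i, rfl⟩ := List.mem_ofFn.1 hφ
    simp only [Form.fv, Finset.mem_union, List.mem_toFinset, List.mem_map] at hz
    rcases hz with ⟨v, -, e⟩ | ⟨v, -, e⟩ <;> exact hg v e
  · have h1 := h.allMono fun Γ hd => hd.andE2.andE1
    have hw := h1.wf
    have hs : ∀ v, Form.single y (.var Y : L.Term ℕ) (g v) = .var (g v) := fun v => by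
      simp [Form.single, hg v]
    have key : Form.subst (Form.single y (.var Y)) (.conj (List.ofFn fun j =>
        .inc ((N.selπ j).map g ++ [y]) ((N.selτ j).map g)) : Form L) =
        .conj (List.ofFn fun j => .inc ((N.selπ j).map g ++ [Y]) ((N.selτ j).map g)) := by
      simp only [Form.subst, Form.subst_conj, List.map_ofFn, Function.comp_def,
        map_varSub hs, List.map_append, List.map_cons, List.map_nil,
        Form.varSub_of_eq (show Form.single y (.var Y : L.Term ℕ) y = .var Y by simp [Form.single])]
    refine Deriv.allSub (Δ := ∅) (y := Y) (Set.empty_subset _) ?_ (by simp) ?_ h1 ?_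
    · intro hz
      simp only [Form.fv, Finset.mem_erase] at hz
      obtain ⟨hne, hz⟩ := hz
      obtain ⟨φ, hφ, hz⟩ := Form.mem_fv_conj.1 hz
      obtain ⟨i, rfl⟩ := List.mem_ofFn.1 hφ
      simp only [Form.fv, Finset.mem_union, List.mem_toFinset, List.mem_map, List.mem_append,
        List.mem_singleton] at hz
      rcases hz with (⟨v, -, e⟩ | e) | ⟨v, -, e⟩
      · exact hY v e
      · exact hne e
      · exact hY v e
    · refine Form.admissible_conj.2 fun φ hφ => ?_
      obtain ⟨i, rfl⟩ := List.mem_ofFn.1 hφ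
      intro x _
      by_cases hx : x = y
      · exact ⟨Y, by simp [Form.single, hx]⟩
      · exact ⟨x, by simp [Form.single, hx]⟩
    · rw [key]
      refine Deriv.ass_insert ?_
      rw [← key]
      exact Form.WF.subst _ (show Form.WF (Form.all y _) from hw)
  · intro hy
    obtain ⟨v, e⟩ := QF.exists_of_mem_fv_inst hy
    exact hg v e

theorem matrix_of_deriv {Γ : Set (Form L)} {g : N.Pos → ℕ} {Y : ℕ}
    (h : Deriv Γ (N.matrixForm g Y)) : N.Matrix Γ g Y where
  ρσ i := Deriv.conj_iff.1 h.andE1 _ (List.mem_ofFn.2 ⟨i, rfl⟩)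
  πτ j := h.andE2.andE1.allMono fun _ hd => Deriv.conj_iff.1 hd _ (List.mem_ofFn.2 ⟨j, rfl⟩)
  α := h.andE2.andE2

theorem mem_fv_matrixForm {g : N.Pos → ℕ} {Y z : ℕ} (h : z ∈ (N.matrixForm g Y).fv) :
    ∃ v, z = g v := by
  simp only [matrixForm, Form.fv, Finset.mem_union, Finset.mem_erase] at h
  rcases h with h | ⟨hne, h⟩ | h
  · obtain ⟨φ, hφ, hz⟩ := Form.mem_fv_conj.1 h
    obtain ⟨i, rfl⟩ := List.mem_ofFn.1 hφ
    simp only [Form.fv, Finset.mem_union, List.mem_toFinset, List.mem_map] at hz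
    rcases hz with ⟨v, -, e⟩ | ⟨v, -, e⟩ <;> exact ⟨v, e.symm⟩
  · obtain ⟨φ, hφ, hz⟩ := Form.mem_fv_conj.1 h
    obtain ⟨i, rfl⟩ := List.mem_ofFn.1 hφ
    simp only [Form.fv, Finset.mem_union, List.mem_toFinset, List.mem_map, List.mem_append,
      List.mem_singleton] at hz
    rcases hz with (⟨v, -, e⟩ | e) | ⟨v, -, e⟩
    · exact ⟨v, e.symm⟩
    · exact absurd e hne
    · exact ⟨v, e.symm⟩
  · obtain ⟨v, e⟩ := QF.exists_of_mem_fv_inst h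
    exact ⟨v, e.symm⟩

/-- The approximations are derivable from any assumptions from which the sentence is derivable. -/
theorem deriv_approx {Γ : Set (Form L)} (h : Deriv Γ N.sentence) (n : ℕ) :
    Deriv Γ (N.approx n) := by
  set f : N.Pos → ℕ := Sum.elim N.wv N.xv with hf
  have hfin : ∃ K, N.nw ≤ K ∧ N.yv < K ∧ ∀ v, f v < K := by
    refine ⟨N.nw + N.yv + ∑ v, f v + 1, by omega, by omega, fun v => ?_⟩
    have := Finset.single_le_sum (f := f) (fun _ _ => Nat.zero_le _) (Finset.mem_univ v)
    omega
  obtain ⟨K, hK, hKy, hKf⟩ := hfin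
  -- As `nw ≤ K`, variables of the family `w_0` at positions from `K` on are not used in the game;
  -- by the choice of `K` they also exceed all bound variables of the sentence.
  set g : N.Pos → ℕ := fun v => wVar .root (K + 1 + Encodable.encode v) with hgdef
  set Y := wVar .root K with hYdef
  have hge : ∀ m, m ≤ wVar .root m := fun m => by
    have := Nat.right_le_pair Idx.root.code m
    simp only [wVar]
    omega
  have hinj : ∀ {a b}, wVar .root a = wVar .root b → a = b := fun {a b} e => by
    simp only [wVar] at e
    exact (Nat.pair_eq_pair.1 (show Nat.pair Idx.root.code a = Nat.pair Idx.root.code b by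
      omega)).2
  have hname : ∀ m, K ≤ m → ∀ ξ v, wVar .root m ≠ N.name ξ v := by
    rintro m hm ξ (v | v) e
    · simp only [wVar, name, Sum.elim_inl] at e
      have := (Nat.pair_eq_pair.1 (show Nat.pair Idx.root.code m = Nat.pair ξ.code v by omega)).2
      omega
    · simp only [wVar, name, Sum.elim_inr, xVar] at e
      omega
  have hyv : ∀ m η, wVar .root m ≠ yVar η := fun m η e => by simp only [wVar, yVar] at e; omega
  have hgY : ∀ v, g v ≠ Y := fun v e => by have := hinj e; omega
  have hginj : g.Injective := fun a b e => by
    have := hinj e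
    exact Encodable.encode_injective (by omega)
  have hfg : ∀ v v', f v ≠ g v' := fun v v' e => by
    have := hge (K + 1 + Encodable.encode v'); have := hKf v
    simp only [hgdef] at e; omega
  have hfY : ∀ v, f v ≠ Y := fun v e => by
    have := hge K; have := hKf v; omega
  have hfy : ∀ v, f v ≠ N.yv := by
    have hd := N.distinct
    simp only [List.nodup_append', List.mem_append, List.disjoint_singleton, List.mem_ofFn] at hd
    rintro (v | v) e
    · exact hd.2.2 (.inl ⟨v, e⟩)
    · exact hd.2.2 (.inr ⟨v, e⟩)
  have h1 : Deriv Γ (.exs (N.positions.map g) (N.matrixForm g Y)) := by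
    rw [sentence_eq] at h
    refine Deriv.exsE ?_ h fun Γ hd => ?_
    · intro x _ hx
      obtain ⟨v, rfl⟩ := mem_fv_matrixForm (Form.mem_fv_exs.1 hx).1
      exact (Form.mem_fv_exs.1 hx).2 (List.mem_map.2 ⟨v, N.mem_positions v, rfl⟩)
    · have hd' := deriv_matrixForm hfy hfY hd
      classical
      -- The inverse of the renaming instantiates the new variables by the old ones.
      set F : ℕ → ℕ := fun z => if h : ∃ v, g v = z then f h.choose else z with hF
      have hFg : ∀ v, F (g v) = f v := fun v => by
        have h : ∃ v', g v' = g v := ⟨v, rfl⟩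
        simp only [hF, dif_pos h]
        rw [hginj h.choose_spec]
      have key : Form.subst (fun z => .var (F z)) (N.matrixForm g Y) = N.matrixForm f Y :=
        subst_matrixForm (fun v => by rw [hFg]) hgY
      have hw : (N.matrixForm g Y).WF := by
        have hw := hd'.wf
        simp only [matrixForm, Form.WF, Form.wf_conj, List.mem_ofFn, forall_exists_index,
          forall_apply_eq_imp_iff, List.length_map, List.length_append] at hw ⊢
        exact ⟨hw.1, hw.2.1, (QF.isFO_inst _ _).wf⟩
      refine Deriv.exsI hw (N.nodup_positions.map hginj) (f := F) ?_ ?_ (by rwa [key])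
      · intro x hx
        obtain ⟨v, -, rfl⟩ := List.mem_map.1 hx
        rw [hFg]
        refine ⟨fun h => ?_, fun h => ?_⟩
        · obtain ⟨v', -, e⟩ := List.mem_map.1 h
          exact hfg v v' e.symm
        · have hbc : ∀ l : List (Form L), (∀ φ ∈ l, φ.bv = ∅) → (Form.conj l).bv = ∅ := by
            intro l hl
            induction l with
            | nil => rfl
            | cons φ l ih =>
              cases l with
              | nil => exact hl φ (by simp)
              | cons ψ l =>
                rw [Form.conj, Form.bv, hl φ (by simp), ih fun φ hφ => hl φ (by simp [hφ])]
                rfl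
          simp only [matrixForm, Form.bv, QF.bv_inst] at h
          rw [hbc _ (by simp [List.mem_ofFn, Form.bv]), hbc _ (by simp [List.mem_ofFn, Form.bv])] at h
          exact hfY v (by simpa using h)
      · intro z hz
        simp only [hF]
        rw [dif_neg]
        rintro ⟨v, rfl⟩
        exact hz (List.mem_map.2 ⟨v, N.mem_positions v, rfl⟩)
  refine Deriv.exsE (fun x hx hx' => ?_) h1 fun Γ hd => ?_
  · obtain ⟨v, -, rfl⟩ := List.mem_map.1 hx
    rcases N.name_or_yVar_of_mem_fv_nest hx' with ⟨ξ, v', e⟩ | ⟨η, e⟩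
    · exact hname _ (by omega) ξ v' e
    · exact hyv _ η e
  -- The game is played with the matrix as the only initial assumption, since nothing is known about
  -- the free variables of `Γ`; a cut then returns to `Γ`.
  · have hd1 : Deriv {N.matrixForm g Y} (N.approx n) := by
      refine deriv_nest (g := g) (Y := Y) (fun v ξ v' => hname _ (by omega) ξ v')
        (fun v η => hyv _ η) (fun ξ v => hname _ le_rfl ξ v) (fun η => hyv _ η) hgY n
        (matrix_of_deriv (Deriv.ass hd.wf rfl)) ?_ (by simp [layers])
      rintro δ rfl z hz
      exact .inr (.inl (mem_fv_matrixForm hz))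
    exact hd.cut hd1

end NormalForm

end IncLogic

namespace IncLogic

open Language

variable {L : FirstOrder.Language.{u, v}}

namespace Form

/-! ### Team semantics: locality, substitution and flatness -/

section Semantics

variable {M : Type w}

/-- The relation `R` is total from each of the teams to the other. -/
def Linked (R : (ℕ → M) → (ℕ → M) → Prop) (X Y : Set (ℕ → M)) : Prop :=
  (∀ s ∈ X, ∃ t ∈ Y, R s t) ∧ ∀ t ∈ Y, ∃ s ∈ X, R s t

theorem Linked.flip {R : (ℕ → M) → (ℕ → M) → Prop} {X Y : Set (ℕ → M)} (h : Linked R X Y) :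
    Linked (fun t s => R s t) Y X := ⟨h.2, h.1⟩

theorem Linked.mono {R R' : (ℕ → M) → (ℕ → M) → Prop} {X Y : Set (ℕ → M)} (h : Linked R X Y)
    (hR : ∀ s t, R s t → R' s t) : Linked R' X Y :=
  ⟨fun s hs => (h.1 s hs).imp fun t ht => ⟨ht.1, hR s t ht.2⟩,
    fun t ht => (h.2 t ht).imp fun s hs => ⟨hs.1, hR s t hs.2⟩⟩

theorem Linked.union {R : (ℕ → M) → (ℕ → M) → Prop} {X₁ X₂ Y : Set (ℕ → M)}
    (h : Linked R (X₁ ∪ X₂) Y) : ∃ Y₁ Y₂, Y = Y₁ ∪ Y₂ ∧ Linked R X₁ Y₁ ∧ Linked R X₂ Y₂ := by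
  refine ⟨{t ∈ Y | ∃ s ∈ X₁, R s t}, {t ∈ Y | ∃ s ∈ X₂, R s t}, ?_,
    ⟨fun s hs => ?_, fun t ht => ht.2⟩, ⟨fun s hs => ?_, fun t ht => ht.2⟩⟩
  · ext t
    refine ⟨fun ht => ?_, fun ht => ht.elim (·.1) (·.1)⟩
    obtain ⟨s, hs | hs, hr⟩ := h.2 t ht
    · exact .inl ⟨ht, s, hs, hr⟩
    · exact .inr ⟨ht, s, hs, hr⟩
  · obtain ⟨t, ht, hr⟩ := h.1 s (.inl hs); exact ⟨t, ⟨ht, s, hs, hr⟩, hr⟩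
  · obtain ⟨t, ht, hr⟩ := h.1 s (.inr hs); exact ⟨t, ⟨ht, s, hs, hr⟩, hr⟩

theorem Linked.forall_iff {R : (ℕ → M) → (ℕ → M) → Prop} {X Y : Set (ℕ → M)} (h : Linked R X Y)
    {P Q : (ℕ → M) → Prop} (hPQ : ∀ s t, R s t → (P s ↔ Q t)) :
    (∀ s ∈ X, P s) ↔ ∀ t ∈ Y, Q t := by
  constructor
  · intro hX t ht
    obtain ⟨s, hs, hst⟩ := h.2 t ht
    exact (hPQ s t hst).1 (hX s hs)
  · intro hY s hs
    obtain ⟨t, ht, hst⟩ := h.1 s hs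
    exact (hPQ s t hst).2 (hY t ht)

/-- `Y` is the team `X` with the values at `x` supplemented by nonempty sets of values. -/
def Supplements (x : ℕ) (X Y : Set (ℕ → M)) : Prop :=
  (∀ s ∈ X, ∃ a, Function.update s x a ∈ Y) ∧ ∀ r ∈ Y, ∃ s ∈ X, ∃ a, r = Function.update s x a

/-- Lax semantics allows `t` to receive all values that are given to any of the assignments related
to it. -/
theorem Linked.supplement {R R' : (ℕ → M) → (ℕ → M) → Prop} {X X' Y : Set (ℕ → M)} {x : ℕ}
    (h : Linked R X Y) (hX : Supplements x X X')
    (hR : ∀ s t a, R s t → R' (Function.update s x a) (Function.update t x a)) :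
    ∃ Y', Supplements x Y Y' ∧ Linked R' X' Y' := by
  refine ⟨{r | ∃ t ∈ Y, ∃ s ∈ X, ∃ a, R s t ∧ Function.update s x a ∈ X' ∧
    r = Function.update t x a}, ⟨fun t ht => ?_, ?_⟩, fun r hr => ?_, ?_⟩
  · obtain ⟨s, hs, hr⟩ := h.2 t ht
    obtain ⟨a, ha⟩ := hX.1 s hs
    exact ⟨a, t, ht, s, hs, a, hr, ha, rfl⟩
  · rintro r ⟨t, ht, s, -, a, -, -, rfl⟩
    exact ⟨t, ht, a, rfl⟩
  · obtain ⟨s, hs, a, rfl⟩ := hX.2 r hr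
    obtain ⟨t, ht, hst⟩ := h.1 s hs
    exact ⟨_, ⟨t, ht, s, hs, a, hst, hr, rfl⟩, hR s t a hst⟩
  · rintro r ⟨t, ht, s, -, a, hst, hs, rfl⟩
    exact ⟨_, hs, hR s t a hst⟩

/-- The duplicated team `X(M/x)`. -/
def dup (x : ℕ) (X : Set (ℕ → M)) : Set (ℕ → M) :=
  {r | ∃ s ∈ X, ∃ a : M, r = Function.update s x a}

theorem Linked.dup {R R' : (ℕ → M) → (ℕ → M) → Prop} {X Y : Set (ℕ → M)} {x : ℕ}
    (h : Linked R X Y)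
    (hR : ∀ s t a, R s t → R' (Function.update s x a) (Function.update t x a)) :
    Linked R' (dup x X) (dup x Y) := by
  constructor
  · rintro _ ⟨s, hs, a, rfl⟩
    obtain ⟨t, ht, hst⟩ := h.1 s hs
    exact ⟨_, ⟨t, ht, a, rfl⟩, hR s t a hst⟩
  · rintro _ ⟨t, ht, a, rfl⟩
    obtain ⟨s, hs, hst⟩ := h.2 t ht
    exact ⟨_, ⟨s, hs, a, rfl⟩, hR s t a hst⟩

variable [L.Structure M]

theorem sat_ex {X : Set (ℕ → M)} {x : ℕ} {φ : Form L} :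
    Sat X (ex x φ) ↔ ∃ Y, Supplements x X Y ∧ Sat Y φ := by
  constructor
  · rintro ⟨F, hF, h⟩
    refine ⟨_, ⟨fun s hs => ?_, ?_⟩, h⟩
    · obtain ⟨a, ha⟩ := hF s hs
      exact ⟨a, s, hs, a, ha, rfl⟩
    · rintro r ⟨s, hs, a, -, rfl⟩
      exact ⟨s, hs, a, rfl⟩
  · rintro ⟨Y, ⟨h₁, h₂⟩, h⟩
    refine ⟨fun s => {a | Function.update s x a ∈ Y}, h₁, ?_⟩
    convert h using 1
    ext r
    constructor
    · rintro ⟨s, -, a, ha, rfl⟩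
      exact ha
    · intro hr
      obtain ⟨s, hs, a, rfl⟩ := h₂ r hr
      exact ⟨s, hs, a, hr, rfl⟩

theorem sat_all {X : Set (ℕ → M)} {x : ℕ} {φ : Form L} : Sat X (all x φ) ↔ Sat (dup x X) φ :=
  Iff.rfl

theorem realize_update_subst {σ : ℕ → L.Term ℕ} {x z : ℕ} {s t : ℕ → M} {a : M}
    (hσ : z ≠ x → x ∉ (σ z).varFinset) (h : z ≠ x → (σ z).realize s = t z) :
    (Function.update σ x (.var x) z).realize (Function.update s x a) = Function.update t x a z := by
  by_cases hz : z = x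
  · subst hz; simp
  · rw [Function.update_of_ne hz, Function.update_of_ne hz, ← h hz]
    refine Term.realize_congr_varFinset _ fun y hy => Function.update_of_ne ?_ _ _
    rintro rfl
    exact hσ hz hy

theorem realize_subst_eq {σ : ℕ → L.Term ℕ} {s t : ℕ → M} (τ : L.Term ℕ)
    (h : ∀ z ∈ τ.varFinset, (σ z).realize s = t z) : (τ.subst σ).realize s = τ.realize t := by
  rw [Term.realize_subst]
  exact Term.realize_congr_varFinset _ h

theorem map_varSub_eq {σ : ℕ → L.Term ℕ} {s t : ℕ → M} {xs : List ℕ}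
    (hσ : ∀ x ∈ xs, ∃ y : ℕ, σ x = .var y) (h : ∀ z ∈ xs, (σ z).realize s = t z) :
    (xs.map (varSub σ)).map s = xs.map t := by
  rw [List.map_map]
  refine List.map_congr_left fun z hz => ?_
  obtain ⟨y, hy⟩ := hσ z hz
  rw [← h z hz, Function.comp, varSub_of_eq hy, hy, Term.realize_var]

theorem holds_subst {σ : ℕ → L.Term ℕ} {φ : Form L} (ha : Admissible σ φ) {s t : ℕ → M}
    (h : ∀ z ∈ φ.fv, (σ z).realize s = t z) : Holds s (subst σ φ) ↔ Holds t φ := by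
  induction φ generalizing σ s t with
  | bot => rfl
  | eq τ₁ τ₂ =>
    simp only [fv, Finset.mem_union] at h
    simp only [subst, Holds, realize_subst_eq τ₁ fun z hz => h z (.inl hz),
      realize_subst_eq τ₂ fun z hz => h z (.inr hz)]
  | rel R ts =>
    simp only [fv, Finset.mem_biUnion, Finset.mem_univ, true_and] at h
    simp only [subst, Holds, fun i => realize_subst_eq (ts i) fun z hz => h z ⟨i, hz⟩]
  | inc xs ys =>
    simp only [fv, Finset.mem_union, List.mem_toFinset] at h
    simp only [subst, Holds]
    rw [map_varSub_eq (fun x hx => ha x (by simp [hx])) fun z hz => h z (.inl hz),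
      map_varSub_eq (fun x hx => ha x (by simp [hx])) fun z hz => h z (.inr hz)]
  | neg φ ih => exact not_congr (ih ha h)
  | and φ ψ ih₁ ih₂ =>
    simp only [fv, Finset.mem_union] at h
    exact and_congr (ih₁ ha.1 fun z hz => h z (.inl hz)) (ih₂ ha.2 fun z hz => h z (.inr hz))
  | or φ ψ ih₁ ih₂ =>
    simp only [fv, Finset.mem_union] at h
    exact or_congr (ih₁ ha.1 fun z hz => h z (.inl hz)) (ih₂ ha.2 fun z hz => h z (.inr hz))
  | ex x φ ih =>
    simp only [fv, Finset.mem_erase] at h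
    exact exists_congr fun a => ih ha.2 fun z hz =>
      realize_update_subst (ha.1 z hz) fun hzx => h z ⟨hzx, hz⟩
  | all x φ ih =>
    simp only [fv, Finset.mem_erase] at h
    exact forall_congr' fun a => ih ha.2 fun z hz =>
      realize_update_subst (ha.1 z hz) fun hzx => h z ⟨hzx, hz⟩

/-- The substitution lemma of team semantics, which includes locality. -/
theorem sat_subst {σ : ℕ → L.Term ℕ} {φ : Form L} (ha : Admissible σ φ) {X Y : Set (ℕ → M)}
    (h : Linked (fun s t => ∀ z ∈ φ.fv, (σ z).realize s = t z) X Y) :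
    Sat X (subst σ φ) ↔ Sat Y φ := by
  induction φ generalizing σ X Y with
  | bot =>
    simp only [subst, Sat, Set.eq_empty_iff_forall_notMem]
    exact h.forall_iff (P := fun _ => False) (Q := fun _ => False) fun _ _ _ => Iff.rfl
  | eq τ₁ τ₂ =>
    exact h.forall_iff (P := fun s => Holds s (subst σ (eq τ₁ τ₂))) (Q := fun s => Holds s (eq τ₁ τ₂))
      fun s t hst => holds_subst ha hst
  | rel R ts =>
    exact h.forall_iff (P := fun s => Holds s (subst σ (rel R ts))) (Q := fun s => Holds s (rel R ts))
      fun s t hst => holds_subst ha hst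
  | neg φ ih =>
    exact h.forall_iff (P := fun s => Holds s (subst σ (neg φ))) (Q := fun s => Holds s (neg φ))
      fun s t hst => holds_subst (φ := neg φ) ha hst
  | inc xs ys =>
    have hx : ∀ s t : ℕ → M, (∀ z ∈ (inc xs ys : Form L).fv, (σ z).realize s = t z) →
        (xs.map (varSub σ)).map s = xs.map t := fun s t hst =>
      map_varSub_eq (fun x hx => ha x (by simp [hx])) fun z hz => hst z (by simp [fv, hz])
    have hy : ∀ s t : ℕ → M, (∀ z ∈ (inc xs ys : Form L).fv, (σ z).realize s = t z) →
        (ys.map (varSub σ)).map s = ys.map t := fun s t hst =>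
      map_varSub_eq (fun x hx => ha x (by simp [hx])) fun z hz => hst z (by simp [fv, hz])
    refine h.forall_iff fun s t hst => ?_
    rw [hx s t hst]
    constructor
    · rintro ⟨r, hr, e⟩
      obtain ⟨r', hr', hrr⟩ := h.1 r hr
      exact ⟨r', hr', by rw [e, hy r r' hrr]⟩
    · rintro ⟨r', hr', e⟩
      obtain ⟨r, hr, hrr⟩ := h.2 r' hr'
      exact ⟨r, hr, by rw [e, hy r r' hrr]⟩
  | and φ ψ ih₁ ih₂ =>
    exact and_congr
      (ih₁ ha.1 (h.mono fun s t hst z hz => hst z (by simp [fv, hz])))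
      (ih₂ ha.2 (h.mono fun s t hst z hz => hst z (by simp [fv, hz])))
  | or φ ψ ih₁ ih₂ =>
    constructor
    · rintro ⟨X₁, X₂, rfl, h₁, h₂⟩
      obtain ⟨Y₁, Y₂, rfl, l₁, l₂⟩ := h.union
      exact ⟨Y₁, Y₂, rfl,
        (ih₁ ha.1 (l₁.mono fun s t hst z hz => hst z (by simp [fv, hz]))).1 h₁,
        (ih₂ ha.2 (l₂.mono fun s t hst z hz => hst z (by simp [fv, hz]))).1 h₂⟩
    · rintro ⟨Y₁, Y₂, rfl, h₁, h₂⟩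
      obtain ⟨X₁, X₂, rfl, l₁, l₂⟩ := h.flip.union
      exact ⟨X₁, X₂, rfl,
        (ih₁ ha.1 (l₁.flip.mono fun s t hst z hz => hst z (by simp [fv, hz]))).2 h₁,
        (ih₂ ha.2 (l₂.flip.mono fun s t hst z hz => hst z (by simp [fv, hz]))).2 h₂⟩
  | ex x φ ih =>
    have hR : ∀ (s t : ℕ → M) (a : M), (∀ z ∈ (ex x φ).fv, (σ z).realize s = t z) →
        ∀ z ∈ φ.fv, (Function.update σ x (.var x) z).realize (Function.update s x a) =
          Function.update t x a z := fun s t a hst z hz =>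
      realize_update_subst (ha.1 z hz) fun hzx => hst z (by simp [fv, hzx, hz])
    rw [subst, sat_ex, sat_ex]
    constructor
    · rintro ⟨X', hX', hS⟩
      obtain ⟨Y', hY', l⟩ := h.supplement (R' := fun s t => ∀ z ∈ φ.fv,
        (Function.update σ x (.var x) z).realize s = t z) hX' hR
      exact ⟨Y', hY', (ih ha.2 l).1 hS⟩
    · rintro ⟨Y', hY', hS⟩
      obtain ⟨X', hX', l⟩ := h.flip.supplement (R' := fun t s => ∀ z ∈ φ.fv,
        (Function.update σ x (.var x) z).realize s = t z) hY' fun t s a hst => hR s t a hst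
      exact ⟨X', hX', (ih ha.2 l.flip).2 hS⟩
  | all x φ ih =>
    rw [subst, sat_all, sat_all]
    exact ih ha.2 (h.dup fun s t a hst z hz =>
      realize_update_subst (ha.1 z hz) fun hzx => hst z (by simp [fv, hzx, hz]))

/-- Locality, as the case of the identity in the substitution lemma. -/
theorem sat_congr {φ : Form L} {X Y : Set (ℕ → M)}
    (h : Linked (fun s t => ∀ z ∈ φ.fv, s z = t z) X Y) : Sat X φ ↔ Sat Y φ := by
  have ha : Admissible (fun z => .var z) φ := admissible_of_fresh fun z _ => .inl rfl
  have := sat_subst ha (X := X) (Y := Y) (h.mono fun s t hst z hz => hst z hz)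
  rwa [subst_var] at this

theorem holds_congr {φ : Form L} {s t : ℕ → M} (h : ∀ z ∈ φ.fv, s z = t z) :
    Holds s φ ↔ Holds t φ := by
  have ha : Admissible (fun z => .var z) φ := admissible_of_fresh fun z _ => .inl rfl
  have := holds_subst ha (s := s) (t := t) h
  rwa [subst_var] at this

/-- Flatness. The team is split into the assignments satisfying either disjunct, and an existential
quantifier is given all of its witnesses. -/
theorem sat_iff_holds {φ : Form L} (h : φ.IsFO) {X : Set (ℕ → M)} :
    Sat X φ ↔ ∀ s ∈ X, Holds s φ := by
  induction φ generalizing X with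
  | bot => simp only [Sat, Holds, Set.eq_empty_iff_forall_notMem]
  | inc xs ys => exact h.elim
  | and φ ψ ih₁ ih₂ => simp only [Sat, Holds, ih₁ h.1, ih₂ h.2, forall_and]
  | or φ ψ ih₁ ih₂ =>
    constructor
    · rintro ⟨Y, Z, rfl, hY, hZ⟩ s (hs | hs)
      · exact .inl ((ih₁ h.1).1 hY s hs)
      · exact .inr ((ih₂ h.2).1 hZ s hs)
    · intro hX
      refine ⟨{s ∈ X | Holds s φ}, {s ∈ X | Holds s ψ}, ?_, (ih₁ h.1).2 fun s hs => hs.2,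
        (ih₂ h.2).2 fun s hs => hs.2⟩
      ext s
      exact ⟨fun hs => (hX s hs).imp (⟨hs, ·⟩) (⟨hs, ·⟩), fun hs => hs.elim (·.1) (·.1)⟩
  | ex x φ ih =>
    rw [sat_ex]
    constructor
    · rintro ⟨Y, hY, hS⟩ s hs
      obtain ⟨a, ha⟩ := hY.1 s hs
      exact ⟨a, (ih h).1 hS _ ha⟩
    · intro hX
      refine ⟨{r | ∃ s ∈ X, ∃ a, Holds (Function.update s x a) φ ∧ r = Function.update s x a},
        ⟨fun s hs => ?_, ?_⟩, (ih h).2 ?_⟩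
      · obtain ⟨a, ha⟩ := hX s hs
        exact ⟨a, s, hs, a, ha, rfl⟩
      · rintro r ⟨s, hs, a, -, rfl⟩
        exact ⟨s, hs, a, rfl⟩
      · rintro r ⟨s, hs, a, ha, rfl⟩
        exact ha
  | all x φ ih =>
    rw [sat_all, ih h]
    exact ⟨fun hX s hs a => hX _ ⟨s, hs, a, rfl⟩, by rintro hX _ ⟨s, hs, a, rfl⟩; exact hX s hs a⟩
  | _ => rfl

theorem sat_conj {l : List (Form L)} {X : Set (ℕ → M)} :
    Sat X (conj l) ↔ ∀ φ ∈ l, Sat X φ := by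
  induction l with
  | nil => simp [conj, top, Sat, Holds]
  | cons φ l ih =>
    cases l with
    | nil => simp [conj]
    | cons ψ l => rw [conj, Sat, ih]; simp

/-- In lax semantics successive supplementations compose to a single relation, total on both sides,
that changes the variables of the block only. -/
theorem sat_exs {xs : List ℕ} {φ : Form L} {X : Set (ℕ → M)} :
    Sat X (exs xs φ) ↔ ∃ Y, Linked (fun s t => ∀ z ∉ xs, s z = t z) X Y ∧ Sat Y φ := by
  induction xs generalizing X with
  | nil =>
    constructor
    · exact fun h => ⟨X, ⟨fun s hs => ⟨s, hs, fun _ _ => rfl⟩, fun s hs => ⟨s, hs, fun _ _ => rfl⟩⟩,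
        h⟩
    · rintro ⟨Y, hY, h⟩
      exact (sat_congr (hY.mono fun s t hst z _ => hst z (by simp))).2 h
  | cons x xs ih =>
    rw [exs_cons, sat_ex]
    constructor
    · rintro ⟨Y, hY, hS⟩
      obtain ⟨Z, hZ, hS⟩ := ih.1 hS
      refine ⟨Z, ⟨fun s hs => ?_, fun t ht => ?_⟩, hS⟩
      · obtain ⟨a, ha⟩ := hY.1 s hs
        obtain ⟨t, ht, hst⟩ := hZ.1 _ ha
        refine ⟨t, ht, fun z hz => ?_⟩
        simp only [List.mem_cons, not_or] at hz
        rw [← hst z hz.2, Function.update_of_ne hz.1]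
      · obtain ⟨r, hr, hrt⟩ := hZ.2 t ht
        obtain ⟨s, hs, a, rfl⟩ := hY.2 r hr
        refine ⟨s, hs, fun z hz => ?_⟩
        simp only [List.mem_cons, not_or] at hz
        rw [← hrt z hz.2, Function.update_of_ne hz.1]
    · rintro ⟨Z, hZ, hS⟩
      -- The intermediate team takes the value at `x` from the final assignment.
      refine ⟨{r | ∃ s ∈ X, ∃ t ∈ Z, (∀ z ∉ x :: xs, s z = t z) ∧ r = Function.update s x (t x)},
        ⟨fun s hs => ?_, ?_⟩, ih.2 ⟨Z, ⟨?_, fun t ht => ?_⟩, hS⟩⟩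
      · obtain ⟨t, ht, hst⟩ := hZ.1 s hs
        exact ⟨t x, s, hs, t, ht, hst, rfl⟩
      · rintro r ⟨s, hs, t, -, -, rfl⟩
        exact ⟨s, hs, t x, rfl⟩
      · rintro r ⟨s, hs, t, ht, hst, rfl⟩
        refine ⟨t, ht, fun z hz => ?_⟩
        by_cases hzx : z = x
        · simp [hzx]
        · rw [Function.update_of_ne hzx]
          exact hst z (by simp [hzx, hz])
      · obtain ⟨s, hs, hst⟩ := hZ.2 t ht
        refine ⟨_, ⟨s, hs, t, ht, hst, rfl⟩, fun z hz => ?_⟩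
        by_cases hzx : z = x
        · simp [hzx]
        · rw [Function.update_of_ne hzx]
          exact hst z (by simp [hzx, hz])

end Semantics

end Form

end IncLogic

/-! ### Reductions: derivable and semantically equivalent transformations -/

namespace IncLogic

open Language

variable {L : FirstOrder.Language.{u, v}}

open Form

/-- `ψ` is semantically equivalent to `φ`, derivable from `φ`, and has no new free variables. -/
structure Red (φ ψ : Form L) : Prop where
  deriv : ∀ Γ, Deriv Γ φ → Deriv Γ ψ
  sem : SemEquiv.{u, v, w} φ ψ
  fv_subset : ψ.fv ⊆ φ.fv

namespace Red

theorem refl (φ : Form L) : Red.{u, v, w} φ φ := ⟨fun _ h => h, fun _ _ _ _ => Iff.rfl, subset_rfl⟩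

theorem trans {φ ψ χ : Form L} (h : Red.{u, v, w} φ ψ) (h' : Red.{u, v, w} ψ χ) :
    Red.{u, v, w} φ χ :=
  ⟨fun Γ hd => h'.deriv Γ (h.deriv Γ hd), fun M _ _ X => (h.sem M X).trans (h'.sem M X),
    h'.fv_subset.trans h.fv_subset⟩

theorem and_congr {φ φ' ψ ψ' : Form L} (h : Red.{u, v, w} φ φ') (h' : Red.{u, v, w} ψ ψ') :
    Red.{u, v, w} (and φ ψ) (and φ' ψ') :=
  ⟨fun Γ hd => (h.deriv Γ hd.andE1).andI (h'.deriv Γ hd.andE2),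
    fun M _ _ X => _root_.and_congr (h.sem M X) (h'.sem M X),
    Finset.union_subset_union h.fv_subset h'.fv_subset⟩

theorem or_congr {φ φ' ψ ψ' : Form L} (h : Red.{u, v, w} φ φ') (h' : Red.{u, v, w} ψ ψ') :
    Red.{u, v, w} (or φ ψ) (or φ' ψ') where
  deriv Γ hd := by
    -- Disjunction elimination tolerates first-order side assumptions only; a reduction needs none.
    have h1 := h.deriv _ (Deriv.ass_insert (Γ := ∅) hd.wf.1)
    have h2 := h'.deriv _ (Deriv.ass_insert (Γ := ∅) hd.wf.2)
    exact Deriv.orE (Δ₀ := ∅) (Δ₁ := ∅) (Set.empty_subset _) (Set.empty_subset _) (by simp)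
      (by simp) hd (h1.orI1 h2.wf) (h2.orI2 h1.wf)
  sem M _ _ X := exists_congr fun Y => exists_congr fun Z =>
    and_congr_right fun _ => _root_.and_congr (h.sem M Y) (h'.sem M Z)
  fv_subset := Finset.union_subset_union h.fv_subset h'.fv_subset

theorem ex_congr {φ φ' : Form L} (x : ℕ) (h : Red.{u, v, w} φ φ') :
    Red.{u, v, w} (ex x φ) (ex x φ') where
  deriv _ hd := hd.exMono h.deriv
  sem M _ _ X := by
    rw [sat_ex, sat_ex]
    exact exists_congr fun Y => and_congr_right fun _ => h.sem M Y
  fv_subset := Finset.erase_subset_erase x h.fv_subset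

theorem all_congr {φ φ' : Form L} (x : ℕ) (h : Red.{u, v, w} φ φ') :
    Red.{u, v, w} (all x φ) (all x φ') where
  deriv _ hd := hd.allMono h.deriv
  sem M _ _ _ := h.sem M _
  fv_subset := Finset.erase_subset_erase x h.fv_subset

theorem exs_congr {φ φ' : Form L} (xs : List ℕ) (h : Red.{u, v, w} φ φ') :
    Red.{u, v, w} (exs xs φ) (exs xs φ') := by
  induction xs with
  | nil => exact h
  | cons x xs ih => exact ex_congr x ih

theorem and_comm (φ ψ : Form L) : Red.{u, v, w} (and φ ψ) (and ψ φ) :=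
  ⟨fun _ hd => hd.andE2.andI hd.andE1, fun _ _ _ _ => _root_.and_comm,
    (Finset.union_comm _ _).subset⟩

theorem or_comm (φ ψ : Form L) : Red.{u, v, w} (or φ ψ) (or ψ φ) where
  deriv Γ hd := Deriv.orE (Δ₀ := ∅) (Δ₁ := ∅) (Set.empty_subset _) (Set.empty_subset _) (by simp)
      (by simp) hd (Deriv.orI2 hd.wf.2 (Deriv.ass_insert hd.wf.1))
      (Deriv.orI1 hd.wf.1 (Deriv.ass_insert hd.wf.2))
  sem M _ _ X :=
    ⟨fun ⟨Y, Z, h, hY, hZ⟩ => ⟨Z, Y, h.trans (Set.union_comm _ _), hZ, hY⟩,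
      fun ⟨Y, Z, h, hY, hZ⟩ => ⟨Z, Y, h.trans (Set.union_comm _ _), hZ, hY⟩⟩
  fv_subset := (Finset.union_comm _ _).subset

/-- First-order formulas: it suffices to check the Tarski semantics. -/
theorem of_isFO {φ ψ : Form L} (hφ : φ.IsFO) (hψ : ψ.IsFO)
    (hd : ∀ Γ, Deriv Γ φ → Deriv Γ ψ)
    (hs : ∀ (M : Type w) [L.Structure M] (s : ℕ → M), Holds s φ ↔ Holds s ψ)
    (hfv : ψ.fv ⊆ φ.fv) : Red.{u, v, w} φ ψ where
  deriv := hd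
  sem M _ _ X := by
    rw [sat_iff_holds hφ, sat_iff_holds hψ]
    exact forall₂_congr fun s _ => hs M s
  fv_subset := hfv

/-! ### Moving quantifiers -/

theorem linked_of_supplements {M : Type w} {V : Finset ℕ} {x : ℕ} (hx : x ∉ V)
    {X Y : Set (ℕ → M)} (h : Supplements x X Y) :
    Linked (fun s t => ∀ z ∈ V, s z = t z) X Y := by
  refine ⟨fun s hs => ?_, fun t ht => ?_⟩
  · obtain ⟨a, ha⟩ := h.1 s hs
    exact ⟨_, ha, fun z hz => (Function.update_of_ne (fun e => hx (by rwa [← e])) _ _).symm⟩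
  · obtain ⟨s, hs, a, rfl⟩ := h.2 t ht
    exact ⟨s, hs, fun z hz => (Function.update_of_ne (fun e => hx (by rwa [← e])) _ _).symm⟩

theorem linked_dup {M : Type w} [Nonempty M] {V : Finset ℕ} {x : ℕ} (hx : x ∉ V)
    (X : Set (ℕ → M)) : Linked (fun s t => ∀ z ∈ V, s z = t z) X (dup x X) :=
  linked_of_supplements hx ⟨fun s hs => ⟨Classical.arbitrary M, s, hs, _, rfl⟩, fun _ h => h⟩

theorem ex_and {x : ℕ} {φ ψ : Form L} (hx : x ∉ ψ.fv) :
    Red.{u, v, w} (and (ex x φ) ψ) (ex x (and φ ψ)) where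
  deriv Γ hd := by
    have hw := hd.wf
    refine Deriv.cut₂ hd.andE1 hd.andE2 (Deriv.exE (Δ := {ψ}) (by simp) (by simp [fv])
      (by simpa using hx) (Deriv.ass hw.1 (by simp)) (Deriv.exI_self (Deriv.andI ?_ ?_)))
    · exact Deriv.ass hw.1 (by simp)
    · exact Deriv.ass hw.2 (by simp)
  sem M _ _ X := by
    rw [sat_ex, Sat, sat_ex]
    constructor
    · rintro ⟨⟨Y, hY, h⟩, h'⟩
      exact ⟨Y, hY, h, (sat_congr (linked_of_supplements hx hY)).1 h'⟩
    · rintro ⟨Y, hY, h, h'⟩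
      exact ⟨⟨Y, hY, h⟩, (sat_congr (linked_of_supplements hx hY)).2 h'⟩
  fv_subset := by
    intro z
    simp only [fv, Finset.mem_erase, Finset.mem_union]
    rintro ⟨hz, h | h⟩
    · exact .inl ⟨hz, h⟩
    · exact .inr h

theorem exs_and {xs : List ℕ} {φ ψ : Form L} (hx : ∀ x ∈ xs, x ∉ ψ.fv) :
    Red.{u, v, w} (and (exs xs φ) ψ) (exs xs (and φ ψ)) := by
  induction xs with
  | nil => exact refl _
  | cons x xs ih =>
    exact (ex_and (hx x (by simp))).trans (ex_congr x (ih fun z hz => hx z (by simp [hz])))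

theorem and_exs {xs : List ℕ} {φ ψ : Form L} (hx : ∀ x ∈ xs, x ∉ ψ.fv) :
    Red.{u, v, w} (and ψ (exs xs φ)) (exs xs (and ψ φ)) :=
  (and_comm _ _).trans ((exs_and hx).trans (exs_congr xs (and_comm _ _)))

theorem ex_or {x : ℕ} {φ ψ : Form L} (hx : x ∉ ψ.fv) :
    Red.{u, v, w} (or (ex x φ) ψ) (ex x (or φ ψ)) where
  deriv Γ hd := by
    have hw := hd.wf
    refine Deriv.orE (Δ₀ := ∅) (Δ₁ := ∅) (Set.empty_subset _) (Set.empty_subset _) (by simp)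
      (by simp) hd ?_ ?_
    · exact Deriv.exMono (Deriv.ass_insert hw.1) fun Γ h => h.orI1 hw.2
    · exact Deriv.exI_self (Deriv.orI2 hw.1 (Deriv.ass_insert hw.2))
  sem M _ _ X := by
    rw [sat_ex]
    constructor
    · rintro ⟨A, B, rfl, hA, hB⟩
      obtain ⟨Y, hY, h⟩ := sat_ex.1 hA
      -- The half for `ψ` may take all values at `x`, by locality.
      refine ⟨Y ∪ dup x B, ⟨?_, ?_⟩, Y, dup x B, rfl, h, (sat_congr (linked_dup hx B)).1 hB⟩
      · rintro s (hs | hs)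
        · exact (hY.1 s hs).imp fun a ha => .inl ha
        · exact ⟨Classical.arbitrary M, .inr ⟨s, hs, _, rfl⟩⟩
      · rintro r (hr | ⟨s, hs, a, rfl⟩)
        · obtain ⟨s, hs, a, rfl⟩ := hY.2 r hr
          exact ⟨s, .inl hs, a, rfl⟩
        · exact ⟨s, .inr hs, a, rfl⟩
    · rintro ⟨_, hY, Y, Z, rfl, h, h'⟩
      -- An assignment is put into each half that contains one of its extensions.
      have supp : ∀ Z' : Set (ℕ → M), Z' ⊆ Y ∪ Z →
          Supplements x {s ∈ X | ∃ a, Function.update s x a ∈ Z'} Z' := by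
        refine fun Z' hZ' => ⟨fun s hs => hs.2, fun r hr => ?_⟩
        obtain ⟨s, hs, a, rfl⟩ := hY.2 r (hZ' hr)
        exact ⟨s, ⟨hs, a, hr⟩, a, rfl⟩
      refine ⟨_, _, ?_, sat_ex.2 ⟨Y, supp Y Set.subset_union_left, h⟩,
        (sat_congr (linked_of_supplements hx (supp Z Set.subset_union_right))).2 h'⟩
      ext s
      refine ⟨fun hs => ?_, fun hs => hs.elim (·.1) (·.1)⟩
      obtain ⟨a, ha | ha⟩ := hY.1 s hs
      · exact .inl ⟨hs, a, ha⟩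
      · exact .inr ⟨hs, a, ha⟩
  fv_subset := by
    intro z
    simp only [fv, Finset.mem_erase, Finset.mem_union]
    rintro ⟨hz, h | h⟩
    · exact .inl ⟨hz, h⟩
    · exact .inr h

theorem exs_or {xs : List ℕ} {φ ψ : Form L} (hx : ∀ x ∈ xs, x ∉ ψ.fv) :
    Red.{u, v, w} (or (exs xs φ) ψ) (exs xs (or φ ψ)) := by
  induction xs with
  | nil => exact refl _
  | cons x xs ih =>
    exact (ex_or (hx x (by simp))).trans (ex_congr x (ih fun z hz => hx z (by simp [hz])))

theorem all_and {x : ℕ} {φ ψ : Form L} (hx : x ∉ ψ.fv) :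
    Red.{u, v, w} (and (all x φ) ψ) (all x (and φ ψ)) where
  deriv Γ hd := by
    have hw := hd.wf
    refine Deriv.cut₂ hd.andE1 hd.andE2 (Deriv.allSub (x := x) (φ := φ) (Δ := {ψ}) (by simp)
      (by simp [fv]) (by simpa using hx) (admissible_single_self x φ)
      (Deriv.ass hw.1 (by simp)) (Deriv.andI ?_ ?_))
    · rw [subst_single_self]; exact Deriv.ass hw.1 (by simp)
    · exact Deriv.ass hw.2 (by simp)
  sem M _ _ X := and_congr_right fun _ => sat_congr (linked_dup hx X)
  fv_subset := by
    intro z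
    simp only [fv, Finset.mem_erase, Finset.mem_union]
    rintro ⟨hz, h | h⟩
    · exact .inl ⟨hz, h⟩
    · exact .inr h

theorem all_and_split {x : ℕ} {φ ψ : Form L} (hx : x ∉ ψ.fv) :
    Red.{u, v, w} (all x (and φ ψ)) (and (all x φ) ψ) where
  deriv Γ hd := (hd.allMono fun _ h => h.andE1).andI
    (Deriv.allE₀ hx (hd.allMono fun _ h => h.andE2))
  sem M _ _ X := and_congr_right fun _ => (sat_congr (linked_dup hx X)).symm
  fv_subset := by
    intro z
    simp only [fv, Finset.mem_erase, Finset.mem_union]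
    rintro (⟨hz, h⟩ | h)
    · exact ⟨hz, .inl h⟩
    · exact ⟨fun e => hx (e ▸ h), .inr h⟩

theorem all_and_all (x : ℕ) (φ ψ : Form L) :
    Red.{u, v, w} (and (all x φ) (all x ψ)) (all x (and φ ψ)) where
  deriv Γ hd := hd.andE1.allAndExt hd.andE2
  sem M _ _ X := Iff.rfl
  fv_subset := by
    intro z
    simp only [fv, Finset.mem_erase, Finset.mem_union]
    tauto

theorem all_vacuous {x : ℕ} {φ : Form L} (hx : x ∉ φ.fv) : Red.{u, v, w} φ (all x φ) where
  deriv Γ hd := hd.cut (Deriv.allI subset_rfl (by simpa using hx) (Deriv.ass hd.wf rfl))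
  sem M _ _ X := sat_congr (linked_dup hx X)
  fv_subset := Finset.erase_subset _ _

theorem mem_fv_subst_single {x y z : ℕ} {φ : Form L} (hy : y ∉ φ.vars)
    (hz : z ∈ (subst (single x (.var y)) φ).fv) : z = y ∨ (z ≠ x ∧ z ∈ φ.fv) := by
  obtain ⟨z', hz', h⟩ := exists_of_mem_fv_subst (admissible_single_fresh hy) hz
  by_cases e : z' = x
  · left; simpa [single, e, Term.varFinset] using h
  · right
    have : z = z' := by simpa [single, e, Term.varFinset] using h
    exact this ▸ ⟨e, hz'⟩

theorem linked_rename {M : Type w} [L.Structure M] {x y : ℕ} {φ : Form L} (hy : y ∉ φ.vars)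
    {s : ℕ → M} {a : M} : ∀ z ∈ φ.fv, ((single x (.var y) : ℕ → L.Term ℕ) z).realize
      (Function.update s y a) = Function.update s x a z := by
  intro z hz
  by_cases hzx : z = x
  · simp [single, hzx]
  · have : z ≠ y := fun e => hy (φ.fv_subset_vars (e ▸ hz))
    simp [single, hzx, this]

theorem ex_rename {x y : ℕ} {φ : Form L} (hy : y ∉ φ.vars) :
    Red.{u, v, w} (ex x φ) (ex y (subst (single x (.var y)) φ)) where
  deriv Γ hd := by
    refine Deriv.exE (Δ := ∅) (Set.empty_subset _) ?_ (by simp) hd (Deriv.exI (t := .var x)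
      (WF.subst _ hd.wf) (admissible_single_back hy) ?_)
    · intro hx
      simp only [fv, Finset.mem_erase] at hx
      rcases mem_fv_subst_single hy hx.2 with h | h
      · exact hx.1 h
      · exact h.1 rfl
    · rw [subst_single_back hy]; exact Deriv.ass_insert hd.wf
  sem M _ _ X := by
    rw [sat_ex, sat_ex]
    constructor
    · rintro ⟨Y, hY, h⟩
      refine ⟨{r | ∃ s ∈ X, ∃ a, Function.update s x a ∈ Y ∧ r = Function.update s y a},
        ⟨fun s hs => ?_, ?_⟩, (sat_subst (admissible_single_fresh hy) ⟨?_, fun t ht => ?_⟩).2 h⟩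
      · obtain ⟨a, ha⟩ := hY.1 s hs
        exact ⟨a, s, hs, a, ha, rfl⟩
      · rintro r ⟨s, hs, a, -, rfl⟩
        exact ⟨s, hs, a, rfl⟩
      · rintro r ⟨s, hs, a, ha, rfl⟩
        exact ⟨_, ha, linked_rename hy⟩
      · obtain ⟨s, hs, a, rfl⟩ := hY.2 t ht
        exact ⟨_, ⟨s, hs, a, ht, rfl⟩, linked_rename hy⟩
    · rintro ⟨Y, hY, h⟩
      refine ⟨{r | ∃ s ∈ X, ∃ a, Function.update s y a ∈ Y ∧ r = Function.update s x a},
        ⟨fun s hs => ?_, ?_⟩, (sat_subst (admissible_single_fresh hy) ⟨fun t ht => ?_, ?_⟩).1 h⟩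
      · obtain ⟨a, ha⟩ := hY.1 s hs
        exact ⟨a, s, hs, a, ha, rfl⟩
      · rintro r ⟨s, hs, a, -, rfl⟩
        exact ⟨s, hs, a, rfl⟩
      · obtain ⟨s, hs, a, rfl⟩ := hY.2 t ht
        exact ⟨_, ⟨s, hs, a, ht, rfl⟩, linked_rename hy⟩
      · rintro r ⟨s, hs, a, ha, rfl⟩
        exact ⟨_, ha, linked_rename hy⟩
  fv_subset := by
    intro z hz
    simp only [fv, Finset.mem_erase] at hz ⊢
    rcases mem_fv_subst_single hy hz.2 with h | h
    · exact absurd h hz.1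
    · exact h

theorem all_rename {x y : ℕ} {φ : Form L} (hy : y ∉ φ.vars) :
    Red.{u, v, w} (all x φ) (all y (subst (single x (.var y)) φ)) where
  deriv Γ hd := Deriv.allSub (Δ := ∅) (Set.empty_subset _)
    (fun h => hy (φ.fv_subset_vars (Finset.mem_of_mem_erase h))) (by simp)
    (admissible_single_fresh hy) hd (Deriv.ass_insert (WF.subst _ hd.wf))
  sem M _ _ X := by
    rw [sat_all, sat_all]
    refine (sat_subst (admissible_single_fresh hy) ⟨?_, ?_⟩).symm
    · rintro r ⟨s, hs, a, rfl⟩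
      exact ⟨_, ⟨s, hs, a, rfl⟩, linked_rename hy⟩
    · rintro r ⟨s, hs, a, rfl⟩
      exact ⟨_, ⟨s, hs, a, rfl⟩, linked_rename hy⟩
  fv_subset := by
    intro z hz
    simp only [fv, Finset.mem_erase] at hz ⊢
    rcases mem_fv_subst_single hy hz.2 with h | h
    · exact absurd h hz.1
    · exact h

/-! ### The rules that are specific to inclusion logic -/

/-- The pair `p, q` records the side of the disjunction: equal values for `φ`, distinct ones for
`ψ`, which exist since models have two elements. The choice precedes the quantifier, so all values
of `x` stay on one side. -/
theorem all_or {x p q : ℕ} {φ ψ : Form L} (hx : x ∉ ψ.fv) (hpq : p ≠ q)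
    (hp : p ∉ insert x (φ.vars ∪ ψ.vars)) (hq : q ∉ insert x (φ.vars ∪ ψ.vars)) :
    Red.{u, v, w} (or (all x φ) ψ)
      (ex p (ex q (all x (or (and φ (veq p q)) (and ψ (neg (veq p q))))))) where
  deriv Γ hd := hd.allOrExt hx hpq hp hq
  sem M _ _ X := by
    simp only [Finset.mem_insert, Finset.mem_union, not_or] at hp hq
    have hpφ : p ∉ φ.fv := fun h => hp.2.1 (φ.fv_subset_vars h)
    have hqφ : q ∉ φ.fv := fun h => hq.2.1 (φ.fv_subset_vars h)
    have hpψ : p ∉ ψ.fv := fun h => hp.2.2 (ψ.fv_subset_vars h)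
    have hqψ : q ∉ ψ.fv := fun h => hq.2.2 (ψ.fv_subset_vars h)
    have key : Sat X (ex p (ex q (all x (or (and φ (veq p q)) (and ψ (neg (veq p q))))))) ↔
        ∃ Y, Linked (fun s t => ∀ z ∉ [p, q], s z = t z) X Y ∧
          Sat Y (all x (or (and φ (veq p q)) (and ψ (neg (veq p q))))) :=
      sat_exs (xs := [p, q])
    rw [key]
    constructor
    · rintro ⟨A, B, rfl, hA, hB⟩
      obtain ⟨a, b, hab⟩ := exists_pair_ne M
      have off : ∀ (s : ℕ → M) (c z : ℕ) (d e : M), z ∉ [p, q] →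
          s z = Function.update (Function.update s p d) q e z := by
        intro s c z d e hz
        simp only [List.mem_cons, List.not_mem_nil, or_false, not_or] at hz
        rw [Function.update_of_ne hz.2, Function.update_of_ne hz.1]
      let Y₁ : Set (ℕ → M) := {t | ∃ s ∈ A, t = Function.update (Function.update s p a) q a}
      let Y₂ : Set (ℕ → M) := {t | ∃ s ∈ B, t = Function.update (Function.update s p a) q b}
      have l₁ : Linked (fun s t => ∀ z ∉ [p, q], s z = t z) A Y₁ :=
        ⟨fun s hs => ⟨_, ⟨s, hs, rfl⟩, fun z hz => off s 0 z a a hz⟩,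
          by rintro t ⟨s, hs, rfl⟩; exact ⟨s, hs, fun z hz => off s 0 z a a hz⟩⟩
      have l₂ : Linked (fun s t => ∀ z ∉ [p, q], s z = t z) B Y₂ :=
        ⟨fun s hs => ⟨_, ⟨s, hs, rfl⟩, fun z hz => off s 0 z a b hz⟩,
          by rintro t ⟨s, hs, rfl⟩; exact ⟨s, hs, fun z hz => off s 0 z a b hz⟩⟩
      refine ⟨Y₁ ∪ Y₂, ⟨?_, ?_⟩, dup x Y₁, dup x Y₂, ?_, ⟨?_, ?_⟩, ?_, ?_⟩
      · rintro s (hs | hs)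
        · exact (l₁.1 s hs).imp fun t ht => ⟨.inl ht.1, ht.2⟩
        · exact (l₂.1 s hs).imp fun t ht => ⟨.inr ht.1, ht.2⟩
      · rintro t (ht | ht)
        · exact (l₁.2 t ht).imp fun t ht => ⟨.inl ht.1, ht.2⟩
        · exact (l₂.2 t ht).imp fun t ht => ⟨.inr ht.1, ht.2⟩
      · ext t
        constructor
        · rintro ⟨s, hs | hs, c, rfl⟩
          · exact .inl ⟨s, hs, c, rfl⟩
          · exact .inr ⟨s, hs, c, rfl⟩
        · rintro (⟨s, hs, c, rfl⟩ | ⟨s, hs, c, rfl⟩)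
          · exact ⟨s, .inl hs, c, rfl⟩
          · exact ⟨s, .inr hs, c, rfl⟩
      · refine (sat_congr (l₁.dup (R' := fun s t => ∀ z ∈ φ.fv, s z = t z)
          fun s t c hst z hz => ?_)).1 hA
        by_cases hzx : z = x
        · simp [hzx]
        · rw [Function.update_of_ne hzx, Function.update_of_ne hzx]
          refine hst z ?_
          simp only [List.mem_cons, List.not_mem_nil, or_false, not_or]
          exact ⟨fun e => hpφ (e ▸ hz), fun e => hqφ (e ▸ hz)⟩
      · rintro _ ⟨_, ⟨s, hs, rfl⟩, c, rfl⟩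
        simp [hp.1, hq.1, hpq]
      · refine (sat_congr (linked_dup hx Y₂)).1 ((sat_congr (l₂.mono fun s t hst z hz => ?_)).1 hB)
        refine hst z ?_
        simp only [List.mem_cons, List.not_mem_nil, or_false, not_or]
        exact ⟨fun e => hpψ (e ▸ hz), fun e => hqψ (e ▸ hz)⟩
      · rintro _ ⟨_, ⟨s, hs, rfl⟩, c, rfl⟩
        simp [Holds, veq, hp.1, hq.1, hpq, hab]
    · rintro ⟨Y, hY, P, Q, hPQ, ⟨hP, hPe⟩, hQ, hQe⟩
      replace hPQ : dup x Y = P ∪ Q := hPQ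
      have hPe' : ∀ r ∈ P, r p = r q := hPe
      have hQe' : ∀ r ∈ Q, r p ≠ r q := hQe
      have upd : ∀ (t : ℕ → M) (c : M), Function.update t x c p = t p ∧
          Function.update t x c q = t q := fun t c =>
        ⟨Function.update_of_ne hp.1 _ _, Function.update_of_ne hq.1 _ _⟩
      have inP : ∀ t ∈ Y, t p = t q → ∀ c, Function.update t x c ∈ P := by
        intro t ht e c
        have : Function.update t x c ∈ P ∪ Q := hPQ ▸ ⟨t, ht, c, rfl⟩
        exact this.resolve_right fun h => hQe' _ h (by rw [(upd t c).1, (upd t c).2, e])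
      have inQ : ∀ t ∈ Y, t p ≠ t q → ∀ c, Function.update t x c ∈ Q := by
        intro t ht e c
        have : Function.update t x c ∈ P ∪ Q := hPQ ▸ ⟨t, ht, c, rfl⟩
        exact this.resolve_left fun h => e (by rw [← (upd t c).1, ← (upd t c).2, hPe' _ h])
      refine ⟨{s ∈ X | ∃ t ∈ Y, (∀ z ∉ [p, q], s z = t z) ∧ t p = t q},
        {s ∈ X | ∃ t ∈ Y, (∀ z ∉ [p, q], s z = t z) ∧ t p ≠ t q}, ?_, ?_, ?_⟩
      · ext s
        refine ⟨fun hs => ?_, fun hs => hs.elim (·.1) (·.1)⟩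
        obtain ⟨t, ht, hst⟩ := hY.1 s hs
        by_cases e : t p = t q
        · exact .inl ⟨hs, t, ht, hst, e⟩
        · exact .inr ⟨hs, t, ht, hst, e⟩
      · have off : ∀ (s t : ℕ → M) (c : M), (∀ z ∉ [p, q], s z = t z) →
            ∀ z ∈ φ.fv, Function.update s x c z = Function.update t x c z := by
          intro s t c hst z hz
          by_cases hzx : z = x
          · simp [hzx]
          · rw [Function.update_of_ne hzx, Function.update_of_ne hzx]
            refine hst z ?_
            simp only [List.mem_cons, List.not_mem_nil, or_false, not_or]
            exact ⟨fun e => hpφ (e ▸ hz), fun e => hqφ (e ▸ hz)⟩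
        refine (sat_congr (X := dup x _) ⟨?_, fun r hr => ?_⟩).2 hP
        · rintro _ ⟨s, ⟨hs, t, ht, hst, e⟩, c, rfl⟩
          exact ⟨_, inP t ht e c, off s t c hst⟩
        · have : r ∈ dup x Y := hPQ ▸ .inl hr
          obtain ⟨t, ht, c, rfl⟩ := this
          obtain ⟨s, hs, hst⟩ := hY.2 t ht
          refine ⟨_, ⟨s, ⟨hs, t, ht, hst, ?_⟩, c, rfl⟩, off s t c hst⟩
          have := hPe' _ hr
          rwa [(upd t c).1, (upd t c).2] at this
      · have off : ∀ (s t : ℕ → M) (c : M), (∀ z ∉ [p, q], s z = t z) →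
            ∀ z ∈ ψ.fv, s z = Function.update t x c z := by
          intro s t c hst z hz
          rw [Function.update_of_ne fun e : z = x => hx (e ▸ hz)]
          refine hst z ?_
          simp only [List.mem_cons, List.not_mem_nil, or_false, not_or]
          exact ⟨fun e => hpψ (e ▸ hz), fun e => hqψ (e ▸ hz)⟩
        refine (sat_congr ⟨?_, fun r hr => ?_⟩).2 hQ
        · rintro s ⟨hs, t, ht, hst, e⟩
          exact ⟨_, inQ t ht e (t x), off s t _ hst⟩
        · have : r ∈ dup x Y := hPQ ▸ .inr hr
          obtain ⟨t, ht, c, rfl⟩ := this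
          obtain ⟨s, hs, hst⟩ := hY.2 t ht
          refine ⟨_, ⟨hs, t, ht, hst, ?_⟩, off s t c hst⟩
          have := hQe' _ hr
          rwa [(upd t c).1, (upd t c).2] at this
  fv_subset := by
    intro z
    simp only [fv, veq, Term.varFinset, Finset.mem_erase, Finset.mem_union, Finset.mem_singleton]
    rintro ⟨h1, h2, h3, (h | h | h) | h | h | h⟩
    · exact .inl ⟨h3, h⟩
    · exact absurd h h1
    · exact absurd h h2
    · exact .inr h
    · exact absurd h h1
    · exact absurd h h2

/-- The atom under `∀y` forces every value to occur at `x` together with the same `zs`; as `φ` sees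
nothing else, such a team is as good as the duplicated one, which in turn satisfies the atom. Taking
`zs` among the free variables of `φ` avoids new free variables. -/
theorem all_sim {x y : ℕ} {zs : List ℕ} {φ : Form L} (hxz : x ∉ zs) (hfv : φ.fv ⊆ (x :: zs).toFinset)
    (hzs : ∀ z ∈ zs, z ∈ φ.fv) (hyx : y ≠ x) (hyz : y ∉ zs) (hy : y ∉ φ.vars) :
    Red.{u, v, w} (all x φ) (ex x (all y (and (inc (zs ++ [y]) (zs ++ [x])) φ))) where
  deriv Γ hd := Deriv.allSim (xs := [x]) (ys := [y]) (by simp) (by simpa using hxz)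
    (by simpa using hfv) rfl (by simp) (by simp [hyx, hyz]) (by simpa using hy) hd
  sem M _ _ X := by
    have hyφ : y ∉ φ.fv := fun h => hy (φ.fv_subset_vars h)
    rw [sat_all, sat_ex]
    constructor
    · intro h
      refine ⟨dup x X, ⟨fun s hs => ⟨Classical.arbitrary M, s, hs, _, rfl⟩, fun r hr => hr⟩, ?_,
        (sat_congr (linked_dup hyφ _)).1 h⟩
      rintro _ ⟨_, ⟨s, hs, a, rfl⟩, b, rfl⟩
      refine ⟨_, ⟨_, ⟨s, hs, b, rfl⟩, b, rfl⟩, ?_⟩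
      simp only [List.map_append, List.map_cons, List.map_nil, Function.update_self]
      congr 1
      · refine List.map_congr_left fun z hz => ?_
        have h₁ : z ≠ y := fun e => hyz (e ▸ hz)
        have h₂ : z ≠ x := fun e => hxz (e ▸ hz)
        simp only [Function.update_of_ne h₁, Function.update_of_ne h₂]
      · rw [Function.update_of_ne hyx.symm, Function.update_self]
    · rintro ⟨Y, hY, hinc, h⟩
      refine (sat_congr ⟨?_, ?_⟩).2 h
      · rintro _ ⟨s, hs, b, rfl⟩
        obtain ⟨a, ha⟩ := hY.1 s hs
        obtain ⟨r, hr, e⟩ := hinc (Function.update (Function.update s x a) y b) ⟨_, ha, b, rfl⟩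
        refine ⟨r, hr, fun z hz => ?_⟩
        simp only [List.map_append, List.map_cons, List.map_nil, Function.update_self] at e
        obtain ⟨e₁, e₂⟩ := List.append_inj e (by simp)
        have hz' := hfv hz
        simp only [List.toFinset_cons, Finset.mem_insert, List.mem_toFinset] at hz'
        by_cases hzx : z = x
        · subst hzx
          simpa using e₂
        · have hz'' := hz'.resolve_left hzx
          have := List.map_inj_left.1 e₁ z hz''
          rw [Function.update_of_ne (fun e : z = y => hyz (e ▸ hz'')), Function.update_of_ne hzx] at this
          rw [Function.update_of_ne hzx, this]
      · rintro _ ⟨r, hr, b, rfl⟩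
        obtain ⟨s, hs, a, rfl⟩ := hY.2 r hr
        exact ⟨_, ⟨s, hs, a, rfl⟩, fun z hz =>
          (Function.update_of_ne (fun e : z = y => hyφ (e ▸ hz)) _ _).symm⟩
  fv_subset := by
    intro z
    simp only [fv, Finset.mem_erase, Finset.mem_union, List.mem_toFinset, List.mem_append,
      List.mem_singleton]
    rintro ⟨h1, h2, ((h | h) | h | h) | h⟩
    · exact ⟨h1, hzs z h⟩
    · exact absurd h h2
    · exact ⟨h1, hzs z h⟩
    · exact absurd h h1
    · exact ⟨h1, h⟩

/-- The atoms can leave the disjunction because they are made trivially true on the half for `φ`.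
Since `p = q` marks the truth of `α`, atoms extended by `p, q` on both sides find their witnesses
for assignments satisfying `α` among assignments satisfying `α`. -/
theorem ex_inc {xs : List ℕ} {ps : List (List ℕ × List ℕ)} {α φ : Form L} {p q : ℕ} (ha : α.IsFO)
    (hx : xs.Nodup)
    (hps : ∀ a ∈ ps, a.1.length = a.2.length ∧ a.1.Nodup ∧ a.2.Nodup ∧ a.1 ⊆ xs ∧ a.2 ⊆ xs)
    (hφ : ∀ x ∈ xs, x ∉ φ.fv) (hpq : p ≠ q) (hp : p ∉ xs.toFinset ∪ α.vars ∪ φ.vars)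
    (hq : q ∉ xs.toFinset ∪ α.vars ∪ φ.vars) :
    Red.{u, v, w} (or (exs xs (and (conj (ps.map fun a => inc a.1 a.2)) α)) φ)
      (exs (xs ++ [p, q]) (and (conj (ps.map fun a => inc (a.1 ++ [p, q]) (a.2 ++ [p, q])))
          (and (iff α (veq p q)) (or α φ)))) where
  deriv Γ hd := by
    rw [exs_append]
    exact hd.exIncExt ha hx hps hφ hpq hp hq
  sem M _ _ X := by
    classical
    simp only [Finset.mem_union, List.mem_toFinset, not_or] at hp hq
    have hpα : p ∉ α.fv := fun h => hp.1.2 (α.fv_subset_vars h)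
    have hqα : q ∉ α.fv := fun h => hq.1.2 (α.fv_subset_vars h)
    have hpφ : p ∉ φ.fv := fun h => hp.2 (φ.fv_subset_vars h)
    have hqφ : q ∉ φ.fv := fun h => hq.2 (φ.fv_subset_vars h)
    have hφ' : ∀ z ∈ φ.fv, z ∉ xs ++ [p, q] := by
      intro z hz h
      simp only [List.mem_append, List.mem_cons, List.not_mem_nil, or_false] at h
      rcases h with h | rfl | rfl
      · exact hφ z h hz
      · exact hpφ hz
      · exact hqφ hz
    have hiff : ∀ Y : Set (ℕ → M), Sat Y (iff α (veq p q)) ↔ ∀ t ∈ Y, (Holds t α ↔ t p = t q) := by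
      intro Y
      rw [sat_iff_holds (show (iff α (veq p q)).IsFO from ⟨⟨ha, trivial⟩, trivial, ha⟩)]
      refine forall₂_congr fun t _ => ?_
      simp only [iff, imp, Holds, veq, Term.realize_var]
      tauto
    rw [sat_exs]
    constructor
    · rintro ⟨A, B, rfl, hA, hB⟩
      obtain ⟨A', hA', hinc, hα⟩ := sat_exs.1 hA
      rw [sat_conj] at hinc
      rw [sat_iff_holds ha] at hα
      obtain ⟨a, b, hab⟩ := exists_pair_ne M
      -- On the half for `φ` all variables of `xs` get one value, so every atom is witnessed by the
      -- assignment itself; `q` then records whether `α` happens to hold.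
      let c : (ℕ → M) → ℕ → M := fun s z => if z ∈ xs then a else s z
      let f : (ℕ → M) → ℕ → M := fun r => Function.update (Function.update r p a) q a
      let d : (ℕ → M) → ℕ → M := fun s =>
        Function.update (Function.update (c s) p a) q (if Holds (c s) α then a else b)
      have upd : ∀ (r : ℕ → M) (e e' : M) (z : ℕ), z ≠ p → z ≠ q →
          Function.update (Function.update r p e) q e' z = r z := fun r e e' z h₁ h₂ => by
        rw [Function.update_of_ne h₂, Function.update_of_ne h₁]
      have hdp : ∀ s, d s p = a := fun s => by simp [d, hpq]
      have hdq : ∀ s, d s q = if Holds (c s) α then a else b := fun s => by simp [d]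
      have hdxs : ∀ s, ∀ z ∈ xs, d s z = a := fun s z hz => by
        have : d s z = c s z := upd _ _ _ z (fun e => hp.1.1 (e ▸ hz)) (fun e => hq.1.1 (e ▸ hz))
        simp [this, c, hz]
      have hdoff : ∀ s, ∀ z ∉ xs ++ [p, q], s z = d s z := fun s z hz => by
        simp only [List.mem_append, List.mem_cons, List.not_mem_nil, or_false, not_or] at hz
        have : d s z = c s z := upd _ _ _ z hz.2.1 hz.2.2
        simp [this, c, hz.1]
      have holds_upd : ∀ (r : ℕ → M) (e e' : M),
          Holds (Function.update (Function.update r p e) q e') α ↔ Holds r α := fun r e e' =>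
        holds_congr fun z hz => upd r e e' z (fun h => hpα (h ▸ hz)) (fun h => hqα (h ▸ hz))
      refine ⟨f '' A' ∪ d '' B, ⟨?_, ?_⟩, sat_conj.2 ?_, (hiff _).2 ?_, ?_⟩
      · rintro s (hs | hs)
        · obtain ⟨r, hr, hsr⟩ := hA'.1 s hs
          refine ⟨f r, .inl ⟨r, hr, rfl⟩, fun z hz => ?_⟩
          simp only [List.mem_append, List.mem_cons, List.not_mem_nil, or_false, not_or] at hz
          rw [hsr z hz.1]
          exact (upd _ _ _ z hz.2.1 hz.2.2).symm
        · exact ⟨d s, .inr ⟨s, hs, rfl⟩, hdoff s⟩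
      · rintro _ (⟨r, hr, rfl⟩ | ⟨s, hs, rfl⟩)
        · obtain ⟨s, hs, hsr⟩ := hA'.2 r hr
          refine ⟨s, .inl hs, fun z hz => ?_⟩
          simp only [List.mem_append, List.mem_cons, List.not_mem_nil, or_false, not_or] at hz
          rw [hsr z hz.1]
          exact (upd _ _ _ z hz.2.1 hz.2.2).symm
        · exact ⟨s, .inr hs, hdoff s⟩
      · intro ψ hψ
        obtain ⟨⟨us, vs⟩, hmem, rfl⟩ := List.mem_map.1 hψ
        obtain ⟨hl, -, -, hu, hv⟩ := hps _ hmem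
        simp only at hl hu hv
        have mapf : ∀ (r : ℕ → M) (l : List ℕ), l ⊆ xs → l.map (f r) = l.map r := fun r l hl =>
          List.map_congr_left fun z hz => upd _ _ _ z (fun e => hp.1.1 (e ▸ hl hz))
            (fun e => hq.1.1 (e ▸ hl hz))
        rintro _ (⟨r, hr, rfl⟩ | ⟨s, hs, rfl⟩)
        · obtain ⟨r', hr', e⟩ := hinc _ (List.mem_map.2 ⟨_, hmem, rfl⟩) r hr
          refine ⟨f r', .inl ⟨r', hr', rfl⟩, ?_⟩
          rw [List.map_append, List.map_append, mapf r us hu, mapf r' vs hv, e]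
          simp [f, hpq]
        · refine ⟨d s, .inr ⟨s, hs, rfl⟩, ?_⟩
          rw [List.map_append, List.map_append]
          congr 1
          rw [List.map_congr_left fun z hz => hdxs s z (hu hz),
            List.map_congr_left fun z hz => hdxs s z (hv hz), List.map_const', List.map_const', hl]
      · rintro _ (⟨r, hr, rfl⟩ | ⟨s, hs, rfl⟩)
        · simp only [f, holds_upd, hα r hr, true_iff]
          simp [hpq]
        · rw [hdp, hdq]
          simp only [d, holds_upd]
          by_cases h : Holds (c s) α <;> simp [h, hab]
      · refine ⟨{t ∈ f '' A' ∪ d '' B | Holds t α}, d '' B, ?_,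
          (sat_iff_holds ha).2 fun t ht => ht.2, (sat_congr ⟨?_, ?_⟩).1 hB⟩
        · ext t
          constructor
          · rintro (⟨r, hr, rfl⟩ | ht)
            · exact .inl ⟨.inl ⟨r, hr, rfl⟩, (holds_upd _ _ _).2 (hα r hr)⟩
            · exact .inr ht
          · rintro (ht | ht)
            · exact ht.1
            · exact .inr ht
        · exact fun s hs => ⟨d s, ⟨s, hs, rfl⟩, fun z hz => hdoff s z (hφ' z hz)⟩
        · rintro _ ⟨s, hs, rfl⟩
          exact ⟨s, hs, fun z hz => hdoff s z (hφ' z hz)⟩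
    · rintro ⟨Y, hY, hinc, hi, Y₁, Y₂, rfl, h₁, h₂⟩
      rw [sat_conj] at hinc
      rw [hiff] at hi
      rw [sat_iff_holds ha] at h₁
      -- The left half comes from all extensions with `p = q`, not only from `Y₁`, which need not
      -- contain the witnesses of the atoms.
      refine ⟨{s ∈ X | ∃ t ∈ Y₁ ∪ Y₂, (∀ z ∉ xs ++ [p, q], s z = t z) ∧ t p = t q},
        {s ∈ X | ∃ t ∈ Y₂, ∀ z ∉ xs ++ [p, q], s z = t z}, ?_, ?_, ?_⟩
      · ext s
        refine ⟨fun hs => ?_, fun hs => hs.elim (·.1) (·.1)⟩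
        obtain ⟨t, ht | ht, hst⟩ := hY.1 s hs
        · exact .inl ⟨hs, t, .inl ht, hst, (hi t (.inl ht)).1 (h₁ t ht)⟩
        · exact .inr ⟨hs, t, ht, hst⟩
      · have hoff : ∀ z ∈ (exs xs (and (conj (ps.map fun a => inc a.1 a.2)) α)).fv,
              z ∉ xs ++ [p, q] := by
            intro z hz
            obtain ⟨hz, hzx⟩ := mem_fv_exs.1 hz
            simp only [List.mem_append, List.mem_cons, List.not_mem_nil, or_false, not_or]
            refine ⟨hzx, ?_⟩
            simp only [fv, Finset.mem_union] at hz
            rcases hz with hz | hz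
            · obtain ⟨ψ, hψ, hz⟩ := mem_fv_conj.1 hz
              obtain ⟨a, ha', rfl⟩ := List.mem_map.1 hψ
              obtain ⟨-, -, -, hu, hv⟩ := hps a ha'
              simp only [fv, Finset.mem_union, List.mem_toFinset] at hz
              exact absurd (hz.elim (hu ·) (hv ·)) hzx
            · exact ⟨fun e => hpα (e ▸ hz), fun e => hqα (e ▸ hz)⟩
        refine (sat_congr (Y := {t ∈ Y₁ ∪ Y₂ | t p = t q}) ⟨?_, ?_⟩).2 (sat_exs.2
          ⟨_, ⟨fun s hs => ⟨s, hs, fun _ _ => rfl⟩, fun s hs => ⟨s, hs, fun _ _ => rfl⟩⟩,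
            sat_conj.2 ?_, (sat_iff_holds ha).2 fun t ht => (hi t ht.1).2 ht.2⟩)
        · rintro s ⟨hs, t, ht, hst, e⟩
          exact ⟨t, ⟨ht, e⟩, fun z hz => hst z (hoff z hz)⟩
        · rintro t ⟨ht, e⟩
          obtain ⟨s, hs, hst⟩ := hY.2 t ht
          exact ⟨s, ⟨hs, t, ht, hst, e⟩, fun z hz => hst z (hoff z hz)⟩
        · intro ψ hψ
          obtain ⟨⟨us, vs⟩, hmem, rfl⟩ := List.mem_map.1 hψ
          rintro t ⟨ht, e⟩
          obtain ⟨r, hr, e'⟩ := hinc _ (List.mem_map.2 ⟨_, hmem, rfl⟩) t ht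
          simp only [List.map_append] at e'
          obtain ⟨e₁, e₂⟩ := List.append_inj e' (by simpa using (hps _ hmem).1)
          simp only [List.map_cons, List.map_nil, List.cons.injEq, and_true] at e₂
          -- The witness has the same values at `p` and `q`, hence lies in the same subteam.
          exact ⟨r, ⟨hr, by rw [← e₂.1, ← e₂.2, e]⟩, e₁⟩
      · refine (sat_congr ⟨?_, fun t ht => ?_⟩).2 h₂
        · rintro s ⟨hs, t, ht, hst⟩
          exact ⟨t, ht, fun z hz => hst z (hφ' z hz)⟩
        · obtain ⟨s, hs, hst⟩ := hY.2 t (.inr ht)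
          exact ⟨s, ⟨hs, t, ht, hst⟩, fun z hz => hst z (hφ' z hz)⟩
  fv_subset := by
    intro z hz
    simp only [mem_fv_exs, fv, iff, imp, veq, Term.varFinset, Finset.mem_union, mem_fv_conj,
      List.mem_append, List.mem_cons, List.not_mem_nil, or_false, not_or,
      Finset.mem_singleton] at hz ⊢
    obtain ⟨hz, hzx, hzp, hzq⟩ := hz
    have hz' : (∃ ψ ∈ ps.map fun a => (inc (a.1 ++ [p, q]) (a.2 ++ [p, q]) : Form L), z ∈ ψ.fv) ∨
        z ∈ α.fv ∨ z ∈ φ.fv := by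
      rcases hz with h | ((h | h | h) | (h | h) | h) | h | h
      exacts [.inl h, .inr (.inl h), absurd h hzp, absurd h hzq, absurd h hzp, absurd h hzq,
        .inr (.inl h), .inr (.inl h), .inr (.inr h)]
    rcases hz' with ⟨ψ, hψ, hz⟩ | hz | hz
    · obtain ⟨a, hmem, rfl⟩ := List.mem_map.1 hψ
      simp only [fv, Finset.mem_union, List.mem_toFinset, List.mem_append, List.mem_cons,
        List.not_mem_nil, or_false] at hz
      refine .inl ⟨.inl ⟨_, List.mem_map.2 ⟨a, hmem, rfl⟩, ?_⟩, hzx⟩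
      simp only [fv, Finset.mem_union, List.mem_toFinset]
      tauto
    · exact .inl ⟨.inr hz, hzx⟩
    · exact .inr hz

/-- Fresh existentially quantified copies of variables. -/
theorem ex_copy {xs : List ℕ} {f : ℕ → ℕ} {ψ : Form L} (hn : xs.Nodup)
    (hf : ∀ x ∈ xs, f x ∉ xs ∧ f x ∉ ψ.bv) (hf' : ∀ z ∉ xs, f z = z)
    (ha : Admissible (fun z => .var (f z)) ψ) (hw : ψ.WF)
    (hfv : ∀ x ∈ xs, f x ∈ (subst (fun z => .var (f z)) ψ).fv)
    (hfv' : ∀ z ∈ ψ.fv, z ∉ xs → z ∈ (subst (fun z => .var (f z)) ψ).fv) :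
    Red.{u, v, w} (subst (fun z => .var (f z)) ψ)
      (exs xs (and (conj (xs.map fun x => veq x (f x))) ψ)) where
  deriv Γ hd := by
    have hbv : (conj (xs.map fun x => veq x (f x)) : Form L).bv = ∅ := by
      have : ∀ l : List ℕ, (conj (l.map fun x => veq x (f x)) : Form L).bv = ∅ := by
        intro l
        induction l with
        | nil => rfl
        | cons x l ih =>
          cases l with
          | nil => rfl
          | cons y l =>
            have e : (conj ((x :: y :: l).map fun x => veq x (f x)) : Form L).bv =
              ∅ ∪ (conj ((y :: l).map fun x => veq x (f x)) : Form L).bv := rfl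
            rw [e, ih, Finset.empty_union]
      exact this xs
    refine Deriv.exsI ⟨wf_conj.2 ?_, hw⟩ hn (f := f) ?_ hf' (Deriv.andI ?_ hd)
    · intro φ hφ
      obtain ⟨x, -, rfl⟩ := List.mem_map.1 hφ
      trivial
    · intro x hx
      refine ⟨(hf x hx).1, ?_⟩
      rw [bv, hbv, Finset.empty_union]
      exact (hf x hx).2
    · rw [subst_conj, Deriv.conj_iff]
      simp only [List.map_map, List.mem_map, Function.comp]
      rintro _ ⟨x, hx, rfl⟩
      simp only [subst, veq, Term.subst, hf' _ (hf x hx).1]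
      exact Deriv.eqI _
  sem M _ _ X := by
    rw [sat_exs]
    constructor
    · intro h
      refine ⟨(fun (s : ℕ → M) z => s (f z)) '' X, ⟨?_, ?_⟩, sat_conj.2 ?_, (sat_subst ha ⟨?_, ?_⟩).1 h⟩
      · exact fun s hs => ⟨_, ⟨s, hs, rfl⟩, fun z hz => by simp only [hf' z hz]⟩
      · rintro _ ⟨s, hs, rfl⟩
        exact ⟨s, hs, fun z hz => by simp only [hf' z hz]⟩
      · intro φ hφ
        obtain ⟨x, hx, rfl⟩ := List.mem_map.1 hφ
        rintro _ ⟨s, hs, rfl⟩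
        simp only [Term.realize_var, hf' _ (hf x hx).1]
      · exact fun s hs => ⟨_, ⟨s, hs, rfl⟩, fun z hz => rfl⟩
      · rintro _ ⟨s, hs, rfl⟩
        exact ⟨s, hs, fun z hz => rfl⟩
    · rintro ⟨Y, hY, heq, h⟩
      rw [sat_conj] at heq
      have key : ∀ s : ℕ → M, ∀ t ∈ Y, (∀ z ∉ xs, s z = t z) → ∀ z, s (f z) = t z := by
        intro s t ht hst z
        by_cases hz : z ∈ xs
        · have : t z = t (f z) := heq _ (List.mem_map.2 ⟨z, hz, rfl⟩) t ht
          rw [this, hst _ (hf z hz).1]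
        · rw [hf' z hz, hst z hz]
      refine (sat_subst ha ⟨fun s hs => ?_, fun t ht => ?_⟩).2 h
      · obtain ⟨t, ht, hst⟩ := hY.1 s hs
        exact ⟨t, ht, fun z _ => key s t ht hst z⟩
      · obtain ⟨s, hs, hst⟩ := hY.2 t ht
        exact ⟨s, hs, fun z _ => key s t ht hst z⟩
  fv_subset := by
    intro z hz
    simp only [mem_fv_exs, fv, Finset.mem_union, mem_fv_conj, List.mem_map] at hz
    obtain ⟨⟨_, ⟨x, hx, rfl⟩, hz⟩ | hz, hzx⟩ := hz
    · simp only [veq, fv, Term.varFinset, Finset.mem_union, Finset.mem_singleton] at hz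
      rcases hz with rfl | rfl
      · exact absurd hx hzx
      · exact hfv x hx
    · exact hfv' z hz hzx

end Red

end IncLogic

/-! ### Existential normal form with inclusion atoms -/

namespace IncLogic

open Language

variable {L : FirstOrder.Language.{u, v}}

namespace Form

/-- Quantifier-free first-order formulas. -/
def IsQF : Form L → Prop
  | bot => True
  | eq _ _ => True
  | rel _ _ => True
  | inc _ _ => False
  | neg φ => φ.IsQF
  | and φ ψ => φ.IsQF ∧ ψ.IsQF
  | or φ ψ => φ.IsQF ∧ ψ.IsQF
  | ex _ _ => False
  | all _ _ => False

theorem IsQF.isFO {φ : Form L} (h : φ.IsQF) : φ.IsFO := by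
  induction φ with
  | bot | eq | rel => trivial
  | inc => exact h
  | neg φ ih => exact ih h
  | and φ ψ ih ih' => exact ⟨ih h.1, ih' h.2⟩
  | or φ ψ ih ih' => exact ⟨ih h.1, ih' h.2⟩
  | ex | all => exact h.elim

theorem IsQF.subst {φ : Form L} (σ : ℕ → L.Term ℕ) (h : φ.IsQF) : (subst σ φ).IsQF := by
  induction φ with
  | bot | eq | rel => trivial
  | inc => exact h
  | neg φ ih => exact ih h
  | and φ ψ ih ih' => exact ⟨ih h.1, ih' h.2⟩
  | or φ ψ ih ih' => exact ⟨ih h.1, ih' h.2⟩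
  | ex | all => exact h.elim

theorem isQF_conj {l : List (Form L)} (h : ∀ φ ∈ l, φ.IsQF) : (conj l).IsQF := by
  induction l with
  | nil => trivial
  | cons φ l ih =>
    cases l with
    | nil => exact h φ (by simp)
    | cons ψ l =>
      exact ⟨h φ (by simp), ih fun χ hχ => h χ (List.mem_cons_of_mem _ hχ)⟩

theorem isQF_iff_veq {φ : Form L} (h : φ.IsQF) (p q : ℕ) : (iff φ (veq p q)).IsQF :=
  ⟨⟨h, trivial⟩, trivial, h⟩

theorem subst_single_exs {x : ℕ} {t : L.Term ℕ} {l : List ℕ} (φ : Form L) (h : x ∉ l) :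
    subst (single x t) (exs l φ) = exs l (subst (single x t) φ) := by
  induction l with
  | nil => rfl
  | cons z l ih =>
    simp only [List.mem_cons, not_or] at h
    have : Function.update (single x t) z (.var z) = single x t := by
      refine Function.update_eq_self_iff.2 ?_
      simp [single, Ne.symm h.1]
    rw [exs_cons, subst, this, ih h.2, exs_cons]

/-- Freshness is managed by bounds: all variables from `N` on lie outside `s`. -/
theorem exists_lt (s : Finset ℕ) (B : ℕ) : ∃ N, B ≤ N ∧ ∀ z ∈ s, z < N :=
  ⟨max B (s.sup id + 1), le_max_left _ _, fun _ hz =>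
    lt_max_of_lt_right (Nat.lt_succ_of_le (Finset.le_sup (f := id) hz))⟩

/-- The inclusion atoms given by a list of pairs of sequences. -/
def incs (ps : List (List ℕ × List ℕ)) : List (Form L) := ps.map fun a => inc a.1 a.2

theorem incs_append (ps qs : List (List ℕ × List ℕ)) :
    (incs (ps ++ qs) : List (Form L)) = incs ps ++ incs qs := List.map_append

/-- The pairs consist of sequences of distinct variables from `xs`, of the same length. -/
def Pairs (xs : List ℕ) (ps : List (List ℕ × List ℕ)) : Prop :=
  ∀ a ∈ ps, a.1.length = a.2.length ∧ a.1.Nodup ∧ a.2.Nodup ∧ a.1 ⊆ xs ∧ a.2 ⊆ xs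

theorem Pairs.append {xs ys : List ℕ} {ps qs : List (List ℕ × List ℕ)} (h : Pairs xs ps)
    (h' : Pairs ys qs) : Pairs (xs ++ ys) (ps ++ qs) := by
  intro a ha
  rcases List.mem_append.1 ha with ha | ha
  · obtain ⟨h1, h2, h3, h4, h5⟩ := h a ha
    exact ⟨h1, h2, h3, fun z hz => List.mem_append_left _ (h4 hz),
      fun z hz => List.mem_append_left _ (h5 hz)⟩
  · obtain ⟨h1, h2, h3, h4, h5⟩ := h' a ha
    exact ⟨h1, h2, h3, fun z hz => List.mem_append_right _ (h4 hz),
      fun z hz => List.mem_append_right _ (h5 hz)⟩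

theorem Pairs.cons {xs : List ℕ} {ps : List (List ℕ × List ℕ)} (h : Pairs xs ps) (x : ℕ) :
    Pairs (x :: xs) ps :=
  Pairs.append (xs := [x]) (ps := []) (by simp [Pairs]) h

theorem Pairs.extend {xs : List ℕ} {ps : List (List ℕ × List ℕ)} (h : Pairs xs ps) {p q : ℕ}
    (hpq : p ≠ q) (hp : p ∉ xs) (hq : q ∉ xs) :
    Pairs (xs ++ [p, q]) (ps.map fun a => (a.1 ++ [p, q], a.2 ++ [p, q])) := by
  have hn : ∀ l : List ℕ, l.Nodup → l ⊆ xs → (l ++ [p, q]).Nodup := by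
    intro l hl hlx
    refine hl.append (by simpa using hpq) fun z hz hz' => ?_
    simp only [List.mem_cons, List.not_mem_nil, or_false] at hz'
    rcases hz' with rfl | rfl
    · exact hp (hlx hz)
    · exact hq (hlx hz)
  intro b hb
  obtain ⟨a, ha, rfl⟩ := List.mem_map.1 hb
  obtain ⟨h1, h2, h3, h4, h5⟩ := h a ha
  exact ⟨by simp [h1], hn _ h2 h4, hn _ h3 h5, List.append_subset.2
    ⟨fun z hz => List.mem_append_left _ (h4 hz), List.subset_append_right _ _⟩,
    List.append_subset.2
    ⟨fun z hz => List.mem_append_left _ (h5 hz), List.subset_append_right _ _⟩⟩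

theorem Pairs.fv_subset {xs : List ℕ} {ps : List (List ℕ × List ℕ)} (h : Pairs xs ps) {z : ℕ}
    (hz : z ∈ (conj (incs ps) : Form L).fv) : z ∈ xs := by
  obtain ⟨φ, hφ, hz⟩ := mem_fv_conj.1 hz
  obtain ⟨a, ha, rfl⟩ := List.mem_map.1 hφ
  simp only [fv, Finset.mem_union, List.mem_toFinset] at hz
  exact hz.elim (fun hz => (h a ha).2.2.2.1 hz) (fun hz => (h a ha).2.2.2.2 hz)

/-- A fresh copy of a sequence of variables. -/
theorem exists_copy (us : List ℕ) (N : ℕ) : ∃ (xs : List ℕ) (f : ℕ → ℕ), xs.Nodup ∧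
    xs.map f = us ∧ (∀ x ∈ xs, N ≤ x) ∧ ∀ z ∉ xs, f z = z := by
  induction us generalizing N with
  | nil => exact ⟨[], id, by simp⟩
  | cons u us ih =>
    obtain ⟨xs, f, hn, hm, hN, hf⟩ := ih (N + 1)
    have hx : N ∉ xs := fun h => absurd (hN N h) (by simp)
    refine ⟨N :: xs, Function.update f N u, List.nodup_cons.2 ⟨hx, hn⟩, ?_, ?_, ?_⟩
    · rw [List.map_cons, Function.update_self, ← hm]
      congr 1
      refine List.map_congr_left fun z hz => Function.update_of_ne ?_ _ _
      rintro rfl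
      exact hx hz
    · exact List.forall_mem_cons.2 ⟨le_rfl, fun x h => (Nat.le_succ N).trans (hN x h)⟩
    · intro z hz
      simp only [List.mem_cons, not_or] at hz
      rw [Function.update_of_ne hz.1, hf z hz.2]

end Form

open Form

theorem Red.conj_and_conj_and (l l' : List (Form L)) (α α' : Form L) :
    Red.{u, v, w} (and (and (conj l) α) (and (conj l') α'))
      (and (conj (l ++ l')) (and α α')) where
  deriv Γ := by
    simp only [Deriv.and_iff, Deriv.conj_iff, List.forall_mem_append]
    tauto
  sem M _ _ X := by
    simp only [Sat, sat_conj, List.forall_mem_append]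
    tauto
  fv_subset := by
    intro z
    simp only [fv, Finset.mem_union, mem_fv_conj, List.mem_append, or_and_right, exists_or]
    rintro ((h | h) | h | h)
    exacts [.inl (.inl h), .inr (.inl h), .inl (.inr h), .inr (.inr h)]

theorem Red.top_and (φ : Form L) : Red.{u, v, w} φ (and top φ) where
  deriv Γ h := (Deriv.topI Γ).andI h
  sem M _ _ X := by simp [Sat, top, Holds]
  fv_subset := by simp [fv, top]

theorem Red.exs_and_exs {xs ys : List ℕ} {φ ψ : Form L} (hx : ∀ x ∈ xs, x ∉ (exs ys ψ).fv)
    (hy : ∀ y ∈ ys, y ∉ φ.fv) :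
    Red.{u, v, w} (and (exs xs φ) (exs ys ψ)) (exs (xs ++ ys) (and φ ψ)) := by
  rw [exs_append]
  exact (exs_and hx).trans (exs_congr xs (and_exs hy))

theorem Red.ex_pull {x x' : ℕ} {l : List ℕ} {φ : Form L} (hx : x ∉ l)
    (hx' : x' ∉ (exs l φ).vars) :
    Red.{u, v, w} (ex x (exs l φ)) (exs (x' :: l) (subst (single x (.var x')) φ)) := by
  rw [exs_cons, ← subst_single_exs φ hx]
  exact ex_rename hx'

theorem Form.Pairs.subst_incs {xs : List ℕ} {ps : List (List ℕ × List ℕ)} (h : Pairs xs ps) {x : ℕ}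
    {t : L.Term ℕ} (hx : x ∉ xs) :
    Form.subst (single x t) (conj (incs ps)) = (conj (incs ps) : Form L) := by
  refine subst_eq_self fun z hz => ?_
  have : z ≠ x := fun e => hx (e ▸ h.fv_subset hz)
  simp [single, this]

/-- `∃xs (⋀ us ⊆ vs ∧ α)` with sequences of variables from `xs`. -/
def Form.eForm (xs : List ℕ) (ps : List (List ℕ × List ℕ)) (α : Form L) : Form L :=
  exs xs (and (conj (incs ps)) α)

/-- The formula reduces to the form `∃xs (⋀ us ⊆ vs ∧ α)` with `α` quantifier-free and arbitrarily
large bound variables. -/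
def Eable (φ : Form L) : Prop :=
  ∀ B : ℕ, ∃ (xs : List ℕ) (ps : List (List ℕ × List ℕ)) (α : Form L), xs.Nodup ∧ Pairs xs ps ∧
    α.IsQF ∧ (∀ x ∈ xs, B ≤ x) ∧ Red.{u, v, w} φ (eForm xs ps α)

namespace Eable

theorem of_red {φ ψ : Form L} (h : Red.{u, v, w} φ ψ) (hψ : Eable.{u, v, w} ψ) :
    Eable.{u, v, w} φ := fun B =>
  have ⟨xs, ps, α, h1, h2, h3, h4, h5⟩ := hψ B
  ⟨xs, ps, α, h1, h2, h3, h4, h.trans h5⟩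

theorem of_isQF {α : Form L} (h : α.IsQF) : Eable.{u, v, w} α := fun _ =>
  ⟨[], [], α, by simp, by simp [Pairs], h, by simp, Red.top_and α⟩

theorem and {φ ψ : Form L} (hφ : Eable.{u, v, w} φ) (hψ : Eable.{u, v, w} ψ) :
    Eable.{u, v, w} (and φ ψ) := by
  intro B
  -- The bound variables of the first form are placed above the free variables of `ψ`, those of the
  -- second form above all variables of the first.
  obtain ⟨B₁, hB₁, hψB⟩ := exists_lt ψ.fv B
  obtain ⟨xs, ps, α, hn, hps, hα, hB, hr⟩ := hφ B₁
  obtain ⟨B₂, hB₂, hxB⟩ := exists_lt (xs.toFinset ∪ (eForm xs ps α).vars) B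
  obtain ⟨ys, qs, β, hn', hqs, hβ, hB', hr'⟩ := hψ B₂
  simp only [Finset.mem_union, List.mem_toFinset] at hxB
  refine ⟨xs ++ ys, ps ++ qs, .and α β, hn.append hn' fun z hz hz' =>
    absurd (hxB z (.inl hz)) (hB' z hz').not_gt, hps.append hqs, ⟨hα, hβ⟩, ?_,
    (hr.and_congr hr').trans ((Red.exs_and_exs ?_ ?_).trans (Red.exs_congr _ ?_))⟩
  · intro z hz
    rcases List.mem_append.1 hz with hz | hz
    · exact hB₁.trans (hB z hz)
    · exact hB₂.trans (hB' z hz)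
  · exact fun z hz hz' => absurd (hψB z (hr'.fv_subset hz')) (hB z hz).not_gt
  · intro z hz hz'
    exact absurd (hxB z (.inr (mem_vars_exs.2 (.inl (fv_subset_vars _ hz'))))) (hB' z hz).not_gt
  · rw [incs_append]
    exact Red.conj_and_conj_and _ _ _ _

theorem ex {φ : Form L} (x : ℕ) (hφ : Eable.{u, v, w} φ) : Eable.{u, v, w} (ex x φ) := by
  intro B
  -- With all of `xs` above `x` the atoms do not contain `x`, so renaming `x` to a large variable
  -- changes `α` only.
  obtain ⟨xs, ps, α, hn, hps, hα, hB, hr⟩ := hφ (max B (x + 1))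
  have hx : x ∉ xs := fun h => by have := hB x h; omega
  obtain ⟨x', hx', hx'B⟩ := exists_lt (xs.toFinset ∪ (eForm xs ps α).vars) B
  simp only [Finset.mem_union, List.mem_toFinset] at hx'B
  refine ⟨x' :: xs, ps, subst (single x (.var x')) α,
    List.nodup_cons.2 ⟨fun h => (hx'B x' (.inl h)).false, hn⟩, hps.cons x', hα.subst _,
    List.forall_mem_cons.2 ⟨hx', fun z hz => (le_max_left _ _).trans (hB z hz)⟩,
    (hr.ex_congr x).trans ?_⟩
  have := Red.ex_pull.{u, v, w} (φ := .and (conj (incs ps)) α) hx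
    (fun h => (hx'B x' (.inr h)).false)
  rwa [subst, hps.subst_incs hx] at this

theorem exs {φ : Form L} (xs : List ℕ) (hφ : Eable.{u, v, w} φ) : Eable.{u, v, w} (exs xs φ) := by
  induction xs with
  | nil => exact hφ
  | cons x xs ih => exact ih.ex x

theorem conj {l : List (Form L)} (h : ∀ φ ∈ l, Eable.{u, v, w} φ) :
    Eable.{u, v, w} (conj l) := by
  induction l with
  | nil => exact of_isQF trivial
  | cons φ l ih =>
    cases l with
    | nil => exact h φ (by simp)
    | cons ψ l => exact (h φ (by simp)).and (ih fun χ hχ => h χ (List.mem_cons_of_mem _ hχ))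

/-- Every occurrence of a variable gets a fresh copy of its own, which makes the sequences
repetition-free; the equations with the originals form the quantifier-free part. -/
theorem inc {us vs : List ℕ} (h : us.length = vs.length) :
    Eable.{u, v, w} (inc us vs : Form L) := by
  intro B
  obtain ⟨N, hN, hus⟩ := exists_lt (us ++ vs).toFinset B
  obtain ⟨xs, f, hn, hm, hxN, hf⟩ := exists_copy (us ++ vs) N
  obtain ⟨as, bs, rfl, ha, hb⟩ := List.map_eq_append_iff.1 hm
  have hfx : ∀ x ∈ as ++ bs, f x ∈ us ++ vs := fun x hx => hm ▸ List.mem_map_of_mem hx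
  have hvar : (varSub fun z => (.var (f z) : L.Term ℕ)) = f := rfl
  have hs : subst (fun z => .var (f z)) (.inc as bs) = (.inc us vs : Form L) := by
    rw [subst, hvar, ha, hb]
  have hl : as.length = bs.length := by
    rw [← List.length_map (f := f), ha, h, ← hb, List.length_map]
  refine ⟨as ++ bs, [(as, bs)], Form.conj ((as ++ bs).map fun x => veq x (f x)), hn, ?_,
    isQF_conj ?_, fun z hz => hN.trans (hxN z hz), ?_⟩
  · intro a ha
    obtain rfl := List.mem_singleton.1 ha
    exact ⟨hl, hn.of_append_left, hn.of_append_right, List.subset_append_left _ _,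
      List.subset_append_right _ _⟩
  · intro φ hφ
    obtain ⟨x, -, rfl⟩ := List.mem_map.1 hφ
    trivial
  · have := Red.ex_copy.{u, v, w} (L := L) (ψ := .inc as bs) hn (f := f) (fun x hx => ⟨fun h' =>
      absurd (hus _ (List.mem_toFinset.2 (hfx x hx))) (hxN _ h').not_gt, by simp [bv]⟩) hf
      (fun x _ => ⟨_, rfl⟩) hl ?_ ?_
    · rw [hs] at this
      exact this.trans (Red.exs_congr _ (Red.and_comm _ _))
    · intro x hx
      rw [hs]
      simpa [fv] using hfx x hx
    · intro z hz hz'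
      exact absurd (by simpa [fv] using hz) hz'

/-- The result of the rule for disjunctions of `∃xs (⋀ us ⊆ vs ∧ α)` with another formula. -/
theorem exists_red_or {φ ψ : Form L} (hφ : Eable.{u, v, w} φ) (B : ℕ) :
    ∃ (xs : List ℕ) (ps : List (List ℕ × List ℕ)) (α β : Form L), xs.Nodup ∧ Pairs xs ps ∧
      α.IsQF ∧ β.IsQF ∧ (∀ x ∈ xs, B ≤ x) ∧
      Red.{u, v, w} (or φ ψ) (eForm xs ps (.and β (or α ψ))) := by
  obtain ⟨B₁, hB₁, hψB⟩ := exists_lt ψ.fv B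
  obtain ⟨xs, ps, α, hn, hps, hα, hB, hr⟩ := hφ B₁
  obtain ⟨p, hp, hpx⟩ := exists_lt (xs.toFinset ∪ α.vars ∪ ψ.vars) B
  have hp' : p ∉ xs.toFinset ∪ α.vars ∪ ψ.vars := fun h => (hpx p h).false
  have hq' : p + 1 ∉ xs.toFinset ∪ α.vars ∪ ψ.vars := fun h =>
    absurd (hpx _ h) (Nat.lt_succ_self p).not_gt
  have hpx' : p ∉ xs := fun h => hp' (by simp [h])
  have hqx' : p + 1 ∉ xs := fun h => hq' (by simp [h])
  refine ⟨xs ++ [p, p + 1], ps.map fun a => (a.1 ++ [p, p + 1], a.2 ++ [p, p + 1]), α,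
    iff α (veq p (p + 1)), hn.append (by simp) ?_, hps.extend (by simp) hpx' hqx', hα,
    isQF_iff_veq hα _ _, ?_, (hr.or_congr (Red.refl ψ)).trans ?_⟩
  · intro z hz hz'
    simp only [List.mem_cons, List.not_mem_nil, or_false] at hz'
    rcases hz' with rfl | rfl
    · exact hpx' hz
    · exact hqx' hz
  · intro z hz
    simp only [List.mem_append, List.mem_cons, List.not_mem_nil, or_false] at hz
    rcases hz with hz | rfl | rfl
    · exact hB₁.trans (hB z hz)
    · exact hp
    · exact hp.trans (Nat.le_succ p)
  · have := Red.ex_inc.{u, v, w} hα.isFO hn hps (φ := ψ)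
      (fun x hx hx' => absurd (hψB x hx') (hB x hx).not_gt) (Nat.succ_ne_self p).symm hp' hq'
    simpa only [eForm, incs, List.map_map, Function.comp_def] using this

theorem or_isQF {φ β : Form L} (hφ : Eable.{u, v, w} φ) (hβ : β.IsQF) :
    Eable.{u, v, w} (or φ β) := fun B =>
  have ⟨xs, ps, α, γ, h1, h2, hα, hγ, h3, h4⟩ := hφ.exists_red_or (ψ := β) B
  ⟨xs, ps, .and γ (.or α β), h1, h2, ⟨hγ, hα, hβ⟩, h3, h4⟩

/-- The rule is applied twice: first it leaves the disjunction `α ∨ ψ` with `α` quantifier-free, and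
then, with `ψ` on the left, a disjunction of quantifier-free formulas. -/
theorem or {φ ψ : Form L} (hφ : Eable.{u, v, w} φ) (hψ : Eable.{u, v, w} ψ) :
    Eable.{u, v, w} (or φ ψ) := by
  obtain ⟨xs, ps, α, γ, -, hps, hα, hγ, -, hr⟩ := hφ.exists_red_or (ψ := ψ) 0
  refine of_red hr (exs xs ((conj fun χ hχ => ?_).and
    ((of_isQF hγ).and (of_red (Red.or_comm _ _) (hψ.or_isQF hα)))))
  obtain ⟨a, ha, rfl⟩ := List.mem_map.1 hχ
  exact inc (hps a ha).1

end Eable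

end IncLogic

/-! ### Normal form with one universal quantifier -/

namespace IncLogic

open Language Form

variable {L : FirstOrder.Language.{u, v}}

/-- The inclusion atoms `us y ⊆ vs` given by a list of pairs of sequences. -/
def Form.incsWith (y : ℕ) (ps : List (List ℕ × List ℕ)) : List (Form L) :=
  ps.map fun a => inc (a.1 ++ [y]) a.2

theorem Form.incsWith_append (y : ℕ) (ps qs : List (List ℕ × List ℕ)) :
    (incsWith y (ps ++ qs) : List (Form L)) = incsWith y ps ++ incsWith y qs := List.map_append

/-- The pairs consist of sequences of distinct variables from `xs`, the second one being longer
by one. -/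
def Form.SuccPairs (xs : List ℕ) (ps : List (List ℕ × List ℕ)) : Prop :=
  ∀ a ∈ ps, a.2.length = a.1.length + 1 ∧ a.1.Nodup ∧ a.2.Nodup ∧ a.1 ⊆ xs ∧ a.2 ⊆ xs

theorem Form.SuccPairs.append {xs ys : List ℕ} {ps qs : List (List ℕ × List ℕ)}
    (h : SuccPairs xs ps) (h' : SuccPairs ys qs) : SuccPairs (xs ++ ys) (ps ++ qs) := by
  intro a ha
  rcases List.mem_append.1 ha with ha | ha
  · obtain ⟨h1, h2, h3, h4, h5⟩ := h a ha
    exact ⟨h1, h2, h3, fun z hz => List.mem_append_left _ (h4 hz),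
      fun z hz => List.mem_append_left _ (h5 hz)⟩
  · obtain ⟨h1, h2, h3, h4, h5⟩ := h' a ha
    exact ⟨h1, h2, h3, fun z hz => List.mem_append_right _ (h4 hz),
      fun z hz => List.mem_append_right _ (h5 hz)⟩

theorem Form.SuccPairs.fv_subset {xs : List ℕ} {y : ℕ} {ps : List (List ℕ × List ℕ)}
    (h : SuccPairs xs ps) {z : ℕ} (hz : z ∈ (conj (incsWith y ps) : Form L).fv) :
    z ∈ xs ∨ z = y := by
  obtain ⟨φ, hφ, hz⟩ := mem_fv_conj.1 hz
  obtain ⟨a, ha, rfl⟩ := List.mem_map.1 hφ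
  simp only [fv, Finset.mem_union, List.mem_toFinset, List.mem_append, List.mem_singleton] at hz
  obtain ⟨-, -, -, h4, h5⟩ := h a ha
  rcases hz with (hz | hz) | hz
  exacts [.inl (h4 hz), .inr hz, .inl (h5 hz)]

/-- `∃ws ∃xs ∀y (⋀ us ⊆ vs ∧ ⋀ us' y ⊆ vs' ∧ α)` with sequences of variables from `ws` and `xs`,
respectively. -/
def Form.gForm (ws xs : List ℕ) (y : ℕ) (ps qs : List (List ℕ × List ℕ)) (α : Form L) : Form L :=
  exs ws (exs xs (all y (and (conj (incs ps)) (and (conj (incsWith y qs)) α))))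

/-- The conditions for `gForm` to be in normal form, apart from the condition on the free
variables. -/
structure Form.GOk (ws xs : List ℕ) (y : ℕ) (ps qs : List (List ℕ × List ℕ)) (α : Form L) :
    Prop where
  nodup : (ws ++ xs).Nodup
  notMem : y ∉ ws ++ xs
  notMem_fv : y ∉ α.fv
  pairs : Pairs ws ps
  succPairs : SuccPairs xs qs
  isQF : α.IsQF

/-- The formula reduces to the form `∃ws ∃xs ∀y (⋀ us ⊆ vs ∧ ⋀ us' y ⊆ vs' ∧ α)`, for all large `y`
and with arbitrarily large variables `ws` and `xs`. -/
def Gable (φ : Form L) : Prop :=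
  ∃ K : ℕ, ∀ y, K ≤ y → ∀ B : ℕ, ∃ (ws xs : List ℕ) (ps qs : List (List ℕ × List ℕ)) (α : Form L),
    GOk ws xs y ps qs α ∧ (∀ z ∈ ws ++ xs, B ≤ z) ∧ Red.{u, v, w} φ (gForm ws xs y ps qs α)

theorem Red.gForm_and (l l' m m' : List (Form L)) (α α' : Form L) :
    Red.{u, v, w} (and (and (conj l) (and (conj m) α)) (and (conj l') (and (conj m') α')))
      (and (conj (l ++ l')) (and (conj (m ++ m')) (and α α'))) where
  deriv Γ := by
    simp only [Deriv.and_iff, Deriv.conj_iff, List.forall_mem_append]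
    tauto
  sem M _ _ X := by
    simp only [Sat, sat_conj, List.forall_mem_append]
    tauto
  fv_subset := by
    intro z
    simp only [fv, Finset.mem_union, mem_fv_conj, List.mem_append, or_and_right, exists_or]
    rintro ((h | h) | (h | h) | h | h)
    exacts [.inl (.inl h), .inr (.inl h), .inl (.inr (.inl h)), .inr (.inr (.inl h)),
      .inl (.inr (.inr h)), .inr (.inr (.inr h))]

namespace Gable

theorem of_red {φ ψ : Form L} (h : Red.{u, v, w} φ ψ) (hψ : Gable.{u, v, w} ψ) :
    Gable.{u, v, w} φ :=
  have ⟨K, hK⟩ := hψ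
  ⟨K, fun y hy B =>
    have ⟨ws, xs, ps, qs, α, h1, h2, h3⟩ := hK y hy B
    ⟨ws, xs, ps, qs, α, h1, h2, h.trans h3⟩⟩

/-- The universal quantifier is vacuous; `K` exceeds the free variables of `φ`, which may occur in
`α`. -/
theorem of_eable {φ : Form L} (h : Eable.{u, v, w} φ) : Gable.{u, v, w} φ := by
  obtain ⟨K, -, hK⟩ := exists_lt φ.fv 0
  refine ⟨K, fun y hy B => ?_⟩
  obtain ⟨xs, ps, α, hn, hps, hα, hB, hr⟩ := h (max B (y + 1))
  have hyx : y ∉ xs := fun h => by have := hB y h; omega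
  have hyα : y ∉ α.fv := by
    intro h
    have := hK y (hr.fv_subset (mem_fv_exs.2 ⟨Finset.mem_union_right _ h, hyx⟩))
    omega
  refine ⟨xs, [], ps, [], α, ⟨by simpa using hn, by simpa using hyx, hyα, hps, by simp [SuccPairs],
    hα⟩, fun z hz => (le_max_left _ _).trans (hB z (by simpa using hz)), hr.trans
    (Red.exs_congr _ ((Red.and_congr (Red.refl _) (Red.top_and α)).trans (Red.all_vacuous ?_)))⟩
  simp only [fv, Finset.mem_union, not_or]
  exact ⟨fun h => hyx (hps.fv_subset h), by simp [fv, top], hyα⟩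

theorem ex {φ : Form L} (x : ℕ) (hφ : Gable.{u, v, w} φ) : Gable.{u, v, w} (ex x φ) := by
  obtain ⟨K, hK⟩ := hφ
  refine ⟨max K (x + 1), fun y hy B => ?_⟩
  obtain ⟨ws, xs, ps, qs, α, ⟨hn, hyx, hyα, hps, hqs, hα⟩, hB, hr⟩ :=
    hK y (le_trans (le_max_left _ _) hy) (max B (x + 1))
  have hxy : x ≠ y := by
    have := le_trans (le_max_right _ _) hy
    omega
  have hx : x ∉ ws ++ xs := fun h => by have := hB x h; omega
  obtain ⟨x', hx', hx'B⟩ :=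
    exists_lt (insert y ((ws ++ xs).toFinset ∪ (gForm ws xs y ps qs α).vars)) B
  simp only [Finset.mem_insert, Finset.mem_union, List.mem_toFinset] at hx'B
  have hx'α : x' ∉ α.vars := fun h => (hx'B x' (.inr (.inr
    (mem_vars_exs.2 (.inl (mem_vars_exs.2 (.inl (by simp [vars, h])))))))).false
  refine ⟨x' :: ws, xs, ps, qs, subst (single x (.var x')) α, ⟨?_, ?_, ?_, hps.cons x', hqs,
    hα.subst _⟩, ?_, (hr.ex_congr x).trans ?_⟩
  · exact List.nodup_cons.2 ⟨fun h => (hx'B x' (.inr (.inl h))).false, hn⟩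
  · rw [List.cons_append, List.mem_cons, not_or]
    exact ⟨(hx'B y (.inl rfl)).ne, hyx⟩
  · intro h
    rcases Red.mem_fv_subst_single hx'α h with h | h
    · exact (hx'B y (.inl rfl)).ne h
    · exact hyα h.2
  · exact List.forall_mem_cons.2 ⟨hx', fun z hz => (le_max_left _ _).trans (hB z hz)⟩
  · simp only [List.mem_append, not_or] at hx
    have := Red.ex_pull.{u, v, w} (x' := x') (φ := Form.exs xs (all y (.and (conj (incs ps))
      (.and (conj (incsWith y qs)) α)))) hx.1 (fun h => (hx'B x' (.inr (.inr h))).false)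
    have hu : Function.update (single x (.var x') : ℕ → L.Term ℕ) y (.var y) =
        single x (.var x') :=
      Function.update_eq_self_iff.2 (by simp [single, Ne.symm hxy])
    have hq : subst (single x (.var x')) (conj (incsWith y qs)) =
        (conj (incsWith y qs) : Form L) := by
      refine subst_eq_self fun z hz => ?_
      have : z ≠ x := by
        rintro rfl
        exact (hqs.fv_subset hz).elim hx.2 hxy
      simp [single, this]
    rwa [subst_single_exs _ hx.2, subst, hu, subst, subst, hps.subst_incs hx.1, hq] at this

theorem exs {φ : Form L} (xs : List ℕ) (hφ : Gable.{u, v, w} φ) : Gable.{u, v, w} (exs xs φ) := by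
  induction xs with
  | nil => exact hφ
  | cons x xs ih => exact ih.ex x

/-- Both forms are taken with the same `y`, so that the two universal quantifiers merge; hence the
demand for all large `y` in the definition. -/
theorem and {φ ψ : Form L} (hφ : Gable.{u, v, w} φ) (hψ : Gable.{u, v, w} ψ) :
    Gable.{u, v, w} (and φ ψ) := by
  obtain ⟨K, hK⟩ := hφ
  obtain ⟨K', hK'⟩ := hψ
  refine ⟨max K K', fun y hy B => ?_⟩
  obtain ⟨B₁, hB₁, hψB⟩ := exists_lt ψ.fv B
  obtain ⟨ws, xs, ps, qs, α, ⟨hn, hyx, hyα, hps, hqs, hα⟩, hB, hr⟩ :=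
    hK y (le_trans (le_max_left _ _) hy) B₁
  obtain ⟨B₂, hB₂, hxB⟩ := exists_lt ((ws ++ xs).toFinset ∪ (gForm ws xs y ps qs α).vars) B
  obtain ⟨ws', xs', ps', qs', α', ⟨hn', hyx', hyα', hps', hqs', hα'⟩, hB', hr'⟩ :=
    hK' y (le_trans (le_max_right _ _) hy) B₂
  simp only [Finset.mem_union, List.mem_toFinset] at hxB
  have hperm : ((ws ++ ws') ++ (xs ++ xs')).Perm ((ws ++ xs) ++ (ws' ++ xs')) := by
    simp only [List.append_assoc]
    refine List.Perm.append_left _ ?_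
    rw [← List.append_assoc, ← List.append_assoc]
    exact List.perm_append_comm.append_right _
  have hfv : ∀ z ∈ ws ++ xs, z ∉ (gForm ws' xs' y ps' qs' α').fv := fun z hz hz' =>
    absurd (hψB z (hr'.fv_subset hz')) (hB z hz).not_gt
  have hvars : ∀ z ∈ ws' ++ xs', z ∉ (gForm ws xs y ps qs α).vars := fun z hz hz' =>
    absurd (hxB z (.inr hz')) (hB' z hz).not_gt
  have hd : ∀ z ∈ ws ++ xs, z ∉ ws' ++ xs' := fun z hz hz' =>
    absurd (hxB z (.inl hz)) (hB' z hz').not_gt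
  refine ⟨ws ++ ws', xs ++ xs', ps ++ ps', qs ++ qs', .and α α',
    ⟨hperm.nodup_iff.2 (hn.append hn' hd), ?_, ?_, hps.append hps', hqs.append hqs', hα, hα'⟩, ?_,
    (hr.and_congr hr').trans ((Red.exs_and_exs ?_ ?_).trans (Red.exs_congr _
      ((Red.exs_and_exs ?_ ?_).trans (Red.exs_congr _ ((Red.all_and_all _ _ _).trans
        (Red.all_congr _ ?_))))))⟩
  · rw [hperm.mem_iff, List.mem_append, not_or]
    exact ⟨hyx, hyx'⟩
  · simpa [fv] using ⟨hyα, hyα'⟩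
  · intro z hz
    rcases List.mem_append.1 (hperm.mem_iff.1 hz) with hz | hz
    · exact hB₁.trans (hB z hz)
    · exact hB₂.trans (hB' z hz)
  · exact fun z hz => hfv z (List.mem_append_left _ hz)
  · exact fun z hz hz' => hvars z (List.mem_append_left _ hz)
      (mem_vars_exs.2 (.inl (fv_subset_vars _ hz')))
  · refine fun z hz hz' => hfv z (List.mem_append_right _ hz) (mem_fv_exs.2 ⟨hz', fun hz'' => ?_⟩)
    exact hd z (List.mem_append_right _ hz) (List.mem_append_left _ hz'')
  · exact fun z hz hz' => hvars z (List.mem_append_right _ hz)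
      (mem_vars_exs.2 (.inl (mem_vars_exs.2 (.inl (fv_subset_vars _ hz')))))
  · rw [incs_append, incsWith_append]
    exact Red.gForm_and _ _ _ _ _ _

/-- Fresh copies of `zs` and `x` form the second block. Their equations with the originals do not
contain the quantified variable and move under its quantifier, next to a single atom in the copies.
-/
theorem all_inc {x y : ℕ} {zs : List ℕ} (hy : y ∉ zs ++ [x]) :
    Gable.{u, v, w} (all y (inc (zs ++ [y]) (zs ++ [x])) : Form L) := by
  obtain ⟨K, hyK, hK⟩ := exists_lt (zs ++ [x]).toFinset (y + 1)
  simp only [List.mem_toFinset] at hK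
  refine ⟨K, fun y' hy' B => ?_⟩
  have hy'z : y' ∉ zs ++ [x] := fun h => by have := hK _ h; omega
  -- The originals lie below `y'` and the copies above it, so the quantifier over `y'` captures
  -- neither.
  obtain ⟨xs, f, hxn, hm, hxN, hf⟩ := exists_copy (zs ++ [x]) (max B (y' + 1))
  obtain ⟨as, bs, rfl, ha, hb⟩ := List.map_eq_append_iff.1 hm
  obtain ⟨x', rfl, hb⟩ := List.map_eq_singleton_iff.1 hb
  have hfx : ∀ z ∈ as ++ [x'], f z ∈ zs ++ [x] := fun z hz => hm ▸ List.mem_map_of_mem hz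
  have hyx : y' ∉ as ++ [x'] := fun h => by have := hxN _ h; omega
  have hsub : subst (fun z => .var (f z)) (all y' (.inc (as ++ [y']) (as ++ [x']))) =
      (all y' (.inc (zs ++ [y']) (zs ++ [x])) : Form L) := by
    have hu : Function.update (fun z => (.var (f z) : L.Term ℕ)) y' (.var y') =
        fun z => .var (f z) := Function.update_eq_self_iff.2 (by rw [hf y' hyx])
    have hvar : (varSub fun z => (.var (f z) : L.Term ℕ)) = f := rfl
    rw [subst, hu, subst, hvar, hm, List.map_append, ha, List.map_singleton, hf y' hyx]
  have hren : Red.{u, v, w} (all y (.inc (zs ++ [y]) (zs ++ [x])) : Form L)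
      (all y' (.inc (zs ++ [y']) (zs ++ [x]))) := by
    have h := Red.all_rename.{u, v, w} (L := L) (x := y) (y := y')
      (φ := .inc (zs ++ [y]) (zs ++ [x])) ?_
    · have hz : ∀ l : List ℕ, y ∉ l → l.map (varSub (single y (.var y') : ℕ → L.Term ℕ)) = l := by
        intro l hl
        refine (List.map_congr_left fun z hz => ?_).trans (List.map_id l)
        have : z ≠ y := fun e => hl (e ▸ hz)
        simp [varSub, single, this]
      have hy0 : y ∉ zs := fun h => hy (by simp [h])
      rw [subst, hz _ hy, List.map_append, hz _ hy0] at h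
      simpa [varSub, single] using h
    · simp only [vars, Finset.mem_union, List.mem_toFinset, not_or]
      refine ⟨?_, hy'z⟩
      simp only [List.mem_append, List.mem_singleton, not_or] at hy'z ⊢
      exact ⟨hy'z.1, by omega⟩
  have heq : y' ∉ (conj ((as ++ [x']).map fun z => veq z (f z)) : Form L).fv := by
    intro h
    obtain ⟨φ, hφ, h⟩ := mem_fv_conj.1 h
    obtain ⟨z, hz, rfl⟩ := List.mem_map.1 hφ
    simp only [veq, fv, Term.varFinset, Finset.mem_union, Finset.mem_singleton] at h
    rcases h with h | h
    · exact hyx (h ▸ hz)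
    · exact hy'z (h ▸ hfx z hz)
  have hcopy := Red.ex_copy.{u, v, w} (L := L) (f := f)
    (ψ := all y' (.inc (as ++ [y']) (as ++ [x']))) hxn (fun z hz => ⟨fun h => ?_, ?_⟩) hf
    (admissible_of_notMem_bv ?_) ?_ ?_ ?_
  · rw [hsub] at hcopy
    refine ⟨[], as ++ [x'], [], [(as, as ++ [x'])],
      conj ((as ++ [x']).map fun z => veq z (f z)), ⟨by simpa using hxn, by simpa using hyx, ?_,
      by simp [Pairs], ?_, isQF_conj ?_⟩, fun z hz => (le_max_left _ _).trans (hxN z hz),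
      hren.trans (hcopy.trans (Red.exs_congr _ ((Red.and_comm _ _).trans
        ((Red.all_and ?_).trans (Red.all_congr _ (Red.top_and _))))))⟩
    · exact heq
    · intro a ha
      obtain rfl := List.mem_singleton.1 ha
      exact ⟨by simp, hxn.of_append_left, hxn, List.subset_append_left _ _, List.Subset.refl _⟩
    · intro φ hφ
      obtain ⟨z, -, rfl⟩ := List.mem_map.1 hφ
      trivial
    · exact heq
  · have := hK _ (hfx z hz)
    have := hxN _ h
    omega
  · have := hK _ (hfx z hz)
    simp only [bv, Finset.mem_insert, Finset.notMem_empty, or_false]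
    omega
  · intro z hz
    by_cases h : z ∈ as ++ [x']
    · refine .inr ⟨_, rfl, ?_⟩
      have := hK _ (hfx z h)
      simp only [bv, Finset.mem_insert, Finset.notMem_empty, or_false]
      omega
    · exact .inl (by rw [hf z h])
  · simp [WF]
  · intro z hz
    rw [hsub]
    have h := hfx z hz
    simp only [fv, Finset.mem_erase, Finset.mem_union, List.mem_toFinset]
    exact ⟨fun e => hy'z (e ▸ h), .inr h⟩
  · intro z hz hz'
    simp only [fv, Finset.mem_erase, Finset.mem_union, List.mem_toFinset, List.mem_append,
      List.mem_singleton] at hz hz'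
    tauto

/-- After the simulation rule the fresh variable `y` occurs in the inclusion atom only, so `φ`
leaves the scope of `∀y`, and the closure under conjunction and `∃x` applies. -/
theorem all {φ : Form L} (x : ℕ) (hφ : Gable.{u, v, w} φ) : Gable.{u, v, w} (all x φ) := by
  obtain ⟨y, -, hy⟩ := exists_lt (insert x φ.vars) 0
  have hyφ : y ∉ φ.vars := fun h => (hy y (by simp [h])).false
  have hyx : y ≠ x := (hy x (by simp)).ne'
  have hx : x ∉ (φ.fv.erase x).toList := by simp
  have hyz : y ∉ (φ.fv.erase x).toList := by
    simpa using fun _ h => hyφ (φ.fv_subset_vars h)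
  refine of_red ((Red.all_sim (y := y) hx ?_ (by simp) hyx hyz hyφ).trans
    (Red.ex_congr x (Red.all_and_split fun h => hyφ (φ.fv_subset_vars h))))
    (((all_inc ?_).and hφ).ex x)
  · intro z hz
    by_cases h : z = x <;> simp [h, hz]
  · simp only [List.mem_append, List.mem_singleton, not_or]
    exact ⟨hyz, hyx⟩

/-- The existential prefix moves over the disjunction, and `∀y M ∨ ψ` becomes `∃p ∃q ∀y ((M ∧ p = q)
∨ (ψ ∧ ¬ p = q))`. Here `M ∧ p = q` is `Eable`, and the closure under quantifiers handles the
prefix, so only a disjunction with an `Eable` side is left. -/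
theorem or_of_forall {φ ψ : Form L} (hφ : Gable.{u, v, w} φ)
    (h : ∀ χ β : Form L, Eable.{u, v, w} χ → β.IsQF → Gable.{u, v, w} (or χ (.and ψ β))) :
    Gable.{u, v, w} (or φ ψ) := by
  obtain ⟨K, hK⟩ := hφ
  obtain ⟨y, hyK, hy⟩ := exists_lt ψ.vars K
  obtain ⟨B, -, hB⟩ := exists_lt ψ.fv 0
  obtain ⟨ws, xs, ps, qs, α, ⟨-, -, -, hps, hqs, hα⟩, hxB, hr⟩ := hK y hyK B
  have hfv : ∀ z ∈ ws ++ xs, z ∉ ψ.fv := fun z hz hz' => absurd (hB z hz') (hxB z hz).not_gt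
  have hM : Eable.{u, v, w} (.and (conj (incs ps)) (.and (conj (incsWith y qs)) α)) := by
    refine (Eable.conj fun χ hχ => ?_).and ((Eable.conj fun χ hχ => ?_).and (.of_isQF hα))
    · obtain ⟨a, ha, rfl⟩ := List.mem_map.1 hχ
      exact .inc (hps a ha).1
    · obtain ⟨a, ha, rfl⟩ := List.mem_map.1 hχ
      exact .inc (by simp [(hqs a ha).1])
  obtain ⟨p, -, hp⟩ := exists_lt (insert y
    ((.and (conj (incs ps)) (.and (conj (incsWith y qs)) α) : Form L).vars ∪ ψ.vars)) 0
  refine of_red ((hr.or_congr (Red.refl ψ)).trans ((Red.exs_or fun z hz => hfv z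
    (List.mem_append_left _ hz)).trans (Red.exs_congr _ ((Red.exs_or fun z hz => hfv z
    (List.mem_append_right _ hz)).trans (Red.exs_congr _ (Red.all_or (p := p) (q := p + 1)
      (fun h => (hy y (ψ.fv_subset_vars h)).false) (by simp) (fun h => (hp _ h).false)
      (fun h => absurd (hp _ h) (Nat.lt_succ_self p).not_gt)))))))
    ((((((h _ _ (hM.and (.of_isQF ?_)) ?_).all y).ex _).ex _).exs xs).exs ws)
  · trivial
  · trivial

theorem or_eable {φ ψ : Form L} (hφ : Gable.{u, v, w} φ) (hψ : Eable.{u, v, w} ψ) :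
    Gable.{u, v, w} (or φ ψ) :=
  hφ.or_of_forall fun _ _ hχ hβ => of_eable (hχ.or (hψ.and (.of_isQF hβ)))

/-- One application removes the universal quantifier from the left side; exchanging the sides leads
to the case of an `Eable` right side. -/
theorem or {φ ψ : Form L} (hφ : Gable.{u, v, w} φ) (hψ : Gable.{u, v, w} ψ) :
    Gable.{u, v, w} (or φ ψ) :=
  hφ.or_of_forall fun _ _ hχ hβ => of_red (Red.or_comm _ _)
    ((hψ.and (of_eable (.of_isQF hβ))).or_eable hχ)

end Gable

end IncLogic

/-! ### Negations of first-order formulas -/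

namespace IncLogic

open Language Form

variable {L : FirstOrder.Language.{u, v}}

namespace Deriv

variable {Γ : Set (Form L)} {φ ψ : Form L}

/-- Proof by contradiction admits first-order side assumptions only, while `Γ` is arbitrary. So this
law and the next ones are derived from the negated formula alone and brought into `Γ` by a cut. -/
theorem not_not (hφ : φ.IsFO) (h : Deriv Γ (neg (neg φ))) : Deriv Γ φ :=
  h.cut (raa (Δ := {neg (neg φ)}) hφ subset_rfl (by simpa [IsFO]) (negE (α := neg φ) hφ trivial
    (ass_insert hφ) (ass (by exact hφ) (by simp))))

theorem not_and (hφ : φ.IsFO) (hψ : ψ.IsFO) (h : Deriv Γ (neg (and φ ψ))) :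
    Deriv Γ (or (neg φ) (neg ψ)) := by
  have h₀ : (neg (and φ ψ)).IsFO := ⟨hφ, hψ⟩
  have h₁ : (or (neg φ) (neg ψ)).IsFO := ⟨hφ, hψ⟩
  have key : Deriv {neg (or (neg φ) (neg ψ)), neg (and φ ψ)} (and φ ψ) := by
    refine andI (raa (Δ := {neg (or (neg φ) (neg ψ))}) hφ (by simp) ?_
      (negE (α := or (neg φ) (neg ψ)) h₁ trivial (orI1 hψ (ass_insert hφ))
        (ass (by exact h₁) (by simp))))
      (raa (Δ := {neg (or (neg φ) (neg ψ))}) hψ (by simp) ?_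
      (negE (α := or (neg φ) (neg ψ)) h₁ trivial (orI2 hφ (ass_insert hψ))
        (ass (by exact h₁) (by simp))))
    all_goals rintro _ rfl; exact h₁
  refine h.cut (raa (Δ := {neg (and φ ψ)}) h₁ subset_rfl ?_
    (negE (α := and φ ψ) h₀ trivial key (ass (by exact h₀) (by simp))))
  rintro _ rfl; exact h₀

theorem not_or (hφ : φ.IsFO) (hψ : ψ.IsFO) (h : Deriv Γ (neg (or φ ψ))) :
    Deriv Γ (and (neg φ) (neg ψ)) := by
  have h₀ : (or φ ψ).IsFO := ⟨hφ, hψ⟩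
  refine h.cut (andI (negI (Δ := {neg (or φ ψ)}) hφ subset_rfl ?_ (negE (α := or φ ψ) h₀ trivial
      (orI1 hψ.wf (ass_insert hφ.wf)) (ass (by exact h₀) (by simp))))
    (negI (Δ := {neg (or φ ψ)}) hψ subset_rfl ?_ (negE (α := or φ ψ) h₀ trivial
      (orI2 hφ.wf (ass_insert hψ.wf)) (ass (by exact h₀) (by simp)))))
  all_goals rintro _ rfl; exact h₀

theorem not_ex {x : ℕ} (hφ : φ.IsFO) (h : Deriv Γ (neg (ex x φ))) : Deriv Γ (all x (neg φ)) := by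
  refine h.cut (allI (Δ := {neg (ex x φ)}) subset_rfl (by simp [fv]) (negI (Δ := {neg (ex x φ)}) hφ
    subset_rfl ?_ (negE (α := ex x φ) hφ trivial (ass_insert hφ.wf).exI_self
      (ass (by exact hφ) (by simp)))))
  rintro _ rfl; exact hφ

theorem not_all {x : ℕ} (hφ : φ.IsFO) (h : Deriv Γ (neg (all x φ))) :
    Deriv Γ (ex x (neg φ)) := by
  have hn : (neg (ex x (neg φ))).IsFO := hφ
  have key : Deriv {neg (ex x (neg φ)), neg (all x φ)} (all x φ) := by
    refine allI (Δ := {neg (ex x (neg φ))}) (by simp) (by simp [fv])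
      (raa (Δ := {neg (ex x (neg φ))}) hφ subset_rfl ?_ (negE (α := ex x (neg φ)) hφ trivial
        (exI_self (ass_insert hφ)) (ass (by exact hφ) (by simp))))
    rintro _ rfl; exact hn
  refine h.cut (raa (Δ := {neg (all x φ)}) (by exact hφ) subset_rfl ?_
    (negE (α := all x φ) hφ trivial key (ass (by exact hφ) (by simp))))
  rintro _ rfl; exact hφ

end Deriv

namespace Gable

/-- A formula and its negation are treated together, because pushing a negation inwards calls for
the negations of the parts. -/
theorem of_isFO {φ : Form L} (h : φ.IsFO) :
    Gable.{u, v, w} φ ∧ Gable.{u, v, w} (neg φ) := by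
  induction φ with
  | bot => exact ⟨of_eable (.of_isQF trivial), of_eable (.of_isQF trivial)⟩
  | eq t s => exact ⟨of_eable (.of_isQF trivial), of_eable (.of_isQF trivial)⟩
  | rel R ts => exact ⟨of_eable (.of_isQF trivial), of_eable (.of_isQF trivial)⟩
  | inc => exact h.elim
  | neg φ ih =>
    exact ⟨(ih h).2, of_red (.of_isFO (ψ := φ) h h (fun _ => Deriv.not_not h)
      (fun M _ s => by simp [Holds]) subset_rfl) (ih h).1⟩
  | and φ ψ ih ih' =>
    exact ⟨(ih h.1).1.and (ih' h.2).1, of_red (.of_isFO (ψ := (.or (neg φ) (neg ψ))) h h (fun _ => Deriv.not_and h.1 h.2)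
      (fun M _ s => by simp only [Holds]; tauto) subset_rfl) ((ih h.1).2.or (ih' h.2).2)⟩
  | or φ ψ ih ih' =>
    exact ⟨(ih h.1).1.or (ih' h.2).1, of_red (.of_isFO (ψ := (.and (neg φ) (neg ψ))) h h (fun _ => Deriv.not_or h.1 h.2)
      (fun M _ s => by simp only [Holds]; tauto) subset_rfl) ((ih h.1).2.and (ih' h.2).2)⟩
  | ex x φ ih =>
    exact ⟨(ih h).1.ex x, of_red (.of_isFO (ψ := (.all x (neg φ))) h h (fun _ => Deriv.not_ex h)
      (fun M _ s => by simp [Holds]) subset_rfl) ((ih h).2.all x)⟩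
  | all x φ ih =>
    exact ⟨(ih h).1.all x, of_red (.of_isFO (ψ := (.ex x (neg φ))) h h (fun _ => Deriv.not_all h)
      (fun M _ s => by simp [Holds]) subset_rfl) ((ih h).2.ex x)⟩

theorem of_wf {φ : Form L} (h : φ.WF) : Gable.{u, v, w} φ := by
  induction φ with
  | bot => exact of_eable (.of_isQF trivial)
  | eq t s => exact of_eable (.of_isQF trivial)
  | rel R ts => exact of_eable (.of_isQF trivial)
  | inc => exact of_eable (.inc h)
  | neg φ => exact (of_isFO h).2
  | and φ ψ ih ih' => exact (ih h.1).and (ih' h.2)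
  | or φ ψ ih ih' => exact (ih h.1).or (ih' h.2)
  | ex x φ ih => exact (ih h).ex x
  | all x φ ih => exact (ih h).all x

end Gable

/-! ### From formulas to the data of a normal form -/

theorem exists_relabel_eq {V : Type} {f : V → ℕ} (t : L.Term ℕ)
    (h : ∀ z ∈ t.varFinset, z ∈ Set.range f) : ∃ t' : L.Term V, t'.relabel f = t := by
  induction t with
  | var z =>
    obtain ⟨a, rfl⟩ := h z (by simp [Term.varFinset])
    exact ⟨.var a, rfl⟩
  | func F ts ih =>
    choose ts' hts using fun i => ih i fun z hz =>
      h z (by simpa [Term.varFinset] using ⟨i, hz⟩)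
    exact ⟨.func F ts', by simp [Term.relabel, hts]⟩

theorem Form.IsQF.exists_inst_eq {V : Type} {f : V → ℕ} {φ : Form L} (hφ : φ.IsQF)
    (h : ∀ z ∈ φ.fv, z ∈ Set.range f) : ∃ β : QF L V, β.inst f = φ := by
  induction φ with
  | bot => exact ⟨.bot, rfl⟩
  | eq t s =>
    obtain ⟨t', rfl⟩ := exists_relabel_eq t fun z hz => h z (Finset.mem_union_left _ hz)
    obtain ⟨s', rfl⟩ := exists_relabel_eq s fun z hz => h z (Finset.mem_union_right _ hz)
    exact ⟨.eq t' s', rfl⟩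
  | rel R ts =>
    choose ts' hts using fun i => exists_relabel_eq (ts i) fun z hz =>
      h z (Finset.mem_biUnion.2 ⟨i, Finset.mem_univ _, hz⟩)
    exact ⟨.rel R ts', by simp [QF.inst, hts]⟩
  | inc => exact hφ.elim
  | neg φ ih =>
    obtain ⟨β, rfl⟩ := ih hφ h
    exact ⟨.neg β, rfl⟩
  | and φ ψ ih ih' =>
    obtain ⟨β, rfl⟩ := ih hφ.1 fun z hz => h z (Finset.mem_union_left _ hz)
    obtain ⟨γ, rfl⟩ := ih' hφ.2 fun z hz => h z (Finset.mem_union_right _ hz)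
    exact ⟨.and β γ, rfl⟩
  | or φ ψ ih ih' =>
    obtain ⟨β, rfl⟩ := ih hφ.1 fun z hz => h z (Finset.mem_union_left _ hz)
    obtain ⟨γ, rfl⟩ := ih' hφ.2 fun z hz => h z (Finset.mem_union_right _ hz)
    exact ⟨.or β γ, rfl⟩
  | ex | all => exact hφ.elim

theorem exists_embedding {n : ℕ} {us xs : List ℕ} (hn : us.Nodup) (hx : us ⊆ xs)
    (hl : us.length = n) :
    ∃ ρ : Fin n ↪ Fin xs.length, List.ofFn (fun k => xs.get (ρ k)) = us := by
  subst hl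
  choose g hg using fun k : Fin us.length => List.mem_iff_get.1 (hx (us.get_mem k))
  refine ⟨⟨g, fun i j h => List.nodup_iff_injective_get.1 hn ?_⟩, ?_⟩
  · rw [← hg i, ← hg j, h]
  · have : (fun k => xs.get (g k)) = us.get := funext hg
    exact (congrArg List.ofFn this).trans (List.ofFn_get us)

/-- In a sentence the free variables of `α` are bound by the prefix, and `y` is not among them, so
`α` is an instance of a quantifier-free formula over the positions in `ws` and `xs`. -/
theorem Form.GOk.exists_normalForm {ws xs : List ℕ} {y : ℕ} {ps qs : List (List ℕ × List ℕ)}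
    {α : Form L} (h : GOk ws xs y ps qs α) (hfv : (gForm ws xs y ps qs α).fv = ∅) :
    ∃ N : NormalForm L, N.sentence = gForm ws xs y ps qs α := by
  obtain ⟨hn, hyx, hyα, hps, hqs, hα⟩ := h
  have hα' : ∀ z ∈ α.fv, z ∈ Set.range (Sum.elim ws.get xs.get) := by
    intro z hz
    have hzy : z ≠ y := fun e => hyα (e ▸ hz)
    have : z ∉ (gForm ws xs y ps qs α).fv := by simp [hfv]
    simp only [gForm, mem_fv_exs, fv, Finset.mem_erase, Finset.mem_union, hz] at this
    rw [Set.Sum.elim_range, Set.range_list_get, Set.range_list_get]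
    by_contra hc
    simp only [Set.mem_union, Set.mem_ofPred_eq, _root_.not_or] at hc
    exact this ⟨⟨⟨hzy, .inr (.inr trivial)⟩, hc.2⟩, hc.1⟩
  obtain ⟨β, hβ⟩ := hα.exists_inst_eq hα'
  choose ρ hρ using fun i : Fin ps.length =>
    exists_embedding (hps _ (ps.get_mem i)).2.1 (hps _ (ps.get_mem i)).2.2.2.1 rfl
  choose σ hσ using fun i : Fin ps.length =>
    exists_embedding (hps _ (ps.get_mem i)).2.2.1 (hps _ (ps.get_mem i)).2.2.2.2
      (hps _ (ps.get_mem i)).1.symm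
  choose π hπ using fun i : Fin qs.length =>
    exists_embedding (hqs _ (qs.get_mem i)).2.1 (hqs _ (qs.get_mem i)).2.2.2.1 rfl
  choose τ hτ using fun i : Fin qs.length =>
    exists_embedding (hqs _ (qs.get_mem i)).2.2.1 (hqs _ (qs.get_mem i)).2.2.2.2
      (hqs _ (qs.get_mem i)).1
  refine ⟨⟨ws.length, xs.length, ws.get, xs.get, y, ?_, ps.length, _, ρ, σ, qs.length, _, π, τ, β⟩,
    ?_⟩
  · rw [List.ofFn_get, List.ofFn_get]
    exact hn.append (by simp) (by simpa using hyx)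
  · simp only [NormalForm.sentence, hρ, hσ, hπ, hτ, hβ, gForm, incs, incsWith]
    simp only [List.ofFn_get]
    congr 5
    · conv_rhs => rw [← List.ofFn_get ps, List.map_ofFn]
      rfl
    · conv_rhs => rw [← List.ofFn_get qs, List.map_ofFn]
      rfl

theorem NormalForm.wf_sentence (N : NormalForm L) : N.sentence.WF := by
  refine wf_exs.2 (wf_exs.2 ⟨wf_conj.2 ?_, wf_conj.2 ?_, (QF.isFO_inst _ _).wf⟩)
  · intro φ hφ
    obtain ⟨i, rfl⟩ := List.mem_ofFn.1 hφ
    simp [WF]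
  · intro φ hφ
    obtain ⟨i, rfl⟩ := List.mem_ofFn.1 hφ
    simp [WF]

theorem Form.IsSentence.exists_red_normalForm {φ : Form L} (h : φ.IsSentence) :
    ∃ N : NormalForm L, Red.{u, v, w} φ N.sentence := by
  obtain ⟨K, hK⟩ := Gable.of_wf.{u, v, w} h.1
  obtain ⟨ws, xs, ps, qs, α, hok, -, hr⟩ := hK K le_rfl 0
  obtain ⟨N, hN⟩ := hok.exists_normalForm (Finset.subset_empty.1 (h.2 ▸ hr.fv_subset))
  exact ⟨N, hN ▸ hr⟩

end IncLogic

theorem lemma6p1 (L : FirstOrder.Language.{u, v}) :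
    -- sentences in normal form
    (∀ (N : IncLogic.NormalForm L) (n : ℕ),
      IncLogic.Deriv {N.sentence} (N.approx n)) ∧
    -- arbitrary sentences, with the approximations of the game expression of a normal form
    (∀ φ : IncLogic.Form L, φ.IsSentence →
      ∃ N : IncLogic.NormalForm L,
        IncLogic.Form.SemEquiv.{u, v, w} φ N.sentence ∧
        ∀ n : ℕ, IncLogic.Deriv {φ} (N.approx n)) := by
  refine ⟨fun N n => N.deriv_approx (.ass N.wf_sentence (Set.mem_singleton _)) n, fun φ hφ => ?_⟩
  obtain ⟨N, hN⟩ := hφ.exists_red_normalForm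
  exact ⟨N, hN.sem, fun n => N.deriv_approx (hN.deriv _ (.ass hφ.1 (Set.mem_singleton _))) n⟩
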